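/- Let $\mu$ denote the product measure $\bigotimes_{j=1}^d\frac{\lambda}{2}$ on $[-1,1]^d$, where $\lambda$ is the Lebesgue measure on $[-1,1]$. For $\boldsymbol\delta\in(0,\infty)^d$ let $\mathcal B_{\boldsymbol\delta}([-1,1])=\{z\in\mathbb C^d:\forall j\ \exists y\in[-1,1],\ |z_j-y|<\delta_j\}$, and write $x_{[k]}=(x_1,\dots,x_k)$. Let $0<M<L<\infty$. There exist constants $C_6,C_7>0$ depending only on $M$ and $L$ such that the following holds for all $d\in\mathbb N$, $d\ge 1$, all $\boldsymbol\delta\in(0,\infty)^d$ and all $f_\rho,f_\pi$. Assume that for each $*\in\{\rho,\pi\}$: (a) $f_*:[-1,1]^d\to(0,\infty)$ is measurable with $\int f_*\,d\mu=1$, and $f_*$ extends to a complex continuously differentiable function (again denoted $f_*$) on $\mathcal B_{\boldsymbol\delta}([-1,1])$; (b) $M\le|f_*(z)|\le L$ for all $z\in\mathcal B_{\boldsymbol\delta}([-1,1])$; (c) $|f_*(x+y)-f_*(x)|\le C_6$ for all $x\in[-1,1]^d$ and all $y\in\mathbb C^d$ with $|y_j|<\delta_j$ for all $j$; (d) for every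 $k\in\{1,\dots,d-1\}$, $|f_*(x+y)-f_*(x)|\le C_6\delta_{k+1}$ for all $x\in[-1,1]^d$ and all $y\in\mathbb C^d$ with $|y_j|<\delta_j$ for $j\le k$ and $y_j=0$ for $j>k$. Let $T=(T_k)_{k=1}^d$ be the Knothe--Rosenblatt transport from $f_\rho\,d\mu$ to $f_\pi\,d\mu$, i.e., recursively $T_k(x_{[k-1]},\cdot)=F_{\pi;k}(T_1(x_1),\dots,T_{k-1}(x_{[k-1]}),\cdot)^{-1}\circ F_{\rho;k}(x_{[k-1]},\cdot)$ on $[-1,1]$, where $F_{*;k}(x_{[k]})=\int_{-1}^{x_k}\frac{\hat f_{*,k}(x_{[k-1]},t)}{\hat f_{*,k-1}(x_{[k-1]})}\,dt$ and $\hat f_{*,k}$ is the marginal of $f_*$ (w.r.t. $\mu$) in the first $k$ variables. Then $T$ is a bijection of $[-1,1]^d$ that is triangular ($T_k$ depends only on $x_{[k]}$) and monotone ($T_k$ is strictly increasing in $x_k$). Let $S=T^{-1}$ be its inverse. Set $$\xi_j=1+C_7\delta_j,\qquad \beta=\Big((d-1)!\prod_{j=1}^d\log\xi_j\Big)^{1/d},$$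 $$\Lambda_{k,\varepsilon}=\Big\{\nu\in\mathbb N_0^k:\ \xi_k^{-\max\{1,\nu_k\}}\prod_{j=1}^{k-1}\xi_j^{-\nu_j}\ge\varepsilon\Big\},\qquad N_\varepsilon=\sum_{k=1}^d|\Lambda_{k,\varepsilon}|,$$ and let $\mathbb P_{\Lambda_{k,\varepsilon}}$ be the real span of the monomials $x^\nu$, $\nu\in\Lambda_{k,\varepsilon}$ ($\{0\}$ if $\Lambda_{k,\varepsilon}=\emptyset$). Then for every $m\in\mathbb N_0$ and every $\tau\in(0,1)$ there exists $C=C(\boldsymbol\xi,m,d,\tau,f_\rho,f_\pi)>0$ such that for every $\varepsilon\in(0,1)$ there exist polynomials $p_k\in\mathbb P_{\Lambda_{k,\varepsilon}}$, $k\in\{1,\dots,d\}$, with the following property. With $$\tilde T_k(x_{[k]})=-1+\frac{2}{c_k(x_{[k-1]})}\int_{-1}^{x_k}\big(1+p_k(x_{[k-1]},t)\big)^2\,dt,\qquad c_k(x_{[k-1]})=\int_{-1}^{1}\big(1+p_k(x_{[k-1]},t)\big)^2\,dt,$$ the map $\tilde T=(\tilde T_k)_{k=1}^d$ is a monotone triangular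 bijection of $[-1,1]^d$, and $$\|T_k-\tilde T_k\|_{W^{m,\infty}([-1,1]^d)}\le C\exp\big(-\tau\beta N_\varepsilon^{1/d}\big)\qquad\text{for all }k\in\{1,\dots,d\},$$ where $\|u\|_{W^{m,\infty}}=\max_{|\nu|\le m}\|\partial^\nu u\|_{L^\infty}$. The same holds with $T$ replaced by $S$: for every $\varepsilon\in(0,1)$ there are (other) polynomials $p_k\in\mathbb P_{\Lambda_{k,\varepsilon}}$ such that the maps $\tilde S_k$, defined from them by the same formula, form a monotone triangular bijection $\tilde S$ of $[-1,1]^d$ and satisfy $\|S_k-\tilde S_k\|_{W^{m,\infty}([-1,1]^d)}\le C\exp(-\tau\beta N_\varepsilon^{1/d})$ for all $k$. -/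

import Mathlib

noncomputable section

open scoped NNReal ENNReal ContDiff

namespace KRApprox

open MeasureTheory Set

/-- The closed cube `[-1,1]^d`. -/
def cube (d : ℕ) : Set (Fin d → ℝ) := {x | ∀ j, x j ∈ Icc (-1 : ℝ) 1}

/-- The open cube `(-1,1)^d`. -/
def openCube (d : ℕ) : Set (Fin d → ℝ) := {x | ∀ j, x j ∈ Ioo (-1 : ℝ) 1}

/-- The `d`-fold product of the measure `λ / 2`, with `λ` the Lebesgue measure on `[-1,1]`. -/
def cubeMeasure (d : ℕ) : Measure (Fin d → ℝ) :=
  Measure.pi fun _ => (2 : ℝ≥0)⁻¹ • (volume : Measure ℝ).restrict (Icc (-1) 1)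

/-! ### Assumptions on the densities -/

/-- `f` restricts to a positive probability density on `[-1,1]^d` with respect to `cubeMeasure`. -/
structure IsProbDensity {d : ℕ} (f : (Fin d → ℝ) → ℝ) : Prop where
  measurable : Measurable fun x : cube d => f x
  pos : ∀ x ∈ cube d, 0 < f x
  integral_eq_one : ∫ x, f x ∂(cubeMeasure d) = 1

/-- The product over `j` of the complex `δ j`-neighbourhoods of `[-1,1]`. -/
def complexNhd {d : ℕ} (δ : Fin d → ℝ) : Set (Fin d → ℂ) :=
  {z | ∀ j, ∃ y ∈ Icc (-1 : ℝ) 1, ‖z j - (y : ℂ)‖ < δ j}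

/-- A real vector, seen as a complex one. -/
def toComplex {d : ℕ} (x : Fin d → ℝ) : Fin d → ℂ := fun j => (x j : ℂ)

/-- The regularity assumption on one density `f`, with constants `M`, `L`, `C₆` and radii `δ`:
`f` is a probability density on `[-1,1]^d` that has a complex differentiable extension `F` to the
neighbourhood `complexNhd δ`, with two-sided bounds and smallness conditions on its variation.
In the last condition coordinates are counted from `0`: only the coordinates `j < k` are
perturbed, and the bound involves the radius of the next coordinate `k`. -/
def DensityAssumption {d : ℕ} (M L C₆ : ℝ) (δ : Fin d → ℝ) (f : (Fin d → ℝ) → ℝ) : Prop :=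
  IsProbDensity f ∧
  ∃ F : (Fin d → ℂ) → ℂ,
    (∀ x ∈ cube d, F (toComplex x) = (f x : ℂ)) ∧
    ContDiffOn ℂ 1 F (complexNhd δ) ∧
    (∀ z ∈ complexNhd δ, M ≤ ‖F z‖ ∧ ‖F z‖ ≤ L) ∧
    (∀ x ∈ cube d, ∀ y : Fin d → ℂ, (∀ j, ‖y j‖ < δ j) →
      ‖F (toComplex x + y) - F (toComplex x)‖ ≤ C₆) ∧
    (∀ k : Fin d, 0 < (k : ℕ) → ∀ x ∈ cube d, ∀ y : Fin d → ℂ,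
      (∀ j, j < k → ‖y j‖ < δ j) → (∀ j, k ≤ j → y j = 0) →
        ‖F (toComplex x + y) - F (toComplex x)‖ ≤ C₆ * δ k)

/-! ### The Knothe–Rosenblatt transport -/

/-- The marginal density of the first `k` variables, as a function of the full vector `x` (of which
only the first `k` coordinates enter). The integration variable `t` runs over the whole cube; its
first `k` coordinates do not enter the integrand, and the measure has total mass one. -/
def marginal {d : ℕ} (f : (Fin d → ℝ) → ℝ) (k : ℕ) (x : Fin d → ℝ) : ℝ :=
  ∫ t, f (fun j => if (j : ℕ) < k then x j else t j) ∂(cubeMeasure d)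

/-- The density of the variable `k` (counted from `0`) conditioned on the variables before it. -/
def condDensity {d : ℕ} (f : (Fin d → ℝ) → ℝ) (k : Fin d) (x : Fin d → ℝ) : ℝ :=
  marginal f (k + 1) x / marginal f k x

/-- The conditional distribution function `s ↦ ∫_{-1}^s f_k(x_0, …, x_{k-1}, t) dt`. -/
def condCDF {d : ℕ} (f : (Fin d → ℝ) → ℝ) (k : Fin d) (x : Fin d → ℝ) (s : ℝ) : ℝ :=
  ∫ t in (-1 : ℝ)..s, condDensity f k (Function.update x k t)

/-- The vector whose first `n` coordinates are the first `n` components of the Knothe–Rosenblatt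
map at `x`. Component `n` is obtained from the earlier ones by applying the inverse, on `[-1,1]`,
of the conditional distribution function of the target to the one of the reference. -/
def transportAux {d : ℕ} (fρ fπ : (Fin d → ℝ) → ℝ) (x : Fin d → ℝ) : ℕ → Fin d → ℝ
  | 0 => x
  | n + 1 =>
    if h : n < d then
      Function.update (transportAux fρ fπ x n) ⟨n, h⟩
        (Function.invFunOn (condCDF fπ ⟨n, h⟩ (transportAux fρ fπ x n)) (Icc (-1) 1)
          (condCDF fρ ⟨n, h⟩ x (x ⟨n, h⟩)))
    else transportAux fρ fπ x n

/-- The Knothe–Rosenblatt transport from the measure with density `fρ` to the one with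
density `fπ`. -/
def transport {d : ℕ} (fρ fπ : (Fin d → ℝ) → ℝ) (x : Fin d → ℝ) : Fin d → ℝ :=
  transportAux fρ fπ x d

/-- The inverse on `[-1,1]^d` of the Knothe–Rosenblatt transport. -/
def invTransport {d : ℕ} (fρ fπ : (Fin d → ℝ) → ℝ) : (Fin d → ℝ) → (Fin d → ℝ) :=
  Function.invFunOn (transport fρ fπ) (cube d)

/-- `T` maps `[-1,1]^d` bijectively to itself, its component `k` depends only on the coordinates
up to `k`, and is increasing in the coordinate `k`. -/
structure IsMonotoneTriangularBijection {d : ℕ} (T : (Fin d → ℝ) → (Fin d → ℝ)) : Prop where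
  triangular : ∀ k, ∀ x ∈ cube d, ∀ y ∈ cube d, (∀ j ≤ k, x j = y j) → T x k = T y k
  monotone : ∀ k, ∀ x ∈ cube d,
    StrictMonoOn (fun s => T (Function.update x k s) k) (Icc (-1) 1)
  bijOn : BijOn T (cube d) (cube d)

/-! ### The polynomial spaces and the rational maps -/

/-- The first `k + 1` entries of a vector, that is, those with index `≤ k`. -/
def initialSegment {d : ℕ} (k : Fin d) (x : Fin d → ℝ) : Fin ((k : ℕ) + 1) → ℝ :=
  fun j => x (Fin.castLE k.isLt j)

/-- `γ(ξ, ν) = ξ_n ^ (-max {1, ν_n}) * ∏_{j < n} ξ_j ^ (-ν_j)`, for `n + 1` variables. -/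
def gammaWeight {n : ℕ} (ξ : Fin (n + 1) → ℝ) (ν : Fin (n + 1) →₀ ℕ) : ℝ :=
  (ξ (Fin.last n) ^ max 1 (ν (Fin.last n)))⁻¹ * ∏ j : Fin n, (ξ j.castSucc ^ ν j.castSucc)⁻¹

/-- The set of multi-indices `ν` with `γ(ξ, ν) ≥ ε`, for the variables with index `≤ k`. -/
def indexSet {d : ℕ} (ξ : Fin d → ℝ) (k : Fin d) (ε : ℝ) : Set (Fin ((k : ℕ) + 1) →₀ ℕ) :=
  {ν | ε ≤ gammaWeight (initialSegment k ξ) ν}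

/-- The total number of degrees of freedom. -/
def totalCard {d : ℕ} (ξ : Fin d → ℝ) (ε : ℝ) : ℕ := ∑ k : Fin d, (indexSet ξ k ε).ncard

/-- `β = ((d-1)! ∏_j log ξ_j)^(1/d)`. -/
def rate {d : ℕ} (ξ : Fin d → ℝ) : ℝ :=
  (((d - 1).factorial : ℝ) * ∏ j, Real.log (ξ j)) ^ (1 / (d : ℝ))

/-- `∫_{-1}^s (1 + p(x_0, …, x_{k-1}, t))² dt`. -/
def squareIntegral {d : ℕ} (k : Fin d) (p : MvPolynomial (Fin ((k : ℕ) + 1)) ℝ)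
    (x : Fin d → ℝ) (s : ℝ) : ℝ :=
  ∫ t in (-1 : ℝ)..s, (1 + MvPolynomial.eval (initialSegment k (Function.update x k t)) p) ^ 2

/-- The map with components
`x ↦ -1 + (2 / c_k) ∫_{-1}^{x_k} (1 + p_k(x_0, …, x_{k-1}, t))² dt`,
where `c_k = ∫_{-1}^1 (1 + p_k(x_0, …, x_{k-1}, t))² dt`. -/
def rationalMap {d : ℕ} (p : (k : Fin d) → MvPolynomial (Fin ((k : ℕ) + 1)) ℝ)
    (x : Fin d → ℝ) : Fin d → ℝ :=
  fun k => -1 + 2 / squareIntegral k (p k) x 1 * squareIntegral k (p k) x (x k)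

/-! ### The Sobolev norm -/

/-- The partial derivative in the direction of the coordinate `j`. -/
def partialDeriv {d : ℕ} (j : Fin d) (φ : (Fin d → ℝ) → ℝ) : (Fin d → ℝ) → ℝ :=
  fun x => fderiv ℝ φ x (Pi.single j 1)

/-- The mixed partial derivative `∂_0^{ν_0} ⋯ ∂_{d-1}^{ν_{d-1}} φ`. -/
def mixedPartial {d : ℕ} (ν : Fin d → ℕ) (φ : (Fin d → ℝ) → ℝ) : (Fin d → ℝ) → ℝ :=
  (List.finRange d).foldr (fun j g => (partialDeriv j)^[ν j] g) φ

/-- `v` is the weak derivative of order `ν` of `u` on the open cube. -/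
def IsWeakDeriv {d : ℕ} (ν : Fin d → ℕ) (u v : (Fin d → ℝ) → ℝ) : Prop :=
  LocallyIntegrableOn u (openCube d) ∧ LocallyIntegrableOn v (openCube d) ∧
  ∀ φ : (Fin d → ℝ) → ℝ, ContDiff ℝ ∞ φ → HasCompactSupport φ → tsupport φ ⊆ openCube d →
    ∫ x in openCube d, u x * mixedPartial ν φ x =
      (-1) ^ (∑ j, ν j) * ∫ x in openCube d, v x * φ x

/-- The norm of `W^{m,∞}([-1,1]^d)`: the maximum over `|ν| ≤ m` of the `L^∞` norms of the weak
derivatives of order `ν`. Weak derivatives are unique almost everywhere, so the infimum picks the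
norm of the weak derivative if there is one, and it is `∞` if there is none. -/
def sobolevNorm {d : ℕ} (m : ℕ) (u : (Fin d → ℝ) → ℝ) : ℝ≥0∞ :=
  ⨆ (ν : Fin d → ℕ) (_ : ∑ j, ν j ≤ m),
    ⨅ (v : (Fin d → ℝ) → ℝ) (_ : IsWeakDeriv ν u v),
      eLpNorm v ∞ (volume.restrict (openCube d))

/-- For every `ε ∈ (0,1)` there are polynomials `p_k` in the span of the monomials with exponents in
`Λ_{k,ε}` for which `rationalMap p` is a monotone triangular bijection of the cube whose components
approximate those of `T` in `W^{m,∞}` with error at most `C exp(-τ β N_ε^{1/d})`. -/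
def HasRationalApprox {d : ℕ} (ξ : Fin d → ℝ) (m : ℕ) (τ C : ℝ)
    (T : (Fin d → ℝ) → (Fin d → ℝ)) : Prop :=
  ∀ ε ∈ Ioo (0 : ℝ) 1,
    ∃ p : (k : Fin d) → MvPolynomial (Fin ((k : ℕ) + 1)) ℝ,
      (∀ k, p k ∈ MvPolynomial.restrictSupport ℝ (indexSet ξ k ε)) ∧
      IsMonotoneTriangularBijection (rationalMap p) ∧
      ∀ k, sobolevNorm m (fun x => T x k - rationalMap p x k) ≤
        ENNReal.ofReal
          (C * Real.exp (-(τ * rate ξ * (totalCard ξ ε : ℝ) ^ (1 / (d : ℝ)))))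

end KRApprox

end

/-!
The conditional distribution functions of a density that is holomorphic near the cube are
holomorphic too. By (c) and (d) they move so little under complex perturbations of size `C₇ δ`
that a Rouché type argument solves the equation `F_{π;k}(T_1, …, T_k) = F_{ρ;k}` for a holomorphic
`T_k`, one component after the other, on the neighbourhood with radii `C₇ δ_j`. There
`∂_k T_k = f_ρ / f_π ∘ T`, in terms of conditional densities, stays away from `0`, so it has a
holomorphic square root `R_k`, real and positive on the cube. The inverse transport is the
transport with `f_ρ` and `f_π` exchanged.

The Chebyshev coefficients of `R_k - 1` decay like `∏_j ξ_j ^ (-ν_j)`. Truncating the expansion to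
`Λ_{k,ε}` leaves an error of order `ε ^ τ`, where `τ < 1` pays for evaluating off the cube: on a
small complex neighbourhood Cauchy's estimates control all derivatives of
`T_k = -1 + 2 ∫ R_k² / ∫ R_k²`, a formula that is stable under replacing `R_k` by `1 + p_k`.
Finally, only `Λ_{d,ε}` contributes to `N_ε` to leading order, and comparing it with a simplex of
volume `(log ε⁻¹ / β) ^ d / d`, up to lower order terms, bounds `β N_ε ^ (1/d)` by `log ε⁻¹` plus a
constant.
-/

noncomputable section

open scoped NNReal ENNReal ContDiff Topology

namespace KRApprox

open MeasureTheory Set Metric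

/-! ### Parametric integrals over compact sets -/

section ParametricIntegral

variable {𝕜 E E' X G : Type*} [RCLike 𝕜]

lemma exists_closedBall_bound [PseudoMetricSpace E] [ProperSpace E] [TopologicalSpace X]
    [SeminormedAddCommGroup G] {K : Set X} {U : Set E} (hK : IsCompact K) (hU : IsOpen U)
    {Ψ : E → X → G} (hΨ : ContinuousOn (Function.uncurry Ψ) (U ×ˢ K)) {z : E} (hz : z ∈ U) :
    ∃ r > 0, closedBall z r ⊆ U ∧ ∃ C, ∀ w ∈ closedBall z r, ∀ t ∈ K, ‖Ψ w t‖ ≤ C := by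
  obtain ⟨r, hr, hrU⟩ := nhds_basis_closedBall.mem_iff.1 (hU.mem_nhds hz)
  obtain ⟨C, hC⟩ := ((isCompact_closedBall z r).prod hK).exists_bound_of_continuousOn
    (hΨ.mono (prod_mono hrU subset_rfl))
  exact ⟨r, hr, hrU, C, fun w hw t ht => hC (w, t) ⟨hw, ht⟩⟩

variable [NormedAddCommGroup E] [NormedAddCommGroup E'] [NormedAddCommGroup G]

lemma contDiffOn_one_iff_differentiableOn_continuousOn_fderiv [NormedSpace 𝕜 E] [NormedSpace 𝕜 G]
    {F : E → G} {U : Set E} (hU : IsOpen U) :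
    ContDiffOn 𝕜 1 F U ↔ DifferentiableOn 𝕜 F U ∧ ContinuousOn (fderiv 𝕜 F) U := by
  rw [← zero_add 1, contDiffOn_succ_iff_fderiv_of_isOpen hU]
  simp [contDiffOn_zero]

variable [ProperSpace E] [TopologicalSpace X] [SecondCountableTopology X] [MeasurableSpace X]
  [OpensMeasurableSpace X] {μ : Measure X} [IsFiniteMeasureOnCompacts μ] {K : Set X} {U : Set E}

lemma continuousOn_setIntegral [NormedSpace ℝ G] (hK : IsCompact K) (hKm : MeasurableSet K)
    (hU : IsOpen U) {Ψ : E → X → G} (hΨ : ContinuousOn (Function.uncurry Ψ) (U ×ˢ K)) :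
    ContinuousOn (fun z => ∫ t in K, Ψ z t ∂μ) U := by
  intro z hz
  obtain ⟨r, hr, -, C, hC⟩ := exists_closedBall_bound hK hU hΨ hz
  refine ContinuousAt.continuousWithinAt (continuousAt_of_dominated (bound := fun _ => C) ?_ ?_
    (integrableOn_const hK.measure_ne_top) ?_)
  · filter_upwards [hU.mem_nhds hz] with w hw
    exact (hΨ.uncurry_left w hw).aestronglyMeasurable hKm
  · filter_upwards [closedBall_mem_nhds z hr] with w hw
    exact ae_restrict_of_forall_mem hKm (hC w hw)
  · exact ae_restrict_of_forall_mem hKm fun t ht =>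
      (hΨ.uncurry_right t ht).continuousAt (hU.mem_nhds hz)

variable [NormedSpace 𝕜 E] [NormedSpace 𝕜 E'] [NormedSpace ℝ G] [NormedSpace 𝕜 G]

lemma hasFDerivAt_setIntegral (hK : IsCompact K) (hKm : MeasurableSet K) (hU : IsOpen U)
    {Φ : E → X → G} {Φ' : E → X → E →L[𝕜] G}
    (hd : ∀ z ∈ U, ∀ t ∈ K, HasFDerivAt (fun w => Φ w t) (Φ' z t) z)
    (hΦ : ContinuousOn (Function.uncurry Φ) (U ×ˢ K))
    (hΦ' : ContinuousOn (Function.uncurry Φ') (U ×ˢ K)) {z : E} (hz : z ∈ U) :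
    HasFDerivAt (fun w => ∫ t in K, Φ w t ∂μ) (∫ t in K, Φ' z t ∂μ) z := by
  obtain ⟨r, hr, hrU, C, hC⟩ := exists_closedBall_bound hK hU hΦ' hz
  refine hasFDerivAt_integral_of_dominated_of_fderiv_le (bound := fun _ => C)
    (closedBall_mem_nhds z hr) ?_ ((hΦ.uncurry_left z hz).integrableOn_compact' hK hKm)
    ((hΦ'.uncurry_left z hz).aestronglyMeasurable hKm)
    (ae_restrict_of_forall_mem hKm fun t ht w hw => hC w hw t ht)
    (integrableOn_const hK.measure_ne_top)
    (ae_restrict_of_forall_mem hKm fun t ht w hw => hd w (hrU hw) t ht)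
  filter_upwards [hU.mem_nhds hz] with w hw
  exact (hΦ.uncurry_left w hw).aestronglyMeasurable hKm

lemma contDiffOn_setIntegral (hK : IsCompact K) (hKm : MeasurableSet K) (hU : IsOpen U)
    {Φ : E → X → G} {Φ' : E → X → E →L[𝕜] G}
    (hd : ∀ z ∈ U, ∀ t ∈ K, HasFDerivAt (fun w => Φ w t) (Φ' z t) z)
    (hΦ : ContinuousOn (Function.uncurry Φ) (U ×ˢ K))
    (hΦ' : ContinuousOn (Function.uncurry Φ') (U ×ˢ K)) :
    ContDiffOn 𝕜 1 (fun w => ∫ t in K, Φ w t ∂μ) U := by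
  have hderiv := fun z hz => hasFDerivAt_setIntegral (μ := μ) hK hKm hU hd hΦ hΦ' (z := z) hz
  rw [contDiffOn_one_iff_differentiableOn_continuousOn_fderiv hU]
  refine ⟨fun z hz => (hderiv z hz).differentiableAt.differentiableWithinAt, ?_⟩
  exact (continuousOn_setIntegral hK hKm hU hΦ').congr fun z hz => (hderiv z hz).fderiv

lemma contDiffOn_setIntegral_comp_affine (hK : IsCompact K) (hKm : MeasurableSet K)
    (hU : IsOpen U) {F : E' → G} {V : Set E'} (hV : IsOpen V) (hF : ContDiffOn 𝕜 1 F V)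
    {A : X → E →L[𝕜] E'} (hA : ContinuousOn A K) {c : X → E'} (hc : ContinuousOn c K)
    {φ : X → 𝕜} (hφ : ContinuousOn φ K) (hmem : ∀ z ∈ U, ∀ t ∈ K, A t z + c t ∈ V) :
    ContDiffOn 𝕜 1 (fun z => ∫ t in K, φ t • F (A t z + c t) ∂μ) U := by
  have hsnd : MapsTo (Prod.snd : E × X → X) (U ×ˢ K) K := fun q hq => hq.2
  have hφ' := hφ.comp continuousOn_snd hsnd
  have hA' := hA.comp continuousOn_snd hsnd
  have haffine : ContinuousOn (fun q : E × X => A q.2 q.1 + c q.2) (U ×ˢ K) :=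
    (hA'.clm_apply continuousOn_fst).add (hc.comp continuousOn_snd hsnd)
  have hmaps : MapsTo (fun q : E × X => A q.2 q.1 + c q.2) (U ×ˢ K) V :=
    fun q hq => hmem q.1 hq.1 q.2 hq.2
  obtain ⟨hFd, hFc⟩ := (contDiffOn_one_iff_differentiableOn_continuousOn_fderiv hV).1 hF
  refine contDiffOn_setIntegral hK hKm hU
    (Φ' := fun z t => φ t • (fderiv 𝕜 F (A t z + c t)).comp (A t)) (fun z hz t ht => ?_)
    (hφ'.smul (hF.continuousOn.comp haffine hmaps))
    (hφ'.smul ((hFc.comp haffine hmaps).clm_comp hA'))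
  have hFat : HasFDerivAt F (fderiv 𝕜 F (A t z + c t)) (A t z + c t) :=
    (hFd.differentiableAt (hV.mem_nhds (hmem z hz t ht))).hasFDerivAt
  exact (hFat.comp z ((A t).hasFDerivAt.add_const (c t))).const_smul (φ t)

end ParametricIntegral

/-! ### The cube and its complex neighbourhoods -/

/-- The open `r`-neighbourhood of `[-1,1]` in the complex plane, of which `complexNhd` is a
product. -/
def intervalNhd (r : ℝ) : Set ℂ := {z | ∃ y ∈ Icc (-1 : ℝ) 1, ‖z - (y : ℂ)‖ < r}

lemma intervalNhd_eq_thickening (r : ℝ) :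
    intervalNhd r = thickening r ((fun y : ℝ => (y : ℂ)) '' Icc (-1) 1) := by
  ext z
  simp [intervalNhd, mem_thickening_iff, dist_eq_norm]

lemma isOpen_intervalNhd (r : ℝ) : IsOpen (intervalNhd r) := by
  rw [intervalNhd_eq_thickening]
  exact isOpen_thickening

lemma convex_intervalNhd (r : ℝ) : Convex ℝ (intervalNhd r) := by
  rw [intervalNhd_eq_thickening]
  exact ((convex_Icc (-1 : ℝ) 1).linear_image Complex.ofRealCLM.toLinearMap).thickening r

lemma intervalNhd_mono {r s : ℝ} (h : r ≤ s) : intervalNhd r ⊆ intervalNhd s :=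
  fun _ ⟨y, hy, hz⟩ => ⟨y, hy, hz.trans_le h⟩

lemma ofReal_mem_intervalNhd {r : ℝ} (hr : 0 < r) {x : ℝ} (hx : x ∈ Icc (-1 : ℝ) 1) :
    (x : ℂ) ∈ intervalNhd r := ⟨x, hx, by simpa using hr⟩

section Cube

variable {d : ℕ}

lemma complexNhd_eq_pi (δ : Fin d → ℝ) :
    complexNhd δ = Set.pi univ fun j => intervalNhd (δ j) := by
  ext z
  simp [complexNhd, intervalNhd]

lemma mem_complexNhd_iff {δ : Fin d → ℝ} {z : Fin d → ℂ} :
    z ∈ complexNhd δ ↔ ∀ j, z j ∈ intervalNhd (δ j) := Iff.rfl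

lemma isOpen_complexNhd (δ : Fin d → ℝ) : IsOpen (complexNhd δ) := by
  rw [complexNhd_eq_pi]
  exact isOpen_set_pi finite_univ fun j _ => isOpen_intervalNhd (δ j)

lemma complexNhd_mono {δ δ' : Fin d → ℝ} (h : ∀ j, δ j ≤ δ' j) :
    complexNhd δ ⊆ complexNhd δ' :=
  fun _ hz j => intervalNhd_mono (h j) (hz j)

lemma exists_mem_cube_norm_sub_lt {δ : Fin d → ℝ} {z : Fin d → ℂ} (hz : z ∈ complexNhd δ) :
    ∃ x ∈ cube d, ∀ j, ‖z j - (x j : ℂ)‖ < δ j := by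
  choose x hx hxz using hz
  exact ⟨x, hx, hxz⟩

lemma toComplex_mem_complexNhd {δ : Fin d → ℝ} (hδ : ∀ j, 0 < δ j) {x : Fin d → ℝ}
    (hx : x ∈ cube d) : toComplex x ∈ complexNhd δ :=
  fun j => ofReal_mem_intervalNhd (hδ j) (hx j)

lemma update_mem_complexNhd {δ : Fin d → ℝ} {z : Fin d → ℂ} (hz : z ∈ complexNhd δ) {k : Fin d}
    {s : ℂ} (hs : s ∈ intervalNhd (δ k)) : Function.update z k s ∈ complexNhd δ := by
  rw [complexNhd_eq_pi] at hz ⊢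
  exact (update_mem_pi_iff_of_mem hz).2 fun _ => hs

lemma toComplex_update (x : Fin d → ℝ) (k : Fin d) (s : ℝ) :
    toComplex (Function.update x k s) = Function.update (toComplex x) k (s : ℂ) :=
  funext (Function.apply_update (fun _ => ((↑) : ℝ → ℂ)) x k s)

lemma continuous_toComplex : Continuous (toComplex : (Fin d → ℝ) → Fin d → ℂ) := by
  unfold toComplex
  fun_prop

lemma cube_eq_pi (d : ℕ) : cube d = Set.pi univ fun _ => Icc (-1 : ℝ) 1 := by
  ext x
  simp only [cube, mem_ofPred_eq, mem_univ_pi]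

lemma openCube_eq_pi (d : ℕ) : openCube d = Set.pi univ fun _ => Ioo (-1 : ℝ) 1 := by
  ext x
  simp only [openCube, mem_ofPred_eq, mem_univ_pi]

lemma update_mem_cube {x : Fin d → ℝ} (hx : x ∈ cube d) {k : Fin d}
    {s : ℝ} (hs : s ∈ Icc (-1 : ℝ) 1) : Function.update x k s ∈ cube d := by
  rw [cube_eq_pi] at hx ⊢
  exact (update_mem_pi_iff_of_mem hx).2 fun _ => hs

lemma isCompact_cube (d : ℕ) : IsCompact (cube d) := by
  rw [cube_eq_pi]
  exact isCompact_univ_pi fun _ => isCompact_Icc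

lemma measurableSet_cube (d : ℕ) : MeasurableSet (cube d) := (isCompact_cube d).measurableSet

lemma isOpen_openCube (d : ℕ) : IsOpen (openCube d) := by
  rw [openCube_eq_pi]
  exact isOpen_set_pi finite_univ fun _ _ => isOpen_Ioo

lemma openCube_subset_cube (d : ℕ) : openCube d ⊆ cube d :=
  fun _ hx j => Ioo_subset_Icc_self (hx j)

lemma exists_complexNhd_const_subset {U : Set (Fin d → ℂ)} (hU : IsOpen U)
    (hcube : ∀ x ∈ cube d, toComplex x ∈ U) : ∃ r > 0, complexNhd (fun _ : Fin d => r) ⊆ U := by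
  obtain ⟨r, hr, hrU⟩ :=
    ((isCompact_cube d).image continuous_toComplex).exists_thickening_subset_open hU
      (image_subset_iff.2 hcube)
  refine ⟨r, hr, fun z hz => hrU ?_⟩
  obtain ⟨x, hx, hxz⟩ := exists_mem_cube_norm_sub_lt hz
  refine mem_thickening_iff.2 ⟨_, mem_image_of_mem _ hx, (dist_pi_lt_iff hr).2 fun j => ?_⟩
  rw [dist_eq_norm]
  exact hxz j

end Cube

/-! ### Chebyshev expansions in one variable -/

section Joukowski

/-- The Joukowski map, which sends the circles about `0` to the ellipses with foci `±1`. -/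
def joukowski (w : ℂ) : ℂ := (w + w⁻¹) / 2

lemma joukowski_exp_mul_I (ζ : ℂ) : joukowski (Complex.exp (ζ * Complex.I)) = Complex.cos ζ := by
  rw [joukowski, Complex.cos, ← Complex.exp_neg, neg_mul]

lemma exists_joukowski_eq (z : ℂ) : ∃ w ≠ 0, joukowski w = z := by
  obtain ⟨ζ, rfl⟩ := Complex.cos_surjective z
  exact ⟨_, Complex.exp_ne_zero _, joukowski_exp_mul_I ζ⟩

lemma differentiableAt_joukowski {w : ℂ} (hw : w ≠ 0) : DifferentiableAt ℂ joukowski w :=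
  (differentiableAt_id.add (differentiableAt_inv hw)).div_const 2

lemma norm_joukowski_sub_one_add_norm_joukowski_add_one {w : ℂ} (hw : w ≠ 0) :
    ‖joukowski w - 1‖ + ‖joukowski w + 1‖ = ‖w‖ + ‖w‖⁻¹ := by
  have hsub : joukowski w - 1 = (w - 1) ^ 2 / (2 * w) := by rw [joukowski]; field_simp; ring
  have hadd : joukowski w + 1 = (w + 1) ^ 2 / (2 * w) := by rw [joukowski]; field_simp; ring
  have hpar := parallelogram_law_with_norm ℝ w 1
  have : 0 < ‖w‖ := norm_pos_iff.2 hw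
  rw [hsub, hadd, norm_div, norm_div, norm_pow, norm_pow, norm_mul]
  simp only [RCLike.norm_ofNat, norm_one] at hpar ⊢
  field_simp
  linarith

lemma eval_T_joukowski {w : ℂ} (hw : w ≠ 0) (m : ℕ) :
    (Polynomial.Chebyshev.T ℂ m).eval (joukowski w) = joukowski (w ^ m) := by
  have hexp : Complex.exp (Complex.log w / Complex.I * Complex.I) = w := by
    rw [div_mul_cancel₀ _ Complex.I_ne_zero, Complex.exp_log hw]
  rw [← hexp, joukowski_exp_mul_I, Polynomial.Chebyshev.T_complex_cos, ← Complex.exp_nat_mul,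
    ← mul_assoc, joukowski_exp_mul_I, Int.cast_natCast]

lemma norm_joukowski_le {w : ℂ} {s : ℝ} (hw : ‖w‖ ≤ s) (hw' : ‖w‖⁻¹ ≤ s) : ‖joukowski w‖ ≤ s := by
  rw [joukowski, norm_div, RCLike.norm_ofNat, div_le_iff₀ two_pos, mul_two]
  exact (norm_add_le _ _).trans (add_le_add hw (by rwa [norm_inv]))

lemma joukowski_mem_intervalNhd {ρ : ℝ} {w : ℂ} (h₁ : 1 ≤ ‖w‖) (hρ : ‖w‖ < ρ) :
    joukowski w ∈ intervalNhd (ρ - 1) := by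
  set r := ‖w‖
  have hr0 : 0 < r := one_pos.trans_le h₁
  set u : ℂ := w / r with hu
  have hu1 : ‖u‖ = 1 := by
    rw [hu, norm_div, Complex.norm_real, norm_norm, div_self hr0.ne']
  have hre : (u.re : ℂ) = (u + u⁻¹) / 2 := by
    rw [Complex.inv_eq_conj hu1, Complex.re_eq_add_conj]
  have hwu : w = r * u := (mul_div_cancel₀ w (Complex.ofReal_ne_zero.2 hr0.ne')).symm
  refine ⟨u.re, abs_le.1 (hu1 ▸ Complex.abs_re_le_norm u), ?_⟩
  have hdiff : joukowski w - u.re =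
      (((r - 1) / 2 : ℝ) : ℂ) * u - (((1 - r⁻¹) / 2 : ℝ) : ℂ) * u⁻¹ := by
    rw [joukowski, hre, hwu, mul_inv]
    push_cast
    ring
  have hrinv : r⁻¹ ≤ 1 := inv_le_one_of_one_le₀ h₁
  have hsum : 2 ≤ r + r⁻¹ := by
    have : r + r⁻¹ - 2 = (r - 1) ^ 2 / r := by field_simp; ring
    linarith [show 0 ≤ (r - 1) ^ 2 / r by positivity]
  calc ‖joukowski w - u.re‖ ≤ (r - 1) / 2 + (1 - r⁻¹) / 2 := by
        rw [hdiff]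
        refine (norm_sub_le _ _).trans_eq ?_
        rw [norm_mul, norm_mul, norm_inv, hu1, Complex.norm_real, Complex.norm_real,
          Real.norm_of_nonneg (by linarith), Real.norm_of_nonneg (by linarith), inv_one, mul_one,
          mul_one]
    _ < ρ - 1 := by linarith

end Joukowski

section ChebyshevPolynomial

lemma norm_sub_one_add_norm_add_one_le {r : ℝ} {z : ℂ} (hz : z ∈ intervalNhd r) :
    ‖z - 1‖ + ‖z + 1‖ ≤ 2 + 2 * r := by
  obtain ⟨y, hy, hzy⟩ := hz
  have hsub : ‖z - 1‖ ≤ ‖z - y‖ + ‖(y - 1 : ℂ)‖ := norm_sub_le_norm_sub_add_norm_sub z y 1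
  have hadd : ‖z + 1‖ ≤ ‖z - y‖ + ‖(y + 1 : ℂ)‖ := by
    simpa only [sub_neg_eq_add] using norm_sub_le_norm_sub_add_norm_sub z y (-1)
  have hysub : ‖(y - 1 : ℂ)‖ = 1 - y := by
    rw [← Complex.ofReal_one, ← Complex.ofReal_sub, Complex.norm_real, Real.norm_eq_abs,
      abs_of_nonpos (by linarith [hy.2]), neg_sub]
  have hyadd : ‖(y + 1 : ℂ)‖ = y + 1 := by
    rw [← Complex.ofReal_one, ← Complex.ofReal_add, Complex.norm_real,
      Real.norm_of_nonneg (by linarith [hy.1])]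
  linarith

lemma le_of_add_inv_le_add_inv {s σ : ℝ} (hs : 0 < s) (hσ : 1 ≤ σ) (h : s + s⁻¹ ≤ σ + σ⁻¹) :
    s ≤ σ := by
  by_contra! hlt
  have hσs : 1 < s * σ := by nlinarith
  have hfactor : s + s⁻¹ - (σ + σ⁻¹) = (s - σ) * (s * σ - 1) / (s * σ) := by field_simp; ring
  have : 0 < (s - σ) * (s * σ - 1) / (s * σ) :=
    div_pos (mul_pos (by linarith) (by linarith)) (by linarith)
  linarith

lemma norm_eval_T_le {r σ : ℝ} (hσ : 1 ≤ σ) (hr : 2 + 2 * r ≤ σ + σ⁻¹) {z : ℂ}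
    (hz : z ∈ intervalNhd r) (m : ℕ) : ‖(Polynomial.Chebyshev.T ℂ m).eval z‖ ≤ σ ^ m := by
  obtain ⟨w, hw, rfl⟩ := exists_joukowski_eq z
  have hw0 : 0 < ‖w‖ := norm_pos_iff.2 hw
  have hellipse : ‖w‖ + ‖w‖⁻¹ ≤ σ + σ⁻¹ := by
    rw [← norm_joukowski_sub_one_add_norm_joukowski_add_one hw]
    exact (norm_sub_one_add_norm_add_one_le hz).trans hr
  have hle : ‖w‖ ≤ σ := le_of_add_inv_le_add_inv hw0 hσ hellipse
  have hinv : ‖w‖⁻¹ ≤ σ :=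
    le_of_add_inv_le_add_inv (inv_pos.2 hw0) hσ (by rwa [inv_inv, add_comm])
  rw [eval_T_joukowski hw]
  refine norm_joukowski_le ?_ ?_
  · rw [norm_pow]
    exact pow_le_pow_left₀ hw0.le hle m
  · rw [norm_pow, ← inv_pow]
    exact pow_le_pow_left₀ (inv_pos.2 hw0).le hinv m

end ChebyshevPolynomial

section ChebyshevSeries

/-- The coefficient of the Chebyshev polynomial of degree `m` in the expansion of `f` on `[-1,1]`.
It is written as an integral over a full period of `cos`, so that it is visibly a Fourier
coefficient of the even function `f ∘ cos`. -/
def chebCoeff (f : ℂ → ℂ) (m : ℕ) : ℂ :=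
  ∫ θ in Icc (0 : ℝ) (2 * Real.pi),
    (((if m = 0 then 1 else 2) / (2 * Real.pi) * Real.cos (m * θ) : ℝ) : ℂ) • f (Real.cos θ)

/-- The Fourier coefficient of frequency `n` of `f ∘ cos`. -/
def cosFourier (f : ℂ → ℂ) (n : ℤ) : ℂ :=
  (1 / (2 * Real.pi) : ℝ) • ∫ θ in (0 : ℝ)..2 * Real.pi,
    Complex.exp (-(n * θ * Complex.I)) * f (Real.cos θ)

lemma continuous_comp_cos {f : ℂ → ℂ} {r : ℝ} (hr : 0 < r) (hf : ContinuousOn f (intervalNhd r)) :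
    Continuous fun θ : ℝ => f (Real.cos θ) :=
  hf.comp_continuous (by fun_prop) fun θ => ofReal_mem_intervalNhd hr (Real.cos_mem_Icc θ)

lemma cosFourier_neg (f : ℂ → ℂ) (n : ℤ) : cosFourier f (-n) = cosFourier f n := by
  unfold cosFourier
  congr 1
  have hreflect := intervalIntegral.integral_comp_sub_left (a := 0) (b := 2 * Real.pi)
    (fun θ : ℝ => Complex.exp (-(n * θ * Complex.I)) * f (Real.cos θ)) (2 * Real.pi)
  rw [sub_self, sub_zero] at hreflect
  rw [← hreflect]
  refine intervalIntegral.integral_congr fun θ _ => ?_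
  simp only [Real.cos_two_pi_sub]
  congr 1
  rw [Complex.exp_eq_exp_iff_exists_int]
  exact ⟨n, by push_cast; ring⟩

lemma cosFourier_eq_integral_cos {f : ℂ → ℂ} {r : ℝ} (hr : 0 < r)
    (hf : ContinuousOn f (intervalNhd r)) (m : ℕ) :
    cosFourier f m = (1 / (2 * Real.pi) : ℝ) • ∫ θ in (0 : ℝ)..2 * Real.pi,
      (Real.cos (m * θ) : ℂ) * f (Real.cos θ) := by
  have hint : ∀ n : ℤ, IntervalIntegrable
      (fun θ : ℝ => Complex.exp (-(n * θ * Complex.I)) * f (Real.cos θ)) volume 0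
      (2 * Real.pi) := fun n =>
    (Continuous.mul (by fun_prop) (continuous_comp_cos hr hf)).intervalIntegrable _ _
  have hsymm : cosFourier f m = (1 / 2 : ℂ) * (cosFourier f m + cosFourier f (-m)) := by
    rw [cosFourier_neg]
    ring
  rw [hsymm]
  unfold cosFourier
  rw [← smul_add, ← intervalIntegral.integral_add (hint _) (hint _), mul_smul_comm,
    ← intervalIntegral.integral_const_mul]
  congr 1
  refine intervalIntegral.integral_congr fun θ _ => ?_
  simp only [Complex.ofReal_cos, Complex.cos]
  push_cast
  ring_nf

lemma chebCoeff_eq_cosFourier {f : ℂ → ℂ} {r : ℝ} (hr : 0 < r)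
    (hf : ContinuousOn f (intervalNhd r)) (m : ℕ) :
    chebCoeff f m = (if m = 0 then 1 else 2) * cosFourier f m := by
  rw [cosFourier_eq_integral_cos hr hf, chebCoeff,
    intervalIntegral.integral_of_le (by positivity), integral_Icc_eq_integral_Ioc,
    Complex.real_smul, ← integral_const_mul, ← integral_const_mul]
  refine integral_congr_ae (Filter.Eventually.of_forall fun θ => ?_)
  simp only [smul_eq_mul]
  split_ifs <;> push_cast <;> ring

lemma circleIntegral_joukowski_eq_cosFourier (f : ℂ → ℂ) (m : ℕ) :
    (∮ w in C(0, 1), f (joukowski w) * (w ^ (m + 1))⁻¹) =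
      2 * Real.pi * Complex.I * cosFourier f m := by
  rw [circleIntegral, cosFourier, Complex.real_smul, ← mul_assoc,
    ← intervalIntegral.integral_const_mul]
  refine intervalIntegral.integral_congr fun θ _ => ?_
  have hpi : (Real.pi : ℂ) ≠ 0 := Complex.ofReal_ne_zero.2 Real.pi_ne_zero
  have hexp : Complex.exp (-(((m : ℕ) : ℤ) * θ * Complex.I)) =
      (Complex.exp (θ * Complex.I) ^ m)⁻¹ := by
    rw [← Complex.exp_nat_mul, ← Complex.exp_neg]
    push_cast
    ring_nf
  simp only [deriv_circleMap, smul_eq_mul]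
  rw [circleMap_zero, Complex.ofReal_one, one_mul, joukowski_exp_mul_I, hexp, pow_succ,
    Complex.ofReal_cos]
  have := Complex.exp_ne_zero (θ * Complex.I)
  push_cast
  field_simp

variable {f : ℂ → ℂ} {ρ B : ℝ}

/-- Deforming the contour of the Fourier coefficient from the unit circle to the circle of radius
`r` gains the factor `r ^ (-m)`. -/
lemma norm_cosFourier_le_of_lt (hf : DifferentiableOn ℂ f (intervalNhd (ρ - 1)))
    (hB : ∀ z ∈ intervalNhd (ρ - 1), ‖f z‖ ≤ B) {r : ℝ} (h₁ : 1 ≤ r) (hr : r < ρ) (m : ℕ) :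
    ‖cosFourier f m‖ ≤ B * (r ^ m)⁻¹ := by
  set g : ℂ → ℂ := fun w => f (joukowski w) * (w ^ (m + 1))⁻¹ with hg
  have hr0 : 0 < r := one_pos.trans_le h₁
  have hgd : ∀ w : ℂ, 1 ≤ ‖w‖ → ‖w‖ ≤ r → DifferentiableAt ℂ g w := by
    intro w hw₁ hwr
    have hw0 : w ≠ 0 := norm_pos_iff.1 (one_pos.trans_le hw₁)
    have hfd : DifferentiableAt ℂ f (joukowski w) := hf.differentiableAt
      ((isOpen_intervalNhd _).mem_nhds (joukowski_mem_intervalNhd hw₁ (hwr.trans_lt hr)))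
    exact (hfd.comp w (differentiableAt_joukowski hw0)).mul
      ((differentiableAt_id.pow _).inv (pow_ne_zero _ hw0))
  have hdeform : (∮ w in C(0, r), g w) = ∮ w in C(0, 1), g w := by
    refine Complex.circleIntegral_eq_of_differentiable_on_annulus_off_countable one_pos h₁
      countable_empty ?_ ?_
    · rintro w ⟨hwr, hw₁⟩
      simp only [mem_closedBall, mem_ball, dist_zero_right, not_lt] at hwr hw₁
      exact (hgd w hw₁ hwr).continuousAt.continuousWithinAt
    · rintro w ⟨⟨hwr, hw₁⟩, -⟩
      simp only [mem_closedBall, mem_ball, dist_zero_right, not_le] at hwr hw₁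
      exact hgd w hw₁.le hwr.le
  have hbound : ‖∮ w in C(0, r), g w‖ ≤ 2 * Real.pi * r * (B * (r ^ (m + 1))⁻¹) := by
    refine circleIntegral.norm_integral_le_of_norm_le_const hr0.le fun w hw => ?_
    have hwr : ‖w‖ = r := by simpa using hw
    rw [hg, norm_mul, norm_inv, norm_pow, hwr]
    gcongr
    exact hB _ (joukowski_mem_intervalNhd (h₁.trans_eq hwr.symm) (hwr.trans_lt hr))
  have hnorm : ‖(2 * Real.pi * Complex.I : ℂ)‖ = 2 * Real.pi := by simp [Real.pi_pos.le]
  rw [hdeform, circleIntegral_joukowski_eq_cosFourier, norm_mul, hnorm,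
    show 2 * Real.pi * r * (B * (r ^ (m + 1))⁻¹) = 2 * Real.pi * (B * (r ^ m)⁻¹) by
      rw [pow_succ]; field_simp] at hbound
  exact le_of_mul_le_mul_left hbound (by positivity)

lemma norm_cosFourier_le (hρ : 1 < ρ) (hf : DifferentiableOn ℂ f (intervalNhd (ρ - 1)))
    (hB : ∀ z ∈ intervalNhd (ρ - 1), ‖f z‖ ≤ B) (m : ℕ) :
    ‖cosFourier f m‖ ≤ B * (ρ ^ m)⁻¹ := by
  have hcont : ContinuousAt (fun r : ℝ => B * (r ^ m)⁻¹) ρ :=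
    continuousAt_const.mul ((continuousAt_id.pow m).inv₀ (pow_ne_zero _ (by simp; linarith)))
  exact ge_of_tendsto (hcont.mono_left nhdsWithin_le_nhds) (Filter.mem_of_superset
    (Ioo_mem_nhdsLT hρ) fun r hr => norm_cosFourier_le_of_lt hf hB hr.1.le hr.2 m)

lemma norm_chebCoeff_le (hρ : 1 < ρ) (hf : DifferentiableOn ℂ f (intervalNhd (ρ - 1)))
    (hB : ∀ z ∈ intervalNhd (ρ - 1), ‖f z‖ ≤ B) (m : ℕ) :
    ‖chebCoeff f m‖ ≤ 2 * B * (ρ ^ m)⁻¹ := by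
  rw [chebCoeff_eq_cosFourier (by linarith) hf.continuousOn, norm_mul, mul_assoc]
  refine mul_le_mul ?_ (norm_cosFourier_le hρ hf hB m) (norm_nonneg _) (by norm_num)
  split_ifs <;> simp

local instance fact_two_pi_pos : Fact (0 < 2 * Real.pi) := ⟨Real.two_pi_pos⟩

lemma continuous_comp_angleCos {r : ℝ} (hr : 0 < r) (hf : ContinuousOn f (intervalNhd r)) :
    Continuous fun θ : AddCircle (2 * Real.pi) => f (Real.Angle.cos θ) := by
  refine hf.comp_continuous (Complex.continuous_ofReal.comp Real.Angle.continuous_cos) fun θ => ?_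
  induction θ using Real.Angle.induction_on with
  | _ θ => exact ofReal_mem_intervalNhd hr (Real.cos_mem_Icc θ)

lemma fourierCoeff_comp_angleCos (f : ℂ → ℂ) :
    fourierCoeff (fun θ : AddCircle (2 * Real.pi) => f (Real.Angle.cos θ)) = cosFourier f := by
  ext n
  rw [fourierCoeff_eq_intervalIntegral _ n 0, cosFourier, zero_add]
  congr 1
  refine intervalIntegral.integral_congr fun θ _ => ?_
  have hpi : (Real.pi : ℂ) ≠ 0 := Complex.ofReal_ne_zero.2 Real.pi_ne_zero
  have hcos : Real.Angle.cos ((θ : ℝ) : AddCircle (2 * Real.pi)) = Real.cos θ := rfl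
  simp only [fourier_coe_apply, smul_eq_mul, hcos]
  congr 2
  push_cast
  field_simp

lemma hasSum_cosFourier (hρ : 1 < ρ) (hf : DifferentiableOn ℂ f (intervalNhd (ρ - 1)))
    (hB : ∀ z ∈ intervalNhd (ρ - 1), ‖f z‖ ≤ B) (θ : ℝ) :
    HasSum (fun m : ℕ => (if m = 0 then 1 else 2) * cosFourier f m * Complex.cos (m * θ))
      (f (Real.cos θ)) := by
  set g : C(AddCircle (2 * Real.pi), ℂ) :=
    ⟨_, continuous_comp_angleCos (by linarith) hf.continuousOn⟩
  have hcoeff : fourierCoeff g = cosFourier f := fourierCoeff_comp_angleCos f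
  have hgeo : Summable fun m : ℕ => B * (ρ ^ m)⁻¹ := by
    simp_rw [← inv_pow]
    exact (summable_geometric_of_lt_one (by positivity) (inv_lt_one_of_one_lt₀ hρ)).mul_left B
  have hnat : Summable fun m : ℕ => cosFourier f m :=
    hgeo.of_norm_bounded (norm_cosFourier_le hρ hf hB)
  have hsummable : Summable (fourierCoeff g) := by
    rw [hcoeff]
    exact hnat.of_nat_of_neg (by simpa only [cosFourier_neg] using hnat)
  have hfourier := (has_pointwise_sum_fourier_series_of_summable hsummable
    (θ : AddCircle (2 * Real.pi))).nat_add_neg.sub (hasSum_ite_eq 0 (cosFourier f 0))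
  simp only [hcoeff, cosFourier_neg, smul_eq_mul, fourier_zero, mul_one,
    add_sub_cancel_right] at hfourier
  refine hfourier.congr_fun fun m => ?_
  have hpi : (Real.pi : ℂ) ≠ 0 := Complex.ofReal_ne_zero.2 Real.pi_ne_zero
  rcases Nat.eq_zero_or_pos m with rfl | hm
  · simp
  · have hpos : 2 * Real.pi * Complex.I * m * θ / (2 * Real.pi) = m * θ * Complex.I := by
      field_simp
    have hneg : 2 * Real.pi * Complex.I * (-m) * θ / (2 * Real.pi) = -(m * θ) * Complex.I := by
      field_simp
    simp only [fourier_coe_apply, hm.ne', if_false, sub_zero, Complex.cos]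
    push_cast
    rw [hpos, hneg]
    ring

lemma hasSum_chebCoeff_of_mem_Icc (hρ : 1 < ρ) (hf : DifferentiableOn ℂ f (intervalNhd (ρ - 1)))
    (hB : ∀ z ∈ intervalNhd (ρ - 1), ‖f z‖ ≤ B) {x : ℝ} (hx : x ∈ Icc (-1 : ℝ) 1) :
    HasSum (fun m : ℕ => chebCoeff f m * (Polynomial.Chebyshev.T ℂ m).eval (x : ℂ)) (f x) := by
  obtain ⟨θ, rfl⟩ : ∃ θ, Real.cos θ = x := ⟨Real.arccos x, Real.cos_arccos hx.1 hx.2⟩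
  refine (hasSum_cosFourier hρ hf hB θ).congr_fun fun m => ?_
  rw [chebCoeff_eq_cosFourier (by linarith) hf.continuousOn, Complex.ofReal_cos,
    Polynomial.Chebyshev.T_complex_cos, Int.cast_natCast]

lemma eqOn_intervalNhd_of_eqOn_Icc {r : ℝ} (hr : 0 < r) {f g : ℂ → ℂ}
    (hf : DifferentiableOn ℂ f (intervalNhd r)) (hg : DifferentiableOn ℂ g (intervalNhd r))
    (hfg : ∀ x ∈ Icc (-1 : ℝ) 1, f x = g x) : EqOn f g (intervalNhd r) := by
  refine AnalyticOnNhd.eqOn_of_preconnected_of_frequently_eq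
    (hf.analyticOnNhd (isOpen_intervalNhd r)) (hg.analyticOnNhd (isOpen_intervalNhd r))
    (convex_intervalNhd r).isPreconnected (z₀ := ((0 : ℝ) : ℂ))
    (ofReal_mem_intervalNhd hr (by norm_num)) ?_
  have hlim : Filter.Tendsto ((↑) : ℝ → ℂ) (𝓝[≠] 0) (𝓝[≠] ((0 : ℝ) : ℂ)) :=
    (Complex.continuous_ofReal.continuousAt.tendsto).inf
      (Filter.tendsto_principal_principal.2 fun x hx => Complex.ofReal_injective.ne hx)
  exact hlim.frequently (Filter.Eventually.frequently (Filter.mem_of_superset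
    (mem_nhdsWithin_of_mem_nhds (Icc_mem_nhds (by norm_num) (by norm_num))) hfg))

lemma summable_chebCoeff_bound (B : ℝ) {σ : ℝ} (hσ : 0 ≤ σ) (hσρ : σ < ρ) :
    Summable fun m : ℕ => 2 * B * (ρ ^ m)⁻¹ * σ ^ m := by
  have hgeo : ∀ m : ℕ, 2 * B * (ρ ^ m)⁻¹ * σ ^ m = 2 * B * (σ / ρ) ^ m := fun m => by
    rw [div_pow]
    ring
  simp_rw [hgeo]
  exact (summable_geometric_of_lt_one (div_nonneg hσ (by linarith))
    ((div_lt_one (by linarith)).2 hσρ)).mul_left _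

lemma norm_chebCoeff_mul_eval_T_le {σ r : ℝ} (hσ : 1 ≤ σ) (hσρ : σ < ρ)
    (hf : DifferentiableOn ℂ f (intervalNhd (ρ - 1))) (hB : ∀ z ∈ intervalNhd (ρ - 1), ‖f z‖ ≤ B)
    (hr : 2 + 2 * r ≤ σ + σ⁻¹) (m : ℕ) {z : ℂ} (hz : z ∈ intervalNhd r) :
    ‖chebCoeff f m * (Polynomial.Chebyshev.T ℂ m).eval z‖ ≤ 2 * B * (ρ ^ m)⁻¹ * σ ^ m := by
  have hcoeff := norm_chebCoeff_le (hσ.trans_lt hσρ) hf hB m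
  rw [norm_mul]
  exact mul_le_mul hcoeff (norm_eval_T_le hσ hr hz m) (norm_nonneg _)
    ((norm_nonneg _).trans hcoeff)

theorem hasSum_chebCoeff {σ r : ℝ} (hσ : 1 ≤ σ) (hσρ : σ < ρ)
    (hf : DifferentiableOn ℂ f (intervalNhd (ρ - 1)))
    (hB : ∀ z ∈ intervalNhd (ρ - 1), ‖f z‖ ≤ B) (hr0 : 0 < r) (hrρ : r ≤ ρ - 1)
    (hr : 2 + 2 * r ≤ σ + σ⁻¹) {z : ℂ} (hz : z ∈ intervalNhd r) :
    HasSum (fun m : ℕ => chebCoeff f m * (Polynomial.Chebyshev.T ℂ m).eval z) (f z) := by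
  have hbound := norm_chebCoeff_mul_eval_T_le hσ hσρ hf hB hr
  have hsummable := summable_chebCoeff_bound B (zero_le_one.trans hσ) hσρ
  have hseries : DifferentiableOn ℂ
      (fun w => ∑' m : ℕ, chebCoeff f m * (Polynomial.Chebyshev.T ℂ m).eval w) (intervalNhd r) :=
    Complex.differentiableOn_tsum_of_summable_norm hsummable
      (fun m => ((Polynomial.differentiable _).const_mul _).differentiableOn)
      (isOpen_intervalNhd r) fun m w hw => hbound m hw
  rw [eqOn_intervalNhd_of_eqOn_Icc hr0 (hf.mono (intervalNhd_mono hrρ)) hseries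
    (fun x hx => (hasSum_chebCoeff_of_mem_Icc (hσ.trans_lt hσρ) hf hB hx).tsum_eq.symm) hz]
  exact (hsummable.of_norm_bounded fun m => hbound m hz).hasSum

end ChebyshevSeries

/-! ### Polynomial approximation in several variables -/

section Cons

variable {n : ℕ}

lemma cons_mem_complexNhd_iff {δ : Fin (n + 1) → ℝ} {ζ : ℂ} {z : Fin n → ℂ} :
    (Fin.cons ζ z : Fin (n + 1) → ℂ) ∈ complexNhd δ ↔
      ζ ∈ intervalNhd (δ 0) ∧ z ∈ complexNhd (Fin.tail δ) := by
  simp only [mem_complexNhd_iff, Fin.forall_fin_succ, Fin.cons_zero, Fin.cons_succ, Fin.tail]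

lemma cons_mem_cube_iff {t : ℝ} {x : Fin n → ℝ} :
    (Fin.cons t x : Fin (n + 1) → ℝ) ∈ cube (n + 1) ↔ t ∈ Icc (-1 : ℝ) 1 ∧ x ∈ cube n := by
  simp only [cube, mem_ofPred_eq, Fin.forall_fin_succ, Fin.cons_zero, Fin.cons_succ]

lemma toComplex_cons (t : ℝ) (x : Fin n → ℝ) :
    toComplex (Fin.cons t x : Fin (n + 1) → ℝ) = Fin.cons (t : ℂ) (toComplex x) := by
  ext j
  refine Fin.cases ?_ (fun i => ?_) j <;> simp [toComplex]

/-- The linear embedding `z ↦ (0, z)`, which makes `z ↦ (ζ, z)` an affine map. -/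
def consZero (n : ℕ) : (Fin n → ℂ) →L[ℂ] (Fin (n + 1) → ℂ) :=
  ContinuousLinearMap.pi fun j =>
    Fin.cases (motive := fun _ => (Fin n → ℂ) →L[ℂ] ℂ) 0 (fun i => ContinuousLinearMap.proj i) j

lemma consZero_add_single (ζ : ℂ) (z : Fin n → ℂ) :
    consZero n z + Pi.single 0 ζ = Fin.cons ζ z := by
  ext j
  refine Fin.cases ?_ (fun i => ?_) j <;> simp [consZero]

variable {δ : Fin (n + 1) → ℝ} {R : (Fin (n + 1) → ℂ) → ℂ}

lemma differentiableOn_cons (hR : ContDiffOn ℂ 1 R (complexNhd δ)) {z : Fin n → ℂ}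
    (hz : z ∈ complexNhd (Fin.tail δ)) :
    DifferentiableOn ℂ (fun ζ => R (Fin.cons ζ z)) (intervalNhd (δ 0)) := by
  refine (hR.differentiableOn one_ne_zero).comp ?_
    fun ζ hζ => cons_mem_complexNhd_iff.2 ⟨hζ, hz⟩
  refine Differentiable.differentiableOn (differentiable_pi.2 fun j => ?_)
  refine Fin.cases ?_ (fun i => ?_) j <;> simp

lemma contDiffOn_chebCoeff (hδ : 0 < δ 0) (hR : ContDiffOn ℂ 1 R (complexNhd δ)) (m : ℕ) :
    ContDiffOn ℂ 1 (fun z : Fin n → ℂ => chebCoeff (fun ζ => R (Fin.cons ζ z)) m)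
      (complexNhd (Fin.tail δ)) := by
  have hcos : ContinuousOn (fun θ => Pi.single 0 (Real.cos θ : ℂ) : ℝ → Fin (n + 1) → ℂ)
      (Icc 0 (2 * Real.pi)) :=
    ((ContinuousLinearMap.single ℂ (fun _ : Fin (n + 1) => ℂ) 0).continuous.comp
      (Complex.continuous_ofReal.comp Real.continuous_cos)).continuousOn
  have hint := contDiffOn_setIntegral_comp_affine (μ := volume) isCompact_Icc measurableSet_Icc
    (isOpen_complexNhd (Fin.tail δ)) (isOpen_complexNhd δ) hR (A := fun _ => consZero n)
    continuousOn_const hcos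
    (φ := fun θ => (((if m = 0 then 1 else 2) / (2 * Real.pi) * Real.cos (m * θ) : ℝ) : ℂ))
    (Continuous.continuousOn (by fun_prop)) fun z hz θ _ => by
      rw [consZero_add_single]
      exact cons_mem_complexNhd_iff.2 ⟨ofReal_mem_intervalNhd hδ (Real.cos_mem_Icc θ), hz⟩
  simpa only [consZero_add_single, chebCoeff] using hint

lemma exists_chebCoeff_eq_ofReal {f : ℂ → ℂ} (hf : ∀ x ∈ Icc (-1 : ℝ) 1, ∃ y : ℝ, f x = y)
    (m : ℕ) : ∃ y : ℝ, chebCoeff f m = y := by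
  have hre : ∀ θ : ℝ, f (Real.cos θ) = ((f (Real.cos θ)).re : ℂ) := fun θ => by
    obtain ⟨y, hy⟩ := hf _ (Real.cos_mem_Icc θ)
    rw [hy, Complex.ofReal_re]
  refine ⟨∫ θ in Icc (0 : ℝ) (2 * Real.pi),
    ((if m = 0 then 1 else 2) / (2 * Real.pi) * Real.cos (m * θ)) * (f (Real.cos θ)).re, ?_⟩
  rw [chebCoeff, ← integral_complex_ofReal]
  refine integral_congr_ae (Filter.Eventually.of_forall fun θ => ?_)
  beta_reduce
  rw [hre θ, smul_eq_mul, ← Complex.ofReal_mul, Complex.ofReal_re]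

lemma exists_chebCoeff_cons_eq_ofReal (hR : ∀ x ∈ cube (n + 1), ∃ y : ℝ, R (toComplex x) = y)
    (m : ℕ) {x : Fin n → ℝ} (hx : x ∈ cube n) :
    ∃ y : ℝ, chebCoeff (fun ζ => R (Fin.cons ζ (toComplex x))) m = y := by
  refine exists_chebCoeff_eq_ofReal (fun t ht => ?_) m
  rw [← toComplex_cons]
  exact hR _ (cons_mem_cube_iff.2 ⟨ht, hx⟩)

end Cons

section RestrictSupport

variable {σ τ R : Type*} [CommRing R]

lemma mul_mem_restrictSupport {s t u : Set (σ →₀ ℕ)} {p q : MvPolynomial σ R}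
    (hp : p ∈ MvPolynomial.restrictSupport R s) (hq : q ∈ MvPolynomial.restrictSupport R t)
    (h : ∀ a ∈ s, ∀ b ∈ t, a + b ∈ u) : p * q ∈ MvPolynomial.restrictSupport R u := by
  classical
  rw [MvPolynomial.mem_restrictSupport_iff] at hp hq ⊢
  intro ν hν
  obtain ⟨a, ha, b, hb, rfl⟩ := Finset.mem_add.1 (MvPolynomial.support_mul p q hν)
  exact h a (hp ha) b (hq hb)

lemma aeval_X_mem_restrictSupport (i : σ) (p : Polynomial R) :
    Polynomial.aeval (MvPolynomial.X i) p ∈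
      MvPolynomial.restrictSupport R {ν : σ →₀ ℕ | ∃ l ≤ p.natDegree, ν = Finsupp.single i l} := by
  nontriviality R
  rw [Polynomial.aeval_eq_sum_range]
  refine Submodule.sum_mem _ fun l hl => Submodule.smul_mem _ _ ?_
  rw [MvPolynomial.X_pow_eq_monomial, MvPolynomial.monomial_mem_restrictSupport]
  exact Or.inl ⟨l, Nat.lt_succ_iff.1 (Finset.mem_range.1 hl), rfl⟩

lemma rename_mem_restrictSupport {f : σ → τ} {s : Set (σ →₀ ℕ)} {p : MvPolynomial σ R}
    (hp : p ∈ MvPolynomial.restrictSupport R s) :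
    MvPolynomial.rename f p ∈ MvPolynomial.restrictSupport R (Finsupp.mapDomain f '' s) := by
  rw [MvPolynomial.mem_restrictSupport_iff] at hp ⊢
  intro ν hν
  obtain ⟨u, hu, hc⟩ := MvPolynomial.coeff_rename_ne_zero f p ν (MvPolynomial.mem_support_iff.1 hν)
  exact ⟨u, hp (MvPolynomial.mem_support_iff.2 hc), hu⟩

end RestrictSupport

section WeightedSimplex

variable {n : ℕ}

/-- Multi-indices of weighted degree at most `ℓ`, with weights `log (ρ j)`. -/
def weightedSimplex (ρ : Fin n → ℝ) (ℓ : ℝ) : Set (Fin n →₀ ℕ) :=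
  {ν | ∑ j, (ν j : ℝ) * Real.log (ρ j) ≤ ℓ}

lemma mapDomain_succ_add_single_mem_weightedSimplex {ρ : Fin (n + 1) → ℝ} {ℓ : ℝ} {l : ℕ}
    {ν : Fin n →₀ ℕ} (hν : ν ∈ weightedSimplex (Fin.tail ρ) (ℓ - l * Real.log (ρ 0))) :
    ν.mapDomain Fin.succ + Finsupp.single 0 l ∈ weightedSimplex ρ ℓ := by
  have hzero : (ν.mapDomain Fin.succ + Finsupp.single 0 l : Fin (n + 1) →₀ ℕ) 0 = l := by
    rw [Finsupp.add_apply, Finsupp.mapDomain_of_notMem_range ν 0 (by simp), zero_add,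
      Finsupp.single_eq_same]
  have hsucc : ∀ i : Fin n,
      (ν.mapDomain Fin.succ + Finsupp.single 0 l : Fin (n + 1) →₀ ℕ) i.succ = ν i := fun i => by
    rw [Finsupp.add_apply, Finsupp.mapDomain_apply (Fin.succ_injective n),
      Finsupp.single_eq_of_ne (Fin.succ_ne_zero i), add_zero]
  simp only [weightedSimplex, mem_ofPred_eq, Fin.tail] at hν ⊢
  simp only [Fin.sum_univ_succ, hzero, hsucc]
  linarith

lemma weightedSimplex_mono (ρ : Fin n → ℝ) {ℓ ℓ' : ℝ} (h : ℓ ≤ ℓ') :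
    weightedSimplex ρ ℓ ⊆ weightedSimplex ρ ℓ' := fun _ hν => le_trans hν h

lemma rename_mul_aeval_T_mem_restrictSupport {ρ : Fin (n + 1) → ℝ} (hρ : 1 ≤ ρ 0) {ℓ : ℝ} (m : ℕ)
    {q : MvPolynomial (Fin n) ℝ}
    (hq : q ∈ MvPolynomial.restrictSupport ℝ
      (weightedSimplex (Fin.tail ρ) (ℓ - m * Real.log (ρ 0)))) :
    MvPolynomial.rename Fin.succ q *
      Polynomial.aeval (MvPolynomial.X 0) (Polynomial.Chebyshev.T ℝ m) ∈
      MvPolynomial.restrictSupport ℝ (weightedSimplex ρ ℓ) := by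
  refine mul_mem_restrictSupport (rename_mem_restrictSupport hq)
    (aeval_X_mem_restrictSupport 0 _) ?_
  rintro _ ⟨ν, hν, rfl⟩ _ ⟨l, hl, rfl⟩
  rw [Polynomial.Chebyshev.natDegree_T, Int.natAbs_natCast] at hl
  have hlog := Real.log_nonneg hρ
  exact mapDomain_succ_add_single_mem_weightedSimplex (weightedSimplex_mono _ (by gcongr) hν)

end WeightedSimplex

section PolynomialApprox

variable {n : ℕ}

/-- The polynomial `∑_{m < N} p m (x₁, …, xₙ) * T_m (x₀)` in `n + 1` variables. -/
def chebyshevSum (p : ℕ → MvPolynomial (Fin n) ℝ) (N : ℕ) : MvPolynomial (Fin (n + 1)) ℝ :=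
  ∑ m ∈ Finset.range N, MvPolynomial.rename Fin.succ (p m) *
    Polynomial.aeval (MvPolynomial.X 0) (Polynomial.Chebyshev.T ℝ m)

lemma aeval_chebyshevSum (p : ℕ → MvPolynomial (Fin n) ℝ) (N : ℕ) (z : Fin (n + 1) → ℂ) :
    MvPolynomial.aeval z (chebyshevSum p N) = ∑ m ∈ Finset.range N,
      MvPolynomial.aeval (Fin.tail z) (p m) * (Polynomial.Chebyshev.T ℂ m).eval (z 0) := by
  rw [chebyshevSum, map_sum]
  refine Finset.sum_congr rfl fun m _ => ?_
  rw [map_mul, MvPolynomial.aeval_rename, ← Polynomial.aeval_algHom_apply, MvPolynomial.aeval_X,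
    Polynomial.Chebyshev.aeval_T]
  rfl

lemma norm_sub_sum_range_le {E : Type*} [SeminormedAddCommGroup E] {u v : ℕ → E} {s : E}
    (hu : HasSum u s) {b : ℕ → ℝ} {β : ℝ} (hb : HasSum b β) {N : ℕ}
    (hlt : ∀ m < N, ‖u m - v m‖ ≤ b m) (hge : ∀ m, N ≤ m → ‖u m‖ ≤ b m) :
    ‖s - ∑ m ∈ Finset.range N, v m‖ ≤ β := by
  have hv : HasSum (fun m => if m < N then v m else 0)
      (∑ m ∈ Finset.range N, if m < N then v m else 0) :=
    hasSum_sum_of_ne_finset_zero fun m hm => if_neg fun h => hm (Finset.mem_range.2 h)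
  rw [Finset.sum_congr rfl fun m hm => if_pos (Finset.mem_range.1 hm)] at hv
  refine (hu.sub hv).norm_le_of_bounded hb fun m => ?_
  split_ifs with hm
  · exact hlt m hm
  · rw [sub_zero]
    exact hge m (not_lt.1 hm)

/-- The rate `ρ ^ ((1 - τ) / 2)` lost when a Chebyshev expansion with coefficients decaying like
`ρ ^ (-m)` is evaluated off the interval `[-1, 1]`. -/
def lossRate (τ ρ : ℝ) : ℝ := Real.exp ((1 - τ) / 2 * Real.log ρ)

lemma one_lt_lossRate {τ ρ : ℝ} (hτ : τ < 1) (hρ : 1 < ρ) : 1 < lossRate τ ρ :=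
  Real.one_lt_exp_iff.2 (mul_pos (by linarith) (Real.log_pos hρ))

lemma lossRate_lt {τ ρ : ℝ} (hτ : 0 < τ) (hρ : 1 < ρ) : lossRate τ ρ < ρ := by
  rw [lossRate, ← Real.lt_log_iff_exp_lt (by linarith)]
  nlinarith [Real.log_pos hρ]

lemma inv_pow_mul_exp_mul_lossRate_pow {ρ : ℝ} (hρ : 0 < ρ) (τ ℓ : ℝ) (m : ℕ) :
    (ρ ^ m)⁻¹ * Real.exp (-(τ * (ℓ - m * Real.log ρ))) * lossRate τ ρ ^ m =
      Real.exp (-(τ * ℓ)) * (lossRate τ ρ)⁻¹ ^ m := by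
  have hpow : (ρ ^ m)⁻¹ = Real.exp (-(m * Real.log ρ)) := by
    rw [Real.exp_neg, Real.exp_nat_mul, Real.exp_log hρ]
  rw [hpow, lossRate, ← Real.exp_neg, ← Real.exp_nat_mul, ← Real.exp_nat_mul, ← Real.exp_add,
    ← Real.exp_add, ← Real.exp_add]
  ring_nf

lemma inv_pow_mul_lossRate_pow_le {τ ρ ℓ : ℝ} (hτ : 0 ≤ τ) (hρ : 0 < ρ) {m : ℕ}
    (hm : ℓ ≤ m * Real.log ρ) :
    (ρ ^ m)⁻¹ * lossRate τ ρ ^ m ≤ Real.exp (-(τ * ℓ)) * (lossRate τ ρ)⁻¹ ^ m := by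
  rw [← inv_pow_mul_exp_mul_lossRate_pow hρ]
  have hone : 1 ≤ Real.exp (-(τ * (ℓ - m * Real.log ρ))) :=
    Real.one_le_exp (by nlinarith)
  have : 0 < lossRate τ ρ := Real.exp_pos _
  gcongr
  exact le_mul_of_one_le_right (by positivity) hone

lemma lt_floor_div_add_one_iff {a b : ℝ} (ha : 0 ≤ a) (hb : 0 < b) {m : ℕ} :
    m < ⌊a / b⌋₊ + 1 ↔ m * b ≤ a := by
  rw [Nat.lt_succ_iff, Nat.le_floor_iff (by positivity), le_div_iff₀ hb]

/-- Perturbing the Chebyshev coefficients of low degree and truncating the expansion: below the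
cutoff `m log ρ ≤ ℓ` the assumed accuracy of the `m`-th coefficient balances the growth of `T_m`,
above it the decay of the coefficients does. -/
lemma norm_sub_sum_mul_eval_T_le {τ ρ r B C ℓ : ℝ} (hτ0 : 0 < τ) (hτ1 : τ < 1) (hρ : 1 < ρ)
    (hr : 0 < r) (hrρ : r ≤ ρ - 1) (hrσ : 2 + 2 * r ≤ lossRate τ ρ + (lossRate τ ρ)⁻¹)
    {f : ℂ → ℂ} (hf : DifferentiableOn ℂ f (intervalNhd (ρ - 1)))
    (hB : ∀ ζ ∈ intervalNhd (ρ - 1), ‖f ζ‖ ≤ B) (hC : 0 ≤ C) (hℓ : 0 ≤ ℓ) {c : ℕ → ℂ}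
    (hc : ∀ m : ℕ, m * Real.log ρ ≤ ℓ → ‖chebCoeff f m - c m‖ ≤
      C * (2 * B * (ρ ^ m)⁻¹) * Real.exp (-(τ * (ℓ - m * Real.log ρ))))
    {ζ : ℂ} (hζ : ζ ∈ intervalNhd r) :
    ‖f ζ - ∑ m ∈ Finset.range (⌊ℓ / Real.log ρ⌋₊ + 1),
        c m * (Polynomial.Chebyshev.T ℂ m).eval ζ‖ ≤
      2 * (C + 1) * (1 - (lossRate τ ρ)⁻¹)⁻¹ * B * Real.exp (-(τ * ℓ)) := by
  have hσ : 1 < lossRate τ ρ := one_lt_lossRate hτ1 hρ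
  set σ := lossRate τ ρ
  have hσ0 : 0 < σ := one_pos.trans hσ
  have hB0 : 0 ≤ B := (norm_nonneg _).trans (hB ζ (intervalNhd_mono hrρ hζ))
  have hfloor := fun m => lt_floor_div_add_one_iff (m := m) hℓ (Real.log_pos hρ)
  have hT := norm_eval_T_le hσ.le hrσ hζ
  have hgeo := (hasSum_geometric_of_lt_one (inv_nonneg.2 hσ0.le)
    (inv_lt_one_of_one_lt₀ hσ)).mul_left (2 * (C + 1) * B * Real.exp (-(τ * ℓ)))
  refine (norm_sub_sum_range_le (hasSum_chebCoeff hσ.le (lossRate_lt hτ0 hρ) hf hB hr hrρ hrσ hζ)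
    hgeo (fun m hm => ?_) fun m hm => ?_).trans_eq (by ring)
  · rw [← sub_mul, norm_mul]
    calc _ ≤ C * (2 * B * (ρ ^ m)⁻¹) * Real.exp (-(τ * (ℓ - m * Real.log ρ))) * σ ^ m :=
          mul_le_mul (hc m ((hfloor m).1 hm)) (hT m) (norm_nonneg _) (by positivity)
      _ = 2 * C * B * (Real.exp (-(τ * ℓ)) * σ⁻¹ ^ m) := by
          rw [← inv_pow_mul_exp_mul_lossRate_pow (by linarith)]; ring
      _ ≤ 2 * (C + 1) * B * Real.exp (-(τ * ℓ)) * σ⁻¹ ^ m := by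
          rw [mul_assoc (2 * (C + 1) * B)]; gcongr; linarith
  · have hℓm : ℓ ≤ m * Real.log ρ := (not_le.1 fun hle => hm.not_gt ((hfloor m).2 hle)).le
    rw [norm_mul]
    calc _ ≤ 2 * B * (ρ ^ m)⁻¹ * σ ^ m :=
          mul_le_mul (norm_chebCoeff_le hρ hf hB m) (hT m) (norm_nonneg _) (by positivity)
      _ ≤ 2 * B * (Real.exp (-(τ * ℓ)) * σ⁻¹ ^ m) := by
          rw [mul_assoc]
          exact mul_le_mul_of_nonneg_left
            (inv_pow_mul_lossRate_pow_le hτ0.le (by linarith) hℓm) (by positivity)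
      _ ≤ 2 * (C + 1) * B * Real.exp (-(τ * ℓ)) * σ⁻¹ ^ m := by
          rw [mul_assoc (2 * (C + 1) * B)]; gcongr; linarith

/-- Every function that is holomorphic and bounded by `B` on the neighbourhood of the cube with
radii `ρ j - 1` and real on the cube is approximated, on the neighbourhood of radius `r`, by real
polynomials of weighted degree at most `ℓ` up to an error `C * B * exp (-τ ℓ)`. -/
def PolynomialApproxBound (τ : ℝ) (ρ : Fin n → ℝ) (r C : ℝ) : Prop :=
  ∀ (R : (Fin n → ℂ) → ℂ) (B : ℝ), ContDiffOn ℂ 1 R (complexNhd fun j => ρ j - 1) →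
    (∀ z ∈ complexNhd (fun j => ρ j - 1), ‖R z‖ ≤ B) →
    (∀ x ∈ cube n, ∃ y : ℝ, R (toComplex x) = y) → ∀ ℓ : ℝ, 0 ≤ ℓ →
    ∃ p ∈ MvPolynomial.restrictSupport ℝ (weightedSimplex ρ ℓ),
      ∀ z ∈ complexNhd (fun _ : Fin n => r),
        ‖R z - MvPolynomial.aeval z p‖ ≤ C * B * Real.exp (-(τ * ℓ))

lemma polynomialApproxBound_of_fin_zero (τ : ℝ) (ρ : Fin 0 → ℝ) (r : ℝ) :
    PolynomialApproxBound τ ρ r 0 := by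
  intro R B _ _ hreal ℓ hℓ
  obtain ⟨y, hy⟩ := hreal 0 fun j => j.elim0
  refine ⟨MvPolynomial.C y, ?_, fun z _ => ?_⟩
  · rw [MvPolynomial.C_apply, MvPolynomial.monomial_mem_restrictSupport]
    exact Or.inl (by simpa [weightedSimplex] using hℓ)
  · rw [MvPolynomial.aeval_C, Subsingleton.elim z (toComplex 0), hy]
    simp

variable {τ r C : ℝ} {ρ : Fin (n + 1) → ℝ}

/-- The `m`-th Chebyshev coefficient in the first variable has size `ρ₀ ^ (-m)`, so it needs to be
resolved only up to the weighted degree `ℓ - m log ρ₀`. -/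
lemma PolynomialApproxBound.exists_approx_chebCoeff
    (h : PolynomialApproxBound τ (Fin.tail ρ) r C) (hρ : 1 < ρ 0) {R : (Fin (n + 1) → ℂ) → ℂ}
    {B : ℝ} (hR : ContDiffOn ℂ 1 R (complexNhd fun j => ρ j - 1))
    (hB : ∀ z ∈ complexNhd (fun j => ρ j - 1), ‖R z‖ ≤ B)
    (hreal : ∀ x ∈ cube (n + 1), ∃ y : ℝ, R (toComplex x) = y) {ℓ : ℝ} {m : ℕ}
    (hm : m * Real.log (ρ 0) ≤ ℓ) :
    ∃ p ∈ MvPolynomial.restrictSupport ℝ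
        (weightedSimplex (Fin.tail ρ) (ℓ - m * Real.log (ρ 0))),
      ∀ z ∈ complexNhd (fun _ : Fin n => r),
        ‖chebCoeff (fun ζ => R (Fin.cons ζ z)) m - MvPolynomial.aeval z p‖ ≤
          C * (2 * B * (ρ 0 ^ m)⁻¹) * Real.exp (-(τ * (ℓ - m * Real.log (ρ 0)))) :=
  h _ _ (contDiffOn_chebCoeff (by linarith) hR m)
    (fun _ hz => norm_chebCoeff_le hρ (differentiableOn_cons hR hz)
      (fun _ hζ => hB _ (cons_mem_complexNhd_iff.2 ⟨hζ, hz⟩)) m)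
    (fun _ hx => exists_chebCoeff_cons_eq_ofReal hreal m hx) _ (by linarith)

lemma PolynomialApproxBound.cons {r' : ℝ} (h : PolynomialApproxBound τ (Fin.tail ρ) r' C)
    (hC : 0 ≤ C) (hτ0 : 0 < τ) (hτ1 : τ < 1) (hρ : 1 < ρ 0) (hr : 0 < r) (hrr' : r ≤ r')
    (hrρ : ∀ j, r ≤ ρ j - 1)
    (hrσ : 2 + 2 * r ≤ lossRate τ (ρ 0) + (lossRate τ (ρ 0))⁻¹) :
    PolynomialApproxBound τ ρ r (2 * (C + 1) * (1 - (lossRate τ (ρ 0))⁻¹)⁻¹) := by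
  intro R B hR hB hreal ℓ hℓ
  have hfloor := fun m => lt_floor_div_add_one_iff (m := m) hℓ (Real.log_pos hρ)
  choose! p hp using fun (m : ℕ) (hm : (m : ℝ) * Real.log (ρ 0) ≤ ℓ) =>
    h.exists_approx_chebCoeff hρ hR hB hreal hm
  refine ⟨chebyshevSum p (⌊ℓ / Real.log (ρ 0)⌋₊ + 1), Submodule.sum_mem _ fun m hm =>
    rename_mul_aeval_T_mem_restrictSupport hρ.le m
      (hp m ((hfloor m).1 (Finset.mem_range.1 hm))).1, fun z hz => ?_⟩
  have hztail : Fin.tail z ∈ complexNhd (fun _ : Fin n => r) := fun j => hz j.succ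
  have hzρ : Fin.tail z ∈ complexNhd (fun j => Fin.tail ρ j - 1) :=
    complexNhd_mono (fun j => hrρ j.succ) hztail
  have hexpansion := norm_sub_sum_mul_eval_T_le hτ0 hτ1 hρ hr (hrρ 0) hrσ
    (differentiableOn_cons hR hzρ) (fun ζ hζ => hB _ (cons_mem_complexNhd_iff.2 ⟨hζ, hzρ⟩)) hC hℓ
    (fun m hm => (hp m hm).2 _ (complexNhd_mono (fun _ => hrr') hztail)) (hz 0)
  rwa [aeval_chebyshevSum, ← Fin.cons_self_tail z]

theorem exists_polynomialApproxBound {τ : ℝ} (hτ0 : 0 < τ) (hτ1 : τ < 1) {n : ℕ} (ρ : Fin n → ℝ)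
    (hρ : ∀ j, 1 < ρ j) :
    ∃ C ≥ 0, ∃ r > 0, (∀ j, r ≤ ρ j - 1) ∧ PolynomialApproxBound τ ρ r C := by
  induction n with
  | zero => exact ⟨0, le_rfl, 1, one_pos, fun j => j.elim0, polynomialApproxBound_of_fin_zero τ ρ 1⟩
  | succ n ih =>
    obtain ⟨C, hC, r', hr', hr'ρ, happrox⟩ := ih (Fin.tail ρ) fun j => hρ j.succ
    have hρ0 := hρ 0
    have hσ : 1 < lossRate τ (ρ 0) := one_lt_lossRate hτ1 hρ0
    set σ := lossRate τ (ρ 0)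
    have hgap : 0 < (σ + σ⁻¹ - 2) / 2 := by
      have : (σ + σ⁻¹ - 2) / 2 = (σ - 1) ^ 2 / (2 * σ) := by field_simp; ring
      rw [this]
      have := sub_pos.2 hσ
      positivity
    obtain ⟨r, hr, hr_lt⟩ := exists_between (lt_min hr' (lt_min (sub_pos.2 hρ0) hgap))
    obtain ⟨hrr', hr_lt_min⟩ := lt_min_iff.1 hr_lt
    obtain ⟨hrρ, hrσ⟩ := lt_min_iff.1 hr_lt_min
    have hrρ' : ∀ j, r ≤ ρ j - 1 :=
      Fin.forall_fin_succ.2 ⟨hrρ.le, fun j => hrr'.le.trans (hr'ρ j)⟩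
    have hq : 0 < 1 - σ⁻¹ := sub_pos.2 (inv_lt_one_of_one_lt₀ hσ)
    exact ⟨_, by positivity, r, hr, hrρ',
      happrox.cons hC hτ0 hτ1 hρ0 hr hrr'.le hrρ' (by linarith)⟩

end PolynomialApprox

/-! ### Counting multi-indices -/

section Counting

variable {n : ℕ}

lemma sum_range_mul_sub_pow_le {a b : ℝ} (ha : 0 ≤ a) {N : ℕ} (hN : N * a ≤ b) :
    ∑ m ∈ Finset.range (N + 1), (n + 1) * a * (b - m * a) ^ n ≤ (b + a) ^ (n + 1) := by
  set u : ℕ → ℝ := fun m => (b + a - m * a) ^ (n + 1)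
  have hstep : ∀ m ∈ Finset.range (N + 1), (n + 1) * a * (b - m * a) ^ n ≤ u m - u (m + 1) := by
    intro m hm
    have hmN : (m : ℝ) * a ≤ b := by
      refine le_trans ?_ hN
      gcongr
      exact Nat.lt_succ_iff.1 (Finset.mem_range.1 hm)
    have hbernoulli := pow_add_mul_le_add_pow_of_sq_nonneg (sub_nonneg.2 hmN) (sq_nonneg a)
      (sq_nonneg (b - m * a + a)) (by linarith) (n + 1)
    simp only [u]
    push_cast at hbernoulli ⊢
    rw [show b + a - m * a = b - m * a + a by ring,
      show b + a - (m + 1) * a = b - m * a by ring]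
    linarith
  have hlast : 0 ≤ u (N + 1) := by
    simp only [u]
    push_cast
    exact pow_nonneg (by linarith) _
  calc _ ≤ ∑ m ∈ Finset.range (N + 1), (u m - u (m + 1)) := Finset.sum_le_sum hstep
    _ = u 0 - u (N + 1) := Finset.sum_range_sub' u (N + 1)
    _ ≤ (b + a) ^ (n + 1) := by simpa [u] using hlast

lemma weightedSimplex_subset_biUnion_cons {ρ : Fin (n + 1) → ℝ} (hρ : ∀ j, 1 ≤ ρ j)
    (hρ0 : 1 < ρ 0) {ℓ : ℝ} (hℓ : 0 ≤ ℓ) :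
    weightedSimplex ρ ℓ ⊆ ⋃ m ∈ Finset.range (⌊ℓ / Real.log (ρ 0)⌋₊ + 1), Finsupp.cons m ''
      weightedSimplex (Fin.tail ρ) (ℓ - m * Real.log (ρ 0)) := by
  intro ν hν
  simp only [weightedSimplex, mem_ofPred_eq, Fin.sum_univ_succ] at hν
  have htail : 0 ≤ ∑ j : Fin n, (ν j.succ : ℝ) * Real.log (ρ j.succ) :=
    Finset.sum_nonneg fun j _ => mul_nonneg (Nat.cast_nonneg _) (Real.log_nonneg (hρ _))
  refine mem_biUnion (Finset.mem_range.2 ((lt_floor_div_add_one_iff hℓ (Real.log_pos hρ0)).2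
    (by linarith : (ν 0 : ℝ) * Real.log (ρ 0) ≤ ℓ))) ⟨ν.tail, ?_, Finsupp.cons_tail ν⟩
  simp only [weightedSimplex, mem_ofPred_eq, Finsupp.tail_apply, Fin.tail]
  linarith

lemma finite_weightedSimplex_succ_and_ncard_le {ρ : Fin (n + 1) → ℝ} (hρ : ∀ j, 1 ≤ ρ j)
    (hρ0 : 1 < ρ 0) {ℓ : ℝ} (hℓ : 0 ≤ ℓ)
    (hslice : ∀ m < ⌊ℓ / Real.log (ρ 0)⌋₊ + 1,
      (weightedSimplex (Fin.tail ρ) (ℓ - m * Real.log (ρ 0))).Finite) :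
    (weightedSimplex ρ ℓ).Finite ∧ (weightedSimplex ρ ℓ).ncard ≤
      ∑ m ∈ Finset.range (⌊ℓ / Real.log (ρ 0)⌋₊ + 1),
        (weightedSimplex (Fin.tail ρ) (ℓ - m * Real.log (ρ 0))).ncard := by
  have hsubset := weightedSimplex_subset_biUnion_cons hρ hρ0 hℓ
  have hunion := (Finset.finite_toSet (Finset.range (⌊ℓ / Real.log (ρ 0)⌋₊ + 1))).biUnion
    fun m hm => (hslice m (Finset.mem_range.1 hm)).image (Finsupp.cons m)
  exact ⟨hunion.subset hsubset, (ncard_le_ncard hsubset hunion).trans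
    ((Finset.set_ncard_biUnion_le _ _).trans
      (Finset.sum_le_sum fun m hm => ncard_image_le (hslice m (Finset.mem_range.1 hm))))⟩

theorem finite_weightedSimplex_and_ncard_mul_le (ρ : Fin n → ℝ) (hρ : ∀ j, 1 < ρ j) {ℓ : ℝ}
    (hℓ : 0 ≤ ℓ) :
    (weightedSimplex ρ ℓ).Finite ∧
      (weightedSimplex ρ ℓ).ncard * (n.factorial * ∏ j, Real.log (ρ j)) ≤
        (ℓ + ∑ j, Real.log (ρ j)) ^ n := by
  induction n generalizing ℓ with
  | zero =>
    have : (weightedSimplex ρ ℓ).ncard ≤ 1 := Set.ncard_le_one_of_subsingleton _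
    exact ⟨toFinite _, by simpa using this⟩
  | succ n ih =>
    have hlog : ∀ j, 0 < Real.log (ρ j) := fun j => Real.log_pos (hρ j)
    have hfloor := fun m => lt_floor_div_add_one_iff (m := m) hℓ (hlog 0)
    have hslice := fun m hm => ih (Fin.tail ρ) (fun j => hρ j.succ) (sub_nonneg.2 ((hfloor m).1 hm))
    obtain ⟨hfinite, hcard⟩ := finite_weightedSimplex_succ_and_ncard_le (fun j => (hρ j).le) (hρ 0)
      hℓ fun m hm => (hslice m hm).1
    refine ⟨hfinite, ?_⟩
    have hprod : 0 < ∏ j, Real.log (Fin.tail ρ j) := Finset.prod_pos fun j _ => hlog _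
    have hsum : 0 ≤ ∑ j, Real.log (Fin.tail ρ j) := Finset.sum_nonneg fun j _ => (hlog _).le
    have hN := (hfloor ⌊ℓ / Real.log (ρ 0)⌋₊).1 (Nat.lt_succ_self _)
    rw [Fin.prod_univ_succ, Fin.sum_univ_succ, Nat.factorial_succ]
    change _ * (_ * (_ * ∏ j, Real.log (Fin.tail ρ j))) ≤
      (_ + (_ + ∑ j, Real.log (Fin.tail ρ j))) ^ _
    set a := Real.log (ρ 0)
    set P := ∏ j, Real.log (Fin.tail ρ j)
    set A := ∑ j, Real.log (Fin.tail ρ j)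
    have ha : 0 < a := hlog 0
    calc _ ≤ ((∑ m ∈ Finset.range (⌊ℓ / a⌋₊ + 1),
            (weightedSimplex (Fin.tail ρ) (ℓ - m * a)).ncard : ℕ) : ℝ) *
          (((n + 1) * n.factorial : ℕ) * (a * P)) := by gcongr
      _ = ∑ m ∈ Finset.range (⌊ℓ / a⌋₊ + 1), (n + 1) * a *
          ((weightedSimplex (Fin.tail ρ) (ℓ - m * a)).ncard * (n.factorial * P)) := by
          push_cast [Finset.sum_mul]
          exact Finset.sum_congr rfl fun m _ => by ring
      _ ≤ ∑ m ∈ Finset.range (⌊ℓ / a⌋₊ + 1), (n + 1) * a * (ℓ + A - m * a) ^ n := by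
          refine Finset.sum_le_sum fun m hm => ?_
          gcongr
          exact (hslice m (Finset.mem_range.1 hm)).2.trans_eq (by ring)
      _ ≤ (ℓ + A + a) ^ (n + 1) := sum_range_mul_sub_pow_le ha.le (by linarith)
      _ = (ℓ + (a + A)) ^ (n + 1) := by ring

end Counting

section IndexSet

lemma gammaWeight_pos {n : ℕ} {ξ : Fin (n + 1) → ℝ} (hξ : ∀ j, 0 < ξ j) (ν : Fin (n + 1) →₀ ℕ) :
    0 < gammaWeight ξ ν :=
  mul_pos (inv_pos.2 (pow_pos (hξ _) _)) (Finset.prod_pos fun _ _ => inv_pos.2 (pow_pos (hξ _) _))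

lemma log_gammaWeight {n : ℕ} {ξ : Fin (n + 1) → ℝ} (hξ : ∀ j, ξ j ≠ 0) (ν : Fin (n + 1) →₀ ℕ) :
    Real.log (gammaWeight ξ ν) =
      -((max 1 (ν (Fin.last n)) : ℕ) * Real.log (ξ (Fin.last n))
        + ∑ j : Fin n, (ν j.castSucc : ℝ) * Real.log (ξ j.castSucc)) := by
  have hpow : ∀ j l, (ξ j ^ l)⁻¹ ≠ 0 := fun j l => inv_ne_zero (pow_ne_zero l (hξ j))
  rw [gammaWeight, Real.log_mul (hpow _ _) (Finset.prod_ne_zero_iff.2 fun j _ => hpow _ _),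
    Real.log_prod fun j _ => hpow _ _]
  simp only [Real.log_inv, Real.log_pow, Finset.sum_neg_distrib]
  ring

variable {d : ℕ} {ξ : Fin d → ℝ}

lemma mem_indexSet_iff (hξ : ∀ j, 0 < ξ j) {k : Fin d} {ε : ℝ} (hε : 0 < ε)
    {ν : Fin (k + 1) →₀ ℕ} :
    ν ∈ indexSet ξ k ε ↔ (max 1 (ν (Fin.last k)) : ℕ) * Real.log (ξ k) +
      ∑ j : Fin k, (ν j.castSucc : ℝ) * Real.log (initialSegment k ξ j.castSucc) ≤
        -Real.log ε := by
  have hlast : initialSegment k ξ (Fin.last k) = ξ k := rfl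
  rw [indexSet, mem_ofPred_eq, ← Real.log_le_log_iff hε (gammaWeight_pos (ξ := initialSegment k ξ)
    (fun _ => hξ _) ν), log_gammaWeight (ξ := initialSegment k ξ) (fun _ => (hξ _).ne'), hlast,
    le_neg]

lemma indexSet_subset_weightedSimplex (hξ : ∀ j, 1 ≤ ξ j) (k : Fin d) {ε : ℝ} (hε : 0 < ε) :
    indexSet ξ k ε ⊆ weightedSimplex (initialSegment k ξ) (-Real.log ε) := by
  intro ν hν
  rw [mem_indexSet_iff (fun j => one_pos.trans_le (hξ j)) hε] at hν
  rw [weightedSimplex, mem_ofPred_eq, Fin.sum_univ_castSucc]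
  have hlast : (ν (Fin.last k) : ℝ) * Real.log (ξ k) ≤
      (max 1 (ν (Fin.last k)) : ℕ) * Real.log (ξ k) := by
    have := Real.log_nonneg (hξ k)
    gcongr
    exact le_max_right _ _
  exact (add_comm _ _).trans_le ((add_le_add_left hlast _).trans hν)

lemma weightedSimplex_subset_indexSet (hξ : ∀ j, 1 ≤ ξ j) (k : Fin d) {ε : ℝ} (hε : 0 < ε) :
    weightedSimplex (initialSegment k ξ) (-Real.log ε - Real.log (ξ k)) ⊆ indexSet ξ k ε := by
  intro ν hν
  rw [mem_indexSet_iff (fun j => one_pos.trans_le (hξ j)) hε]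
  rw [weightedSimplex, mem_ofPred_eq, Fin.sum_univ_castSucc] at hν
  have hk : initialSegment k ξ (Fin.last k) = ξ k := rfl
  have hlast : ((max 1 (ν (Fin.last k)) : ℕ) : ℝ) * Real.log (ξ k) ≤
      (1 + (ν (Fin.last k) : ℝ)) * Real.log (ξ k) := by
    refine mul_le_mul_of_nonneg_right ?_ (Real.log_nonneg (hξ k))
    exact_mod_cast max_le (Nat.le_add_right _ _) (Nat.le_add_left _ _)
  rw [hk] at hν
  linarith

lemma ncard_indexSet_mul_le (hξ : ∀ j, 1 < ξ j) (k : Fin d) {ε : ℝ} (hε : 0 < ε) (hε1 : ε ≤ 1) :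
    ((indexSet ξ k ε).ncard : ℝ) *
      ((k + 1 : ℕ).factorial * ∏ j, Real.log (initialSegment k ξ j)) ≤
      (-Real.log ε + ∑ j, Real.log (ξ j)) ^ (k + 1 : ℕ) := by
  have hlog : ∀ j, 0 < Real.log (ξ j) := fun j => Real.log_pos (hξ j)
  have hℓ : 0 ≤ -Real.log ε := neg_nonneg.2 (Real.log_nonpos hε.le hε1)
  obtain ⟨hfinite, hcard⟩ := finite_weightedSimplex_and_ncard_mul_le (initialSegment k ξ)
    (fun _ => hξ _) hℓ
  have hsubset := ncard_le_ncard
    (indexSet_subset_weightedSimplex (fun j => (hξ j).le) k hε) hfinite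
  have hsum : ∑ j, Real.log (initialSegment k ξ j) ≤ ∑ j, Real.log (ξ j) := by
    have hmap : ∑ j, Real.log (initialSegment k ξ j) =
        ∑ j ∈ Finset.univ.map (Fin.castLEEmb k.isLt), Real.log (ξ j) := by
      rw [Finset.sum_map]
      rfl
    rw [hmap]
    exact Finset.sum_le_sum_of_subset_of_nonneg (Finset.subset_univ _) fun j _ _ => (hlog j).le
  have hsum0 : 0 ≤ ∑ j, Real.log (initialSegment k ξ j) :=
    Finset.sum_nonneg fun j _ => (hlog _).le
  have hprod : 0 < ∏ j, Real.log (initialSegment k ξ j) := Finset.prod_pos fun j _ => hlog _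
  calc _ ≤ ((weightedSimplex (initialSegment k ξ) (-Real.log ε)).ncard : ℝ) *
        ((k + 1 : ℕ).factorial * ∏ j, Real.log (initialSegment k ξ j)) := by gcongr
    _ ≤ _ := hcard
    _ ≤ _ := by gcongr

/-- Only the last index set contributes to the leading order in `log ε⁻¹`. -/
lemma exists_totalCard_le {n : ℕ} {ξ : Fin (n + 1) → ℝ} (hξ : ∀ j, 1 < ξ j) :
    ∃ c ≥ 0, ∀ ε ∈ Ioo (0 : ℝ) 1, (totalCard ξ ε : ℝ) ≤
      c * (-Real.log ε + ∑ j, Real.log (ξ j) + 1) ^ n +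
        (-Real.log ε + ∑ j, Real.log (ξ j) + 1) ^ (n + 1) /
          ((n + 1).factorial * ∏ j, Real.log (ξ j)) := by
  have hlog : ∀ j, 0 < Real.log (ξ j) := fun j => Real.log_pos (hξ j)
  set D : Fin (n + 1) → ℝ := fun k =>
    (k + 1 : ℕ).factorial * ∏ j, Real.log (initialSegment k ξ j)
  have hD : ∀ k, 0 < D k := fun k =>
    mul_pos (by exact_mod_cast Nat.factorial_pos _) (Finset.prod_pos fun j _ => hlog _)
  refine ⟨∑ k : Fin n, (D k.castSucc)⁻¹, Finset.sum_nonneg fun k _ => (inv_pos.2 (hD _)).le,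
    fun ε ⟨hε, hε1⟩ => ?_⟩
  have hℓ : 0 ≤ -Real.log ε := neg_nonneg.2 (Real.log_nonpos hε.le hε1.le)
  have hsum : 0 ≤ ∑ j, Real.log (ξ j) := Finset.sum_nonneg fun j _ => (hlog j).le
  have hk : ∀ k, ((indexSet ξ k ε).ncard : ℝ) ≤
      (-Real.log ε + ∑ j, Real.log (ξ j) + 1) ^ (k + 1 : ℕ) / D k := fun k => by
    rw [le_div_iff₀ (hD k)]
    exact (ncard_indexSet_mul_le hξ k hε hε1.le).trans
      (pow_le_pow_left₀ (add_nonneg hℓ hsum) (by linarith) _)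
  rw [totalCard, Nat.cast_sum, Fin.sum_univ_castSucc, Finset.sum_mul]
  refine add_le_add (Finset.sum_le_sum fun k _ => (hk _).trans ?_) (hk (Fin.last n))
  rw [div_eq_inv_mul]
  exact mul_le_mul_of_nonneg_left (pow_le_pow_right₀ (by linarith) k.isLt) (inv_pos.2 (hD _)).le

theorem exists_rate_mul_totalCard_rpow_le (hd : 1 ≤ d) (hξ : ∀ j, 1 < ξ j) :
    ∃ K : ℝ, ∀ ε ∈ Ioo (0 : ℝ) 1,
      rate ξ * (totalCard ξ ε : ℝ) ^ (1 / (d : ℝ)) ≤ -Real.log ε + K := by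
  obtain ⟨n, rfl⟩ : ∃ n, d = n + 1 := ⟨d - 1, by omega⟩
  have hlog : ∀ j, 0 < Real.log (ξ j) := fun j => Real.log_pos (hξ j)
  obtain ⟨c, hc, hcard⟩ := exists_totalCard_le hξ
  have hA : 0 ≤ ∑ j, Real.log (ξ j) := Finset.sum_nonneg fun j _ => (hlog j).le
  have hP : 0 < ∏ j, Real.log (ξ j) := Finset.prod_pos fun j _ => hlog j
  set A := ∑ j, Real.log (ξ j)
  set P := ∏ j, Real.log (ξ j)
  set Q := (n.factorial : ℝ) * P * c
  have hQ : 0 ≤ Q := by positivity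
  refine ⟨A + 1 + Q, fun ε hε => ?_⟩
  have hX : 0 ≤ -Real.log ε + A + 1 := by
    linarith [Real.log_nonpos hε.1.le hε.2.le]
  set X := -Real.log ε + A + 1 with hX'
  have hmain : (n.factorial : ℝ) * P * totalCard ξ ε ≤ (X + Q) ^ (n + 1) := by
    calc _ ≤ (n.factorial : ℝ) * P * (c * X ^ n + X ^ (n + 1) / ((n + 1).factorial * P)) := by
          gcongr
          exact hcard ε hε
      _ = Q * X ^ n + X ^ (n + 1) / (n + 1) := by
          rw [Nat.factorial_succ]
          push_cast
          field_simp
          simp only [Q]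
          ring
      _ ≤ (n + 1) * (Q * X ^ n) + X ^ (n + 1) := by
          refine add_le_add (le_mul_of_one_le_left (by positivity) ?_)
            (div_le_self (by positivity) ?_) <;> simp
      _ ≤ _ := by
          have := pow_add_mul_le_add_pow_of_sq_nonneg hX (sq_nonneg Q) (sq_nonneg (X + Q))
            (by linarith) (n + 1)
          push_cast [Nat.add_sub_cancel] at this
          linarith
  rw [rate, Nat.add_sub_cancel, ← Real.mul_rpow (by positivity) (by positivity)]
  calc _ ≤ ((X + Q) ^ (n + 1)) ^ (1 / ((n + 1 : ℕ) : ℝ)) :=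
        Real.rpow_le_rpow (by positivity) hmain (by positivity)
    _ = X + Q := by rw [one_div, Real.pow_rpow_inv_natCast (by linarith) n.succ_ne_zero]
    _ = _ := by rw [hX']; ring

end IndexSet

/-! ### Sobolev norms of holomorphic functions -/

section Sobolev

variable {d : ℕ}

lemma add_single_mem_complexNhd {r s : ℝ} (hs : 0 ≤ s) {z : Fin d → ℂ}
    (hz : z ∈ complexNhd fun _ : Fin d => r) (j : Fin d) {ζ : ℂ} (hζ : ‖ζ‖ ≤ s) :
    z + Pi.single j ζ ∈ complexNhd fun _ : Fin d => r + s := by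
  intro i
  obtain ⟨y, hy, hzy⟩ := hz i
  refine ⟨y, hy, ?_⟩
  rcases eq_or_ne i j with rfl | hij
  · rw [Pi.add_apply, Pi.single_eq_same, add_sub_right_comm]
    exact (norm_add_le _ _).trans_lt (by linarith)
  · rw [Pi.add_apply, Pi.single_eq_of_ne hij, add_zero]
    linarith

section CauchyEstimates

variable {r η : ℝ} {U : (Fin d → ℂ) → ℂ}

lemma add_single_mem_complexNhd_of_half (hr : 0 ≤ r) {z : Fin d → ℂ}
    (hz : z ∈ complexNhd fun _ : Fin d => r / 2) (j : Fin d) {ζ : ℂ} (hζ : ‖ζ‖ ≤ r / 2) :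
    z + Pi.single j ζ ∈ complexNhd fun _ : Fin d => r := by
  simpa only [add_halves] using add_single_mem_complexNhd (by linarith) hz j hζ

lemma hasDerivAt_comp_add_single {U : (Fin d → ℂ) → ℂ} {z : Fin d → ℂ} {j : Fin d} {ζ : ℂ}
    (hU : DifferentiableAt ℂ U (z + Pi.single j ζ)) :
    HasDerivAt (fun ζ => U (z + Pi.single j ζ))
      (fderiv ℂ U (z + Pi.single j ζ) (Pi.single j 1)) ζ := by
  have hline : HasFDerivAt (fun ζ : ℂ => z + Pi.single j ζ)
      (ContinuousLinearMap.single ℂ (fun _ : Fin d => ℂ) j) ζ :=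
    (ContinuousLinearMap.single ℂ (fun _ : Fin d => ℂ) j).hasFDerivAt.const_add z
  have := (hU.hasFDerivAt.comp ζ hline).hasDerivAt
  simp only [ContinuousLinearMap.comp_apply, ContinuousLinearMap.single_apply] at this
  exact this

lemma deriv_comp_add_single_zero {z : Fin d → ℂ} {j : Fin d} (hU : DifferentiableAt ℂ U z) :
    deriv (fun ζ => U (z + Pi.single j ζ)) 0 = fderiv ℂ U z (Pi.single j 1) := by
  have hz : z + Pi.single j 0 = z := by rw [Pi.single_zero, add_zero]
  rw [(hasDerivAt_comp_add_single (j := j) (hz.symm ▸ hU)).deriv, hz]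

lemma isOpen_setOf_add_single_mem_complexNhd (z : Fin d → ℂ) (j : Fin d) :
    IsOpen {ζ : ℂ | z + Pi.single j ζ ∈ complexNhd fun _ : Fin d => r} :=
  (isOpen_complexNhd _).preimage
    (continuous_const.add (ContinuousLinearMap.single ℂ (fun _ : Fin d => ℂ) j).continuous)

lemma differentiableOn_comp_add_single (hU : DifferentiableOn ℂ U (complexNhd fun _ => r))
    (z : Fin d → ℂ) (j : Fin d) :
    DifferentiableOn ℂ (fun ζ => U (z + Pi.single j ζ))
      {ζ | z + Pi.single j ζ ∈ complexNhd fun _ => r} := fun _ hζ =>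
  (hasDerivAt_comp_add_single (hU.differentiableAt
    ((isOpen_complexNhd _).mem_nhds hζ))).differentiableAt.differentiableWithinAt

lemma fderiv_single_eq_setIntegral (hr : 0 < r)
    (hU : DifferentiableOn ℂ U (complexNhd fun _ => r)) {z : Fin d → ℂ}
    (hz : z ∈ complexNhd fun _ => r / 2) (j : Fin d) :
    fderiv ℂ U z (Pi.single j 1) = ∫ θ in Icc 0 (2 * Real.pi),
      ((2 * Real.pi * Complex.I : ℂ)⁻¹ *
        (circleMap 0 (r / 2) θ * Complex.I * (circleMap 0 (r / 2) θ ^ 2)⁻¹)) •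
        U (z + Pi.single j (circleMap 0 (r / 2) θ)) := by
  have hzr : z ∈ complexNhd fun _ => r := by
    simpa using add_single_mem_complexNhd_of_half hr.le hz j (ζ := 0)
      (by simpa using (half_pos hr).le)
  have hball : closedBall (0 : ℂ) (r / 2) ⊆ {ζ | z + Pi.single j ζ ∈ complexNhd fun _ => r} :=
    fun ζ hζ => add_single_mem_complexNhd_of_half hr.le hz j (by simpa using hζ)
  rw [← deriv_comp_add_single_zero (hU.differentiableAt ((isOpen_complexNhd _).mem_nhds hzr)),
    ← Complex.two_pi_I_inv_smul_circleIntegral_sub_sq_inv_smul_of_differentiable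
      (isOpen_setOf_add_single_mem_complexNhd z j) hball
      (differentiableOn_comp_add_single hU z j) (mem_ball_self (half_pos hr)),
    circleIntegral, intervalIntegral.integral_of_le (by positivity),
    integral_Icc_eq_integral_Ioc, smul_eq_mul, ← integral_const_mul]
  refine integral_congr_ae (Filter.Eventually.of_forall fun θ => ?_)
  simp only [deriv_circleMap, sub_zero, smul_eq_mul]
  ring

theorem contDiffOn_fderiv_single (hr : 0 < r) (hU : ContDiffOn ℂ 1 U (complexNhd fun _ => r))
    (j : Fin d) :
    ContDiffOn ℂ 1 (fun z => fderiv ℂ U z (Pi.single j 1)) (complexNhd fun _ => r / 2) := by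
  have hcircle : ContinuousOn
      (fun θ => (Pi.single j (circleMap 0 (r / 2) θ) : Fin d → ℂ)) (Icc 0 (2 * Real.pi)) :=
    ((ContinuousLinearMap.single ℂ (fun _ : Fin d => ℂ) j).continuous.comp
      (continuous_circleMap 0 (r / 2))).continuousOn
  have hkernel : Continuous fun θ => (2 * Real.pi * Complex.I : ℂ)⁻¹ *
      (circleMap 0 (r / 2) θ * Complex.I * (circleMap 0 (r / 2) θ ^ 2)⁻¹) :=
    continuous_const.mul (((continuous_circleMap 0 (r / 2)).mul continuous_const).mul
      (((continuous_circleMap 0 (r / 2)).pow 2).inv₀ fun _ =>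
        pow_ne_zero _ (circleMap_ne_center (half_pos hr).ne')))
  have hmem : ∀ z ∈ complexNhd (fun _ : Fin d => r / 2), ∀ θ ∈ Icc 0 (2 * Real.pi),
      z + Pi.single j (circleMap 0 (r / 2) θ) ∈ complexNhd fun _ : Fin d => r := fun z hz θ _ =>
    add_single_mem_complexNhd_of_half hr.le hz j
      (by rw [norm_circleMap_zero, abs_of_pos (half_pos hr)])
  exact (contDiffOn_setIntegral_comp_affine (μ := volume) isCompact_Icc measurableSet_Icc
    (isOpen_complexNhd _) (isOpen_complexNhd _) hU
    (A := fun _ => ContinuousLinearMap.id ℂ (Fin d → ℂ)) continuousOn_const hcircle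
    hkernel.continuousOn hmem).congr fun z hz =>
      fderiv_single_eq_setIntegral hr (hU.differentiableOn one_ne_zero) hz j

lemma norm_fderiv_single_le (hr : 0 < r) (hU : DifferentiableOn ℂ U (complexNhd fun _ => r))
    (hη : ∀ z ∈ complexNhd (fun _ : Fin d => r), ‖U z‖ ≤ η) (j : Fin d) {z : Fin d → ℂ}
    (hz : z ∈ complexNhd fun _ => r / 2) : ‖fderiv ℂ U z (Pi.single j 1)‖ ≤ η / (r / 2) := by
  have hball : closedBall (0 : ℂ) (r / 2) ⊆ {ζ | z + Pi.single j ζ ∈ complexNhd fun _ => r} :=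
    fun ζ hζ => add_single_mem_complexNhd_of_half hr.le hz j (by simpa using hζ)
  have hzr : z ∈ complexNhd fun _ => r := by
    simpa using hball (mem_closedBall_self (half_pos hr).le)
  rw [← deriv_comp_add_single_zero (hU.differentiableAt ((isOpen_complexNhd _).mem_nhds hzr))]
  exact Complex.norm_deriv_le_of_forall_mem_sphere_norm_le (half_pos hr)
    (((differentiableOn_comp_add_single hU z j).mono hball).diffContOnCl_ball subset_rfl)
    fun ζ hζ => hη _ (hball (sphere_subset_closedBall hζ))

end CauchyEstimates

/-- The inclusion of real vectors into complex ones, as a linear map. -/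
def toComplexCLM (d : ℕ) : (Fin d → ℝ) →L[ℝ] (Fin d → ℂ) :=
  ContinuousLinearMap.pi fun j => Complex.ofRealCLM.comp (ContinuousLinearMap.proj j)

lemma toComplexCLM_apply (x : Fin d → ℝ) : toComplexCLM d x = toComplex x := rfl

lemma toComplexCLM_single (j : Fin d) :
    toComplexCLM d (Pi.single j 1) = Pi.single j 1 := by
  ext i
  rcases eq_or_ne i j with rfl | h
  · simp [toComplexCLM_apply, toComplex]
  · simp [toComplexCLM_apply, toComplex, h]

lemma hasFDerivAt_re_comp_toComplex {U : (Fin d → ℂ) → ℂ} {x : Fin d → ℝ}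
    (h : DifferentiableAt ℂ U (toComplex x)) :
    HasFDerivAt (fun y => (U (toComplex y)).re)
      (Complex.reCLM.comp (((fderiv ℂ U (toComplex x)).restrictScalars ℝ).comp (toComplexCLM d)))
      x :=
  Complex.reCLM.hasFDerivAt.comp x
    ((h.hasFDerivAt.restrictScalars ℝ).comp (f := toComplexCLM d) x (toComplexCLM d).hasFDerivAt)

/-- The test functions in the definition of weak derivatives: smooth functions with compact support
in the open cube. -/
structure IsTestFunction (φ : (Fin d → ℝ) → ℝ) : Prop where
  contDiff : ContDiff ℝ ∞ φ
  hasCompactSupport : HasCompactSupport φ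
  tsupport_subset : tsupport φ ⊆ openCube d

lemma IsTestFunction.partialDeriv {φ : (Fin d → ℝ) → ℝ} (h : IsTestFunction φ) (j : Fin d) :
    IsTestFunction (partialDeriv j φ) where
  contDiff := (h.contDiff.fderiv_right (m := ∞) (by simp)).clm_apply contDiff_const
  hasCompactSupport := h.hasCompactSupport.fderiv_apply (𝕜 := ℝ) _
  tsupport_subset := (tsupport_fderiv_apply_subset ℝ _).trans h.tsupport_subset

lemma setIntegral_openCube_mul {φ : (Fin d → ℝ) → ℝ} (hφ : tsupport φ ⊆ openCube d)
    (u : (Fin d → ℝ) → ℝ) : ∫ x in openCube d, u x * φ x = ∫ x, u x * φ x := by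
  refine setIntegral_eq_integral_of_forall_compl_eq_zero fun x hx => ?_
  rw [image_eq_zero_of_notMem_tsupport fun h => hx (hφ h), mul_zero]

lemma IsTestFunction.integrable_mul {φ : (Fin d → ℝ) → ℝ} (h : IsTestFunction φ)
    {u : (Fin d → ℝ) → ℝ} (hu : ContinuousOn u (openCube d)) : Integrable fun x => u x * φ x := by
  have hsupp : Function.support (fun x => u x * φ x) ⊆ tsupport φ := fun x hx => by
    by_contra hn
    exact hx (by simp [image_eq_zero_of_notMem_tsupport hn])
  rw [← integrableOn_iff_integrable_of_support_subset hsupp]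
  exact ((hu.mono h.tsupport_subset).mul h.contDiff.continuous.continuousOn).integrableOn_compact
    h.hasCompactSupport

section

variable {r η : ℝ} {U : (Fin d → ℂ) → ℂ}

lemma continuousOn_re_comp_toComplex (hr : 0 < r)
    (hU : ContDiffOn ℂ 1 U (complexNhd fun _ : Fin d => r)) :
    ContinuousOn (fun x => (U (toComplex x)).re) (openCube d) :=
  Complex.continuous_re.comp_continuousOn (hU.continuousOn.comp continuous_toComplex.continuousOn
    fun _ hx => toComplex_mem_complexNhd (fun _ => hr) (openCube_subset_cube d hx))

lemma integral_re_mul_partialDeriv (hr : 0 < r)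
    (hU : ContDiffOn ℂ 1 U (complexNhd fun _ : Fin d => r)) (j : Fin d)
    {φ : (Fin d → ℝ) → ℝ} (hφ : IsTestFunction φ)
    (hV : ContinuousOn (fun x => (fderiv ℂ U (toComplex x) (Pi.single j 1)).re) (openCube d)) :
    ∫ x in openCube d, (U (toComplex x)).re * partialDeriv j φ x =
      -∫ x in openCube d, (fderiv ℂ U (toComplex x) (Pi.single j 1)).re * φ x := by
  have hd : ∀ x ∈ openCube d, DifferentiableAt ℂ U (toComplex x) := fun x hx =>
    (hU.differentiableOn one_ne_zero).differentiableAt ((isOpen_complexNhd _).mem_nhds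
      (toComplex_mem_complexNhd (fun _ => hr) (openCube_subset_cube d hx)))
  have hf : ∀ x, fderiv ℝ (fun y => (U (toComplex y)).re) x (Pi.single j 1) * φ x =
      (fderiv ℂ U (toComplex x) (Pi.single j 1)).re * φ x := by
    intro x
    by_cases hx : x ∈ tsupport φ
    · rw [(hasFDerivAt_re_comp_toComplex (hd x (hφ.tsupport_subset hx))).fderiv]
      simp [toComplexCLM_single]
    · simp [image_eq_zero_of_notMem_tsupport hx]
  have hcU := continuousOn_re_comp_toComplex hr hU
  rw [setIntegral_openCube_mul (hφ.partialDeriv j).tsupport_subset,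
    setIntegral_openCube_mul hφ.tsupport_subset]
  simp_rw [← hf]
  refine integral_mul_fderiv_eq_neg_fderiv_mul_of_integrable ?_
    ((hφ.partialDeriv j).integrable_mul hcU) (hφ.integrable_mul hcU) ?_ ?_
  · simp_rw [hf]
    exact hφ.integrable_mul hV
  · exact fun x hx =>
      (hasFDerivAt_re_comp_toComplex (hd x (hφ.tsupport_subset hx))).differentiableAt
  · exact fun x _ => (hφ.contDiff.differentiable (by simp)).differentiableAt

end

lemma exists_iterated_partialDeriv (n : ℕ) : ∀ r : ℝ, 0 < r → ∃ C : ℝ, 0 ≤ C ∧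
    ∀ w : List (Fin d), w.length = n → ∀ (U : (Fin d → ℂ) → ℂ) (η : ℝ),
      ContDiffOn ℂ 1 U (complexNhd fun _ : Fin d => r) →
      (∀ z ∈ complexNhd (fun _ : Fin d => r), ‖U z‖ ≤ η) →
      ∃ (V : (Fin d → ℂ) → ℂ) (r' : ℝ), 0 < r' ∧
        ContDiffOn ℂ 1 V (complexNhd fun _ : Fin d => r') ∧
        (∀ z ∈ complexNhd (fun _ : Fin d => r'), ‖V z‖ ≤ C * η) ∧
        ∀ φ, IsTestFunction φ → ∫ x in openCube d, (U (toComplex x)).re * w.foldr partialDeriv φ x =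
          (-1) ^ n * ∫ x in openCube d, (V (toComplex x)).re * φ x := by
  induction n with
  | zero =>
    intro r hr
    refine ⟨1, zero_le_one, fun w hw U η hU hη => ⟨U, r, hr, hU, by simpa using hη, fun φ _ => ?_⟩⟩
    simp [List.length_eq_zero_iff.1 hw]
  | succ n ih =>
    intro r hr
    obtain ⟨C, hC, h⟩ := ih (r / 2) (by linarith)
    refine ⟨C / (r / 2), by positivity, fun w hw U η hU hη => ?_⟩
    obtain ⟨j, w, rfl⟩ := List.exists_cons_of_length_eq_add_one hw
    have hderiv := contDiffOn_fderiv_single hr hU j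
    obtain ⟨V, r', hr', hV, hVb, hint⟩ := h w (by simpa using hw) _ _ hderiv
      fun z hz => norm_fderiv_single_le hr (hU.differentiableOn one_ne_zero) hη j hz
    refine ⟨V, r', hr', hV, fun z hz => (hVb z hz).trans (le_of_eq (by ring)), fun φ hφ => ?_⟩
    have htest : ∀ w : List (Fin d), IsTestFunction (w.foldr partialDeriv φ) := by
      intro w
      induction w with
      | nil => exact hφ
      | cons j w ih => exact ih.partialDeriv j
    rw [List.foldr_cons, integral_re_mul_partialDeriv hr hU j (htest w)
      (continuousOn_re_comp_toComplex (half_pos hr) hderiv), hint φ hφ]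
    ring

lemma mixedPartial_eq_foldr (ν : Fin d → ℕ) (φ : (Fin d → ℝ) → ℝ) :
    mixedPartial ν φ =
      ((List.finRange d).flatMap fun j => List.replicate (ν j) j).foldr partialDeriv φ := by
  unfold mixedPartial
  induction List.finRange d with
  | nil => rfl
  | cons j l ih =>
    rw [List.foldr_cons, List.flatMap_cons, List.foldr_append, ih]
    generalize (l.flatMap fun j => List.replicate (ν j) j).foldr partialDeriv φ = ψ
    induction ν j with
    | zero => rfl
    | succ n ihn => rw [Function.iterate_succ_apply', ihn, List.replicate_succ, List.foldr_cons]

theorem exists_sobolevNorm_le (m : ℕ) {r : ℝ} (hr : 0 < r) : ∃ C : ℝ, 0 ≤ C ∧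
    ∀ (U : (Fin d → ℂ) → ℂ) (η : ℝ) (u : (Fin d → ℝ) → ℝ),
      ContDiffOn ℂ 1 U (complexNhd fun _ : Fin d => r) →
      (∀ z ∈ complexNhd (fun _ : Fin d => r), ‖U z‖ ≤ η) →
      (∀ x ∈ openCube d, (U (toComplex x)).re = u x) →
      sobolevNorm m u ≤ ENNReal.ofReal (C * η) := by
  choose C hC h using fun n => exists_iterated_partialDeriv (d := d) n r hr
  refine ⟨∑ n ∈ Finset.range (m + 1), C n, Finset.sum_nonneg fun n _ => hC n,
    fun U η u hU hη hu => ?_⟩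
  have hη0 : 0 ≤ η := (norm_nonneg _).trans
    (hη (toComplex 0) (toComplex_mem_complexNhd (fun _ => hr) (by simp [cube])))
  refine iSup₂_le fun ν hν => ?_
  obtain ⟨V, r', hr', hV, hVb, hint⟩ := h (∑ j, ν j)
    ((List.finRange d).flatMap fun j => List.replicate (ν j) j)
    (by simp [List.length_flatMap, ← List.ofFn_eq_map, List.sum_ofFn]) U η hU hη
  have hmeas : MeasurableSet (openCube d) := (isOpen_openCube d).measurableSet
  have hw : IsWeakDeriv ν u fun x => (V (toComplex x)).re := by
    refine ⟨?_, ?_, fun φ hφ hcompact hsupp => ?_⟩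
    · exact ((continuousOn_re_comp_toComplex hr hU).congr fun x hx =>
        (hu x hx).symm).locallyIntegrableOn hmeas
    · exact (continuousOn_re_comp_toComplex hr' hV).locallyIntegrableOn hmeas
    · rw [mixedPartial_eq_foldr, ← hint φ ⟨hφ, hcompact, hsupp⟩]
      exact setIntegral_congr_fun hmeas fun x hx => by simp only [hu x hx]
  refine (iInf₂_le _ hw).trans ?_
  rw [eLpNorm_exponent_top]
  refine eLpNormEssSup_le_of_ae_bound ?_
  refine (ae_restrict_iff' hmeas).2 (Filter.Eventually.of_forall fun x hx => ?_)
  have hVx := hVb (toComplex x)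
    (toComplex_mem_complexNhd (fun _ => hr') (openCube_subset_cube d hx))
  refine (Complex.abs_re_le_norm _).trans (hVx.trans ?_)
  gcongr
  exact Finset.single_le_sum (f := C) (fun n _ => hC n) (Finset.mem_range.2 (by omega))

end Sobolev

/-! ### Triangular maps -/

section Triangular

variable {d : ℕ} {T : (Fin d → ℝ) → (Fin d → ℝ)}

lemma mapsTo_cube_of_endpoints
    (hmono : ∀ k, ∀ x ∈ cube d, MonotoneOn (fun s => T (Function.update x k s) k) (Icc (-1) 1))
    (hleft : ∀ k, ∀ x ∈ cube d, T (Function.update x k (-1)) k = -1)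
    (hright : ∀ k, ∀ x ∈ cube d, T (Function.update x k 1) k = 1) :
    MapsTo T (cube d) (cube d) := by
  intro x hx k
  have hlower := hmono k x hx (left_mem_Icc.2 (by norm_num)) (hx k) (hx k).1
  have hupper := hmono k x hx (hx k) (right_mem_Icc.2 (by norm_num)) (hx k).2
  simp only [Function.update_eq_self] at hlower hupper
  exact ⟨(hleft k x hx).symm.trans_le hlower, hupper.trans_eq (hright k x hx)⟩

lemma injOn_cube_of_triangular
    (htri : ∀ k, ∀ x ∈ cube d, ∀ y ∈ cube d, (∀ j ≤ k, x j = y j) → T x k = T y k)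
    (hinj : ∀ k, ∀ x ∈ cube d, InjOn (fun s => T (Function.update x k s) k) (Icc (-1) 1)) :
    InjOn T (cube d) := by
  intro x hx y hy hxy
  ext k
  induction k using WellFoundedLT.induction with
  | ind k ih =>
    refine hinj k x hx (hx k) (hy k) ?_
    simp only [Function.update_eq_self]
    rw [hxy]
    refine htri k y hy _ (update_mem_cube hx (hy k)) fun j hj => ?_
    rcases hj.eq_or_lt with rfl | hj
    · rw [Function.update_self]
    · rw [Function.update_of_ne hj.ne, ih j hj]

lemma surjOn_cube_of_triangular
    (htri : ∀ k, ∀ x ∈ cube d, ∀ y ∈ cube d, (∀ j ≤ k, x j = y j) → T x k = T y k)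
    (hsurj : ∀ k, ∀ x ∈ cube d,
      SurjOn (fun s => T (Function.update x k s) k) (Icc (-1) 1) (Icc (-1) 1)) :
    SurjOn T (cube d) (cube d) := by
  intro y hy
  have hsolve : ∀ n : ℕ, ∃ x ∈ cube d, ∀ j : Fin d, (j : ℕ) < n → T x j = y j := by
    intro n
    induction n with
    | zero => exact ⟨y, hy, fun j hj => absurd hj (Nat.not_lt_zero _)⟩
    | succ n ih =>
      obtain ⟨x, hx, hxy⟩ := ih
      by_cases hn : n < d
      · obtain ⟨s, hs, hsy⟩ := hsurj ⟨n, hn⟩ x hx (hy _)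
        refine ⟨Function.update x ⟨n, hn⟩ s, update_mem_cube hx hs, fun j hj => ?_⟩
        rcases Nat.lt_succ_iff_lt_or_eq.1 hj with hj | hj
        · rw [← hxy j hj]
          exact htri j _ (update_mem_cube hx hs) x hx fun i hi =>
            Function.update_of_ne (Fin.ne_of_lt (lt_of_le_of_lt (Fin.le_def.1 hi) hj)) _ _
        · obtain rfl : j = ⟨n, hn⟩ := Fin.ext hj
          exact hsy
      · exact ⟨x, hx, fun j _ => hxy j (j.isLt.trans_le (not_lt.1 hn))⟩
  obtain ⟨x, hx, hxy⟩ := hsolve d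
  exact ⟨x, hx, funext fun j => hxy j j.isLt⟩

theorem isMonotoneTriangularBijection_of_endpoints
    (htri : ∀ k, ∀ x ∈ cube d, ∀ y ∈ cube d, (∀ j ≤ k, x j = y j) → T x k = T y k)
    (hmono : ∀ k, ∀ x ∈ cube d, StrictMonoOn (fun s => T (Function.update x k s) k) (Icc (-1) 1))
    (hcont : ∀ k, ∀ x ∈ cube d, ContinuousOn (fun s => T (Function.update x k s) k) (Icc (-1) 1))
    (hleft : ∀ k, ∀ x ∈ cube d, T (Function.update x k (-1)) k = -1)
    (hright : ∀ k, ∀ x ∈ cube d, T (Function.update x k 1) k = 1) :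
    IsMonotoneTriangularBijection T where
  triangular := htri
  monotone := hmono
  bijOn := by
    refine ⟨mapsTo_cube_of_endpoints (fun k x hx => (hmono k x hx).monotoneOn) hleft hright,
      injOn_cube_of_triangular htri fun k x hx => (hmono k x hx).injOn,
      surjOn_cube_of_triangular htri fun k x hx => ?_⟩
    have hivt := intermediate_value_Icc (by norm_num) (hcont k x hx)
    rwa [hleft k x hx, hright k x hx] at hivt

end Triangular

/-! ### The Knothe–Rosenblatt map -/

section KnotheRosenblatt

variable {d : ℕ}

/-- The first `k` coordinates of `z`, completed by those of `t`. -/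
def mix {R : Type*} (k : ℕ) (z t : Fin d → R) : Fin d → R :=
  fun j => if (j : ℕ) < k then z j else t j

lemma mix_congr {R : Type*} {k : ℕ} {z w : Fin d → R} (h : ∀ j : Fin d, (j : ℕ) < k → z j = w j)
    (t : Fin d → R) : mix k z t = mix k w t :=
  funext fun j => ite_congr rfl (h j) fun _ => rfl

lemma marginal_eq_integral_mix (f : (Fin d → ℝ) → ℝ) (k : ℕ) (x : Fin d → ℝ) :
    marginal f k x = ∫ t, f (mix k x t) ∂(cubeMeasure d) := rfl

lemma marginal_congr (f : (Fin d → ℝ) → ℝ) {k : ℕ} {x y : Fin d → ℝ}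
    (h : ∀ j : Fin d, (j : ℕ) < k → x j = y j) : marginal f k x = marginal f k y := by
  simp only [marginal_eq_integral_mix, mix_congr h]

lemma condCDF_congr (f : (Fin d → ℝ) → ℝ) {k : Fin d} {x y : Fin d → ℝ}
    (h : ∀ j < k, x j = y j) : condCDF f k x = condCDF f k y := by
  have hu : ∀ t, ∀ j : Fin d, (j : ℕ) < k + 1 →
      Function.update x k t j = Function.update y k t j := by
    intro t j hj
    rcases eq_or_ne j k with rfl | hjk
    · simp
    · rw [Function.update_of_ne hjk, Function.update_of_ne hjk]
      exact h j (lt_of_le_of_ne (Nat.lt_succ_iff.1 hj) hjk)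
  ext s
  simp only [condCDF, condDensity, marginal_congr f (hu _),
    marginal_congr f fun j hj => hu _ j (Nat.lt_succ_of_lt hj)]

/-- The conditional distribution functions of `f` are increasing homeomorphisms from `[-1,1]` to
`[0,2]`, which is what the construction of the transport needs. The endpoint is `2` because
`condCDF` integrates against the Lebesgue measure and not against half of it. -/
structure HasCondCDF (f : (Fin d → ℝ) → ℝ) : Prop where
  continuousOn : ∀ k, ∀ x ∈ cube d, ContinuousOn (condCDF f k x) (Icc (-1) 1)
  strictMonoOn : ∀ k, ∀ x ∈ cube d, StrictMonoOn (condCDF f k x) (Icc (-1) 1)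
  apply_one : ∀ k, ∀ x ∈ cube d, condCDF f k x 1 = 2

lemma condCDF_neg_one (f : (Fin d → ℝ) → ℝ) (k : Fin d) (x : Fin d → ℝ) :
    condCDF f k x (-1) = 0 := intervalIntegral.integral_same

lemma HasCondCDF.mapsTo {f : (Fin d → ℝ) → ℝ} (h : HasCondCDF f) (k : Fin d) {x : Fin d → ℝ}
    (hx : x ∈ cube d) : MapsTo (condCDF f k x) (Icc (-1) 1) (Icc 0 2) := by
  intro s hs
  have hm := (h.strictMonoOn k x hx).monotoneOn
  rw [← condCDF_neg_one f k x, ← h.apply_one k x hx]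
  exact ⟨hm (by norm_num) hs hs.1, hm hs (by norm_num) hs.2⟩

lemma HasCondCDF.surjOn {f : (Fin d → ℝ) → ℝ} (h : HasCondCDF f) (k : Fin d) {x : Fin d → ℝ}
    (hx : x ∈ cube d) : SurjOn (condCDF f k x) (Icc (-1) 1) (Icc 0 2) := by
  have := intermediate_value_Icc (by norm_num) (h.continuousOn k x hx)
  rwa [condCDF_neg_one, h.apply_one k x hx] at this

variable {fρ fπ : (Fin d → ℝ) → ℝ}

lemma transportAux_succ_of_ne (x : Fin d → ℝ) {n : ℕ} {j : Fin d} (h : (j : ℕ) ≠ n) :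
    transportAux fρ fπ x (n + 1) j = transportAux fρ fπ x n j := by
  rw [transportAux]
  split_ifs with hn
  · exact Function.update_of_ne (fun e => h (by rw [e])) _ _
  · rfl

lemma transportAux_of_lt (x : Fin d → ℝ) {n m : ℕ} {j : Fin d} (h : (j : ℕ) < n) (hnm : n ≤ m) :
    transportAux fρ fπ x m j = transportAux fρ fπ x n j := by
  induction m, hnm using Nat.le_induction with
  | base => rfl
  | succ m hm ih => rw [transportAux_succ_of_ne x (by omega), ih]

lemma transport_apply (x : Fin d → ℝ) (k : Fin d) :
    transport fρ fπ x k = Function.invFunOn (condCDF fπ k (transport fρ fπ x)) (Icc (-1) 1)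
      (condCDF fρ k x (x k)) := by
  have h : condCDF fπ k (transport fρ fπ x) = condCDF fπ k (transportAux fρ fπ x k) :=
    condCDF_congr fπ fun j hj => transportAux_of_lt x hj k.isLt.le
  rw [h, transport, transportAux_of_lt x (Nat.lt_succ_self k) k.isLt, transportAux,
    dif_pos k.isLt, Function.update_self]

lemma transportAux_succ (x : Fin d → ℝ) (k : Fin d) :
    transportAux fρ fπ x (k + 1) =
      Function.update (transportAux fρ fπ x k) k (transport fρ fπ x k) := by
  ext j
  rcases eq_or_ne j k with rfl | hjk
  · rw [Function.update_self, transport, transportAux_of_lt x (Nat.lt_succ_self j) j.isLt]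
  · rw [Function.update_of_ne hjk, transportAux_succ_of_ne x fun e => hjk (Fin.ext e)]

lemma transportAux_mem_cube (hρ : HasCondCDF fρ) (hπ : HasCondCDF fπ) {x : Fin d → ℝ}
    (hx : x ∈ cube d) (n : ℕ) : transportAux fρ fπ x n ∈ cube d := by
  induction n with
  | zero => exact hx
  | succ n ih =>
    rw [transportAux]
    split_ifs with hn
    · exact update_mem_cube ih (Function.invFunOn_mem (hπ.surjOn _ ih (hρ.mapsTo _ hx (hx _))))
    · exact ih

lemma transport_mem_and_condCDF (hρ : HasCondCDF fρ) (hπ : HasCondCDF fπ) {x : Fin d → ℝ}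
    (hx : x ∈ cube d) : transport fρ fπ x ∈ cube d ∧ ∀ k,
      condCDF fπ k (transport fρ fπ x) (transport fρ fπ x k) = condCDF fρ k x (x k) := by
  have hTx : transport fρ fπ x ∈ cube d := transportAux_mem_cube hρ hπ hx d
  refine ⟨hTx, fun k => ?_⟩
  conv_lhs => rw [transport_apply]
  exact Function.invFunOn_eq (hπ.surjOn k hTx (hρ.mapsTo k hx (hx k)))

lemma eq_of_condCDF_eq {f : (Fin d → ℝ) → ℝ} (hf : HasCondCDF f) {x y : Fin d → ℝ}
    (hx : x ∈ cube d) (hy : y ∈ cube d)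
    (h : ∀ k, condCDF f k x (x k) = condCDF f k y (y k)) : x = y := by
  ext k
  induction k using WellFoundedLT.induction with
  | ind k ih =>
    refine (hf.strictMonoOn k x hx).injOn (hx k) (hy k) ?_
    rw [h k, condCDF_congr f ih]

lemma transport_transport (hρ : HasCondCDF fρ) (hπ : HasCondCDF fπ) {x : Fin d → ℝ}
    (hx : x ∈ cube d) : transport fπ fρ (transport fρ fπ x) = x := by
  obtain ⟨hTx, hT⟩ := transport_mem_and_condCDF hρ hπ hx
  obtain ⟨hSTx, hST⟩ := transport_mem_and_condCDF hπ hρ hTx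
  exact eq_of_condCDF_eq hρ hSTx hx fun k => (hST k).trans (hT k)

lemma transport_triangular (k : Fin d) {x y : Fin d → ℝ} (h : ∀ j ≤ k, x j = y j) :
    transport fρ fπ x k = transport fρ fπ y k := by
  induction k using WellFoundedLT.induction with
  | ind k ih =>
    rw [transport_apply, transport_apply, h k le_rfl,
      condCDF_congr fρ (x := x) (y := y) fun j hj => h j hj.le,
      condCDF_congr fπ (x := transport fρ fπ x) (y := transport fρ fπ y)
        fun j hj => ih j hj fun i hi => h i (hi.trans hj.le)]

lemma condCDF_transport_update (hρ : HasCondCDF fρ) (hπ : HasCondCDF fπ) (k : Fin d)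
    {x : Fin d → ℝ} (hx : x ∈ cube d) {s : ℝ} (hs : s ∈ Icc (-1 : ℝ) 1) :
    condCDF fπ k (transport fρ fπ x) (transport fρ fπ (Function.update x k s) k) =
      condCDF fρ k x s := by
  have hπcongr : condCDF fπ k (transport fρ fπ (Function.update x k s)) =
      condCDF fπ k (transport fρ fπ x) :=
    condCDF_congr fπ fun j hj => transport_triangular j fun i hi =>
      Function.update_of_ne (hi.trans_lt hj).ne _ _
  have hρcongr : condCDF fρ k (Function.update x k s) = condCDF fρ k x :=
    condCDF_congr fρ fun j hj => Function.update_of_ne hj.ne _ _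
  have := (transport_mem_and_condCDF hρ hπ (update_mem_cube (k := k) hx hs)).2 k
  rwa [hπcongr, hρcongr, Function.update_self] at this

lemma strictMonoOn_transport_update (hρ : HasCondCDF fρ) (hπ : HasCondCDF fπ) (k : Fin d)
    {x : Fin d → ℝ} (hx : x ∈ cube d) :
    StrictMonoOn (fun s => transport fρ fπ (Function.update x k s) k) (Icc (-1) 1) := by
  have hmem : ∀ s ∈ Icc (-1 : ℝ) 1,
      transport fρ fπ (Function.update x k s) k ∈ Icc (-1 : ℝ) 1 := fun s hs =>
    (transport_mem_and_condCDF hρ hπ (update_mem_cube hx hs)).1 k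
  intro s hs s' hs' hlt
  refine ((hπ.strictMonoOn k _ (transport_mem_and_condCDF hρ hπ hx).1).lt_iff_lt
    (hmem s hs) (hmem s' hs')).1 ?_
  rw [condCDF_transport_update hρ hπ k hx hs, condCDF_transport_update hρ hπ k hx hs']
  exact hρ.strictMonoOn k x hx hs hs' hlt

theorem isMonotoneTriangularBijection_transport (hρ : HasCondCDF fρ) (hπ : HasCondCDF fπ) :
    IsMonotoneTriangularBijection (transport fρ fπ) where
  triangular k _ _ _ _ h := transport_triangular k h
  monotone k _ hx := strictMonoOn_transport_update hρ hπ k hx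
  bijOn := InvOn.bijOn
    ⟨fun _ => transport_transport hρ hπ, fun _ => transport_transport hπ hρ⟩
    (fun _ hx => (transport_mem_and_condCDF hρ hπ hx).1)
    fun _ hy => (transport_mem_and_condCDF hπ hρ hy).1

theorem invTransport_eq (hρ : HasCondCDF fρ) (hπ : HasCondCDF fπ) {y : Fin d → ℝ}
    (hy : y ∈ cube d) : invTransport fρ fπ y = transport fπ fρ y := by
  have hbij := (isMonotoneTriangularBijection_transport hρ hπ).bijOn
  have hex : y ∈ transport fρ fπ '' cube d := hbij.surjOn hy
  refine hbij.injOn (Function.invFunOn_mem hex) (transport_mem_and_condCDF hπ hρ hy).1 ?_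
  rw [transport_transport hπ hρ hy]
  exact Function.invFunOn_eq hex

end KnotheRosenblatt

/-! ### Marginals -/

section Marginals

variable {d : ℕ}

/-- The uniform probability measure on `[-1,1]`, the factor of `cubeMeasure`. -/
def unitMeasure : Measure ℝ := (2 : ℝ≥0)⁻¹ • (volume : Measure ℝ).restrict (Icc (-1) 1)

lemma unitMeasure_univ : unitMeasure univ = 1 := by
  have h : (volume : Measure ℝ) (Icc (-1) 1) = 2 := by
    rw [Real.volume_Icc]
    norm_num
  simp only [unitMeasure, Measure.smul_apply, Measure.restrict_apply_univ, h]
  rw [ENNReal.smul_def, smul_eq_mul, ENNReal.coe_inv two_ne_zero]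
  exact ENNReal.inv_mul_cancel (by simp) (by simp)

instance : IsProbabilityMeasure unitMeasure := ⟨unitMeasure_univ⟩

lemma cubeMeasure_eq (d : ℕ) : cubeMeasure d = Measure.pi fun _ => unitMeasure := rfl

instance (d : ℕ) : IsProbabilityMeasure (cubeMeasure d) := by
  rw [cubeMeasure_eq]
  infer_instance

lemma ae_unitMeasure : ∀ᵐ s ∂unitMeasure, s ∈ Icc (-1 : ℝ) 1 :=
  Measure.ae_smul_measure (ae_restrict_mem measurableSet_Icc) _

lemma ae_cubeMeasure (d : ℕ) : ∀ᵐ t ∂(cubeMeasure d), t ∈ cube d := by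
  rw [cubeMeasure_eq]
  exact Filter.eventually_all.2 fun j => Measure.tendsto_eval_ae_ae.eventually ae_unitMeasure

lemma restrict_cubeMeasure (d : ℕ) : (cubeMeasure d).restrict (cube d) = cubeMeasure d :=
  Measure.restrict_eq_self_of_ae_mem (ae_cubeMeasure d)

lemma integral_unitMeasure {G : Type*} [NormedAddCommGroup G] [NormedSpace ℝ G] (g : ℝ → G) :
    ∫ s, g s ∂unitMeasure = (2⁻¹ : ℝ) • ∫ s in (-1 : ℝ)..1, g s := by
  rw [unitMeasure, integral_smul_nnreal_measure, intervalIntegral.integral_of_le (by norm_num),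
    integral_Icc_eq_integral_Ioc, NNReal.smul_def,
    NNReal.coe_inv, NNReal.coe_ofNat]

lemma measurePreserving_update {ι : Type*} [Fintype ι] [DecidableEq ι] {X : ι → Type*}
    [∀ i, MeasurableSpace (X i)] (μ : ∀ i, Measure (X i)) [∀ i, IsProbabilityMeasure (μ i)]
    (k : ι) :
    MeasurePreserving (fun q : (∀ i, X i) × X k => Function.update q.1 k q.2)
      ((Measure.pi μ).prod (μ k)) (Measure.pi μ) := by
  have hmeas : Measurable fun q : (∀ i, X i) × X k => Function.update q.1 k q.2 :=
    measurable_update'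
  refine ⟨hmeas, (Measure.pi_eq fun s hs => ?_).symm⟩
  have hpreimage : (fun q : (∀ i, X i) × X k => Function.update q.1 k q.2) ⁻¹' univ.pi s =
      univ.pi (Function.update s k univ) ×ˢ s k := by
    ext ⟨t, u⟩
    simp only [mem_preimage, mem_univ_pi, mem_prod, Function.forall_update_iff _ fun i v => v ∈ s i,
      Function.forall_update_iff s fun i A => t i ∈ A, mem_univ, true_and]
    exact and_comm
  rw [Measure.map_apply hmeas (MeasurableSet.univ_pi hs), hpreimage, Measure.prod_prod,
    Measure.pi_pi, ← Finset.prod_erase_mul _ _ (Finset.mem_univ k),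
    ← Finset.prod_erase_mul _ (fun i => μ i (s i)) (Finset.mem_univ k),
    Function.update_self, measure_univ, mul_one]
  congr 1
  exact Finset.prod_congr rfl fun i hi => by rw [Function.update_of_ne (Finset.ne_of_mem_erase hi)]

lemma mix_succ_update {R : Type*} (k : Fin d) (z t : Fin d → R) (s : R) :
    mix (k + 1) (Function.update z k s) t = mix k z (Function.update t k s) := by
  ext j
  rcases eq_or_ne j k with rfl | hjk
  · simp [mix]
  · have hlt : ((j : ℕ) < k + 1) ↔ ((j : ℕ) < k) := by
      have := Fin.val_ne_of_ne hjk
      omega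
    simp only [mix, Function.update_of_ne hjk, hlt]

lemma mix_mem_cube (k : ℕ) {x t : Fin d → ℝ} (hx : x ∈ cube d) (ht : t ∈ cube d) :
    mix k x t ∈ cube d := by
  intro j
  unfold mix
  split_ifs
  exacts [hx j, ht j]

lemma mix_mem_complexNhd {δ : Fin d → ℝ} (k : ℕ) {z t : Fin d → ℂ} (hz : z ∈ complexNhd δ)
    (ht : t ∈ complexNhd δ) : mix k z t ∈ complexNhd δ := by
  rw [mem_complexNhd_iff] at *
  intro j
  unfold mix
  split_ifs
  exacts [hz j, ht j]

lemma toComplex_mix (k : ℕ) (x t : Fin d → ℝ) :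
    toComplex (mix k x t) = mix k (toComplex x) (toComplex t) := by
  ext j
  simp only [toComplex, mix]
  split_ifs <;> rfl

lemma mix_toComplex_eq_add (k : ℕ) (z : Fin d → ℂ) (x t : Fin d → ℝ) :
    mix k z (toComplex t) = toComplex (mix k x t) + mix k (z - toComplex x) 0 := by
  ext j
  simp only [mix, toComplex, Pi.add_apply, Pi.sub_apply]
  split_ifs <;> simp

/-- The extension of `marginal` to complex arguments: the first `k` variables of `F` are kept, the
others are integrated over the real cube. -/
def cmarginal (F : (Fin d → ℂ) → ℂ) (k : ℕ) (z : Fin d → ℂ) : ℂ :=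
  ∫ t, F (mix k z (toComplex t)) ∂(cubeMeasure d)

section CMarginal

variable {δ : Fin d → ℝ} {F : (Fin d → ℂ) → ℂ}

/-- The projection to the first `k` coordinates. -/
def maskCLM (d k : ℕ) : (Fin d → ℂ) →L[ℂ] (Fin d → ℂ) :=
  ContinuousLinearMap.pi fun j => if (j : ℕ) < k then ContinuousLinearMap.proj j else 0

lemma maskCLM_add (k : ℕ) (z t : Fin d → ℂ) : maskCLM d k z + mix k 0 t = mix k z t := by
  ext j
  by_cases h : (j : ℕ) < k <;> simp [maskCLM, mix, h]

lemma continuous_mix_zero (k : ℕ) :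
    Continuous fun t : Fin d → ℝ => mix k (0 : Fin d → ℂ) (toComplex t) := by
  refine continuous_pi fun j => ?_
  unfold mix toComplex
  split_ifs <;> fun_prop

lemma contDiffOn_cmarginal (hδ : ∀ j, 0 < δ j) (hF : ContDiffOn ℂ 1 F (complexNhd δ)) (k : ℕ) :
    ContDiffOn ℂ 1 (cmarginal F k) (complexNhd δ) := by
  have h := contDiffOn_setIntegral_comp_affine (μ := cubeMeasure d) (isCompact_cube d)
    (measurableSet_cube d) (isOpen_complexNhd δ) (isOpen_complexNhd δ) hF
    (A := fun _ => maskCLM d k) continuousOn_const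
    (c := fun t => mix k 0 (toComplex t)) (continuous_mix_zero k).continuousOn
    (φ := fun _ => 1) continuousOn_const ?_
  · simp only [restrict_cubeMeasure, maskCLM_add, one_smul] at h
    exact h
  · intro z hz t ht
    rw [maskCLM_add]
    exact mix_mem_complexNhd k hz (toComplex_mem_complexNhd hδ ht)

lemma continuousOn_comp_mix (hδ : ∀ j, 0 < δ j) (hF : ContDiffOn ℂ 1 F (complexNhd δ)) (k : ℕ)
    {z : Fin d → ℂ} (hz : z ∈ complexNhd δ) :
    ContinuousOn (fun t => F (mix k z (toComplex t))) (cube d) := by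
  refine hF.continuousOn.comp ?_ fun t ht =>
    mix_mem_complexNhd k hz (toComplex_mem_complexNhd hδ ht)
  simp_rw [← maskCLM_add k z]
  exact (continuous_const.add (continuous_mix_zero k)).continuousOn

lemma integrable_comp_mix (hδ : ∀ j, 0 < δ j) (hF : ContDiffOn ℂ 1 F (complexNhd δ)) (k : ℕ)
    {z : Fin d → ℂ} (hz : z ∈ complexNhd δ) :
    Integrable (fun t => F (mix k z (toComplex t))) (cubeMeasure d) := by
  rw [← restrict_cubeMeasure]
  exact (continuousOn_comp_mix hδ hF k hz).integrableOn_compact' (isCompact_cube d)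
    (measurableSet_cube d)

lemma cmarginal_congr (F : (Fin d → ℂ) → ℂ) {k : ℕ} {z w : Fin d → ℂ}
    (h : ∀ j : Fin d, (j : ℕ) < k → z j = w j) : cmarginal F k z = cmarginal F k w := by
  simp only [cmarginal, mix_congr h]

lemma norm_cmarginal_le (F : (Fin d → ℂ) → ℂ) (k : ℕ) {z : Fin d → ℂ} {L : ℝ}
    (h : ∀ t ∈ cube d, ‖F (mix k z (toComplex t))‖ ≤ L) : ‖cmarginal F k z‖ ≤ L := by
  rw [cmarginal]
  simpa using norm_integral_le_of_norm_le_const ((ae_cubeMeasure d).mono h)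

lemma le_re_cmarginal (hδ : ∀ j, 0 < δ j) (hF : ContDiffOn ℂ 1 F (complexNhd δ)) (k : ℕ)
    {z : Fin d → ℂ} (hz : z ∈ complexNhd δ) {c : ℝ}
    (h : ∀ t ∈ cube d, c ≤ (F (mix k z (toComplex t))).re) : c ≤ (cmarginal F k z).re := by
  have hint := integrable_comp_mix hδ hF k hz
  calc c = ∫ _ : Fin d → ℝ, c ∂(cubeMeasure d) := by simp
    _ ≤ ∫ t, (F (mix k z (toComplex t))).re ∂(cubeMeasure d) :=
        integral_mono_ae (integrable_const _) hint.re ((ae_cubeMeasure d).mono h)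
    _ = (cmarginal F k z).re := Complex.reCLM.integral_comp_comm hint

lemma norm_cmarginal_sub_le (hδ : ∀ j, 0 < δ j) (hF : ContDiffOn ℂ 1 F (complexNhd δ)) (k : ℕ)
    {z w : Fin d → ℂ} (hz : z ∈ complexNhd δ) (hw : w ∈ complexNhd δ) {C : ℝ}
    (h : ∀ t ∈ cube d, ‖F (mix k z (toComplex t)) - F (mix k w (toComplex t))‖ ≤ C) :
    ‖cmarginal F k z - cmarginal F k w‖ ≤ C := by
  rw [cmarginal, cmarginal,
    ← integral_sub (integrable_comp_mix hδ hF k hz) (integrable_comp_mix hδ hF k hw)]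
  simpa using norm_integral_le_of_norm_le_const ((ae_cubeMeasure d).mono h)

variable {f : (Fin d → ℝ) → ℝ}

lemma comp_mix_toComplex (hFf : ∀ x ∈ cube d, F (toComplex x) = f x) (k : ℕ) {x t : Fin d → ℝ}
    (hx : x ∈ cube d) (ht : t ∈ cube d) :
    F (mix k (toComplex x) (toComplex t)) = f (mix k x t) := by
  rw [← toComplex_mix, hFf _ (mix_mem_cube k hx ht)]

lemma cmarginal_toComplex (hFf : ∀ x ∈ cube d, F (toComplex x) = f x) (k : ℕ) {x : Fin d → ℝ}
    (hx : x ∈ cube d) : cmarginal F k (toComplex x) = marginal f k x := by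
  rw [cmarginal, marginal_eq_integral_mix, ← integral_complex_ofReal]
  exact integral_congr_ae ((ae_cubeMeasure d).mono fun t ht => comp_mix_toComplex hFf k hx ht)

lemma integrable_comp_mix_real (hδ : ∀ j, 0 < δ j) (hF : ContDiffOn ℂ 1 F (complexNhd δ))
    (hFf : ∀ x ∈ cube d, F (toComplex x) = f x) (k : ℕ) {x : Fin d → ℝ} (hx : x ∈ cube d) :
    Integrable (fun t => f (mix k x t)) (cubeMeasure d) :=
  (integrable_comp_mix hδ hF k (toComplex_mem_complexNhd hδ hx)).re.congr <|
    (ae_cubeMeasure d).mono fun t ht => by simp [comp_mix_toComplex hFf k hx ht]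

lemma marginal_eq_integral_marginal_succ (k : Fin d) {x : Fin d → ℝ}
    (hf : Integrable (fun t => f (mix k x t)) (cubeMeasure d)) :
    marginal f k x = ∫ s, marginal f (k + 1) (Function.update x k s) ∂unitMeasure := by
  have hmp : MeasurePreserving (fun q : (Fin d → ℝ) × ℝ => Function.update q.1 k q.2)
      ((cubeMeasure d).prod unitMeasure) (cubeMeasure d) :=
    measurePreserving_update (fun _ => unitMeasure) k
  have hprod : Integrable (fun q : (Fin d → ℝ) × ℝ => f (mix k x (Function.update q.1 k q.2)))
      ((cubeMeasure d).prod unitMeasure) := hmp.integrable_comp_of_integrable hf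
  simp only [marginal_eq_integral_mix, mix_succ_update]
  have hmeas : AEStronglyMeasurable (fun t => f (mix k x t)) (Measure.map
      (fun q : (Fin d → ℝ) × ℝ => Function.update q.1 k q.2)
      ((cubeMeasure d).prod unitMeasure)) := by
    rw [hmp.map_eq]
    exact hf.aestronglyMeasurable
  rw [← integral_prod_symm _ hprod, ← integral_map hmp.measurable.aemeasurable hmeas, hmp.map_eq]

variable {M L C : ℝ}

lemma norm_comp_mix_sub_le (hδ : ∀ j, 0 < δ j) (hC : 0 ≤ C)
    (hvar : ∀ k : Fin d, 0 < (k : ℕ) → ∀ x ∈ cube d, ∀ y : Fin d → ℂ,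
      (∀ j, j < k → ‖y j‖ < δ j) → (∀ j, k ≤ j → y j = 0) →
        ‖F (toComplex x + y) - F (toComplex x)‖ ≤ C * δ k)
    (k : Fin d) {z : Fin d → ℂ} {x : Fin d → ℝ} (hx : x ∈ cube d)
    (hzx : ∀ j, ‖z j - x j‖ < δ j) {t : Fin d → ℝ} (ht : t ∈ cube d) :
    ‖F (mix k z (toComplex t)) - F (mix k (toComplex x) (toComplex t))‖ ≤ C * δ k := by
  rcases Nat.eq_zero_or_pos (k : ℕ) with hk | hk
  · have hmix : mix k z (toComplex t) = mix k (toComplex x) (toComplex t) :=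
      mix_congr (fun j hj => absurd hj (by omega)) _
    rw [hmix, sub_self, norm_zero]
    exact mul_nonneg hC (hδ k).le
  · rw [mix_toComplex_eq_add k z x, ← toComplex_mix]
    refine hvar k hk _ (mix_mem_cube k hx ht) _ (fun j hj => ?_) fun j hj => ?_
    · simpa only [mix, if_pos (Fin.lt_def.1 hj), Pi.sub_apply, toComplex] using hzx j
    · simp only [mix, if_neg (not_lt.2 (Fin.le_def.1 hj)), Pi.zero_apply]

lemma sub_le_re_comp_mix (hδ : ∀ j, 0 < δ j)
    (hM : ∀ x ∈ cube d, M ≤ (F (toComplex x)).re)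
    (hvar : ∀ x ∈ cube d, ∀ y : Fin d → ℂ, (∀ j, ‖y j‖ < δ j) →
      ‖F (toComplex x + y) - F (toComplex x)‖ ≤ C)
    (k : ℕ) {z : Fin d → ℂ} (hz : z ∈ complexNhd δ) {t : Fin d → ℝ} (ht : t ∈ cube d) :
    M - C ≤ (F (mix k z (toComplex t))).re := by
  obtain ⟨x, hx, hzx⟩ := exists_mem_cube_norm_sub_lt hz
  have hmix := mix_mem_cube k hx ht
  have hdiff := hvar _ hmix (mix k (z - toComplex x) 0) fun j => by
    simp only [mix, toComplex, Pi.sub_apply, Pi.zero_apply]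
    split_ifs
    · exact hzx j
    · simpa using hδ j
  rw [← mix_toComplex_eq_add] at hdiff
  have hre := (abs_le.1 ((Complex.abs_re_le_norm _).trans hdiff)).1
  rw [Complex.sub_re] at hre
  linarith [hM _ hmix]

end CMarginal

/-- The functions `a k` are holomorphic extensions to `complexNhd δ` of the marginals of `f`, with
the bounds that enter the construction of the complex transport. The fields `near` and `near_succ`
are the smallness of the variation, relative to the radius `δ k`, of the numerator and the
denominator of the conditional density of the variable `k`. -/
structure MarginalExtension (M L C : ℝ) (δ : Fin d → ℝ) (f : (Fin d → ℝ) → ℝ)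
    (a : ℕ → (Fin d → ℂ) → ℂ) : Prop where
  contDiffOn : ∀ k, ContDiffOn ℂ 1 (a k) (complexNhd δ)
  congr : ∀ (k : ℕ) (z w : Fin d → ℂ), (∀ j : Fin d, (j : ℕ) < k → z j = w j) → a k z = a k w
  norm_le : ∀ k, ∀ z ∈ complexNhd δ, ‖a k z‖ ≤ L
  le_re : ∀ k, ∀ z ∈ complexNhd δ, M / 2 ≤ (a k z).re
  ofReal : ∀ k, ∀ x ∈ cube d, a k (toComplex x) = marginal f k x
  near : ∀ k : Fin d, ∀ z ∈ complexNhd δ, ∀ x ∈ cube d, (∀ j, ‖z j - x j‖ < δ j) →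
    ‖a k z - a k (toComplex x)‖ ≤ C * δ k
  near_succ : ∀ k : Fin d, ∀ z ∈ complexNhd δ, ∀ x ∈ cube d, (∀ j, ‖z j - x j‖ < δ j) →
    ∀ t ∈ Icc (-1 : ℝ) 1,
      ‖a (k + 1) (Function.update z k t) - a (k + 1) (Function.update (toComplex x) k t)‖ ≤ C * δ k
  integral_eq : ∀ k : Fin d, ∀ x ∈ cube d,
    ∫ t in (-1 : ℝ)..1, marginal f (k + 1) (Function.update x k t) = 2 * marginal f k x

theorem DensityAssumption.exists_marginalExtension {M L C : ℝ} {δ : Fin d → ℝ}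
    {f : (Fin d → ℝ) → ℝ} (h : DensityAssumption M L C δ f) (hδ : ∀ j, 0 < δ j)
    (hC0 : 0 ≤ C) (hC : C ≤ M / 2) : ∃ a, MarginalExtension M L C δ f a := by
  obtain ⟨hf, F, hFf, hF, hbd, hvar, hvark⟩ := h
  have hreal : ∀ {x : Fin d → ℝ}, x ∈ cube d → toComplex x ∈ complexNhd δ :=
    fun hx => toComplex_mem_complexNhd hδ hx
  have hM : ∀ x ∈ cube d, M ≤ (F (toComplex x)).re := fun x hx => by
    have := (hbd _ (hreal hx)).1
    rwa [hFf x hx, Complex.norm_real, Real.norm_of_nonneg (hf.pos x hx).le,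
      ← Complex.ofReal_re (f x), ← hFf x hx] at this
  refine ⟨cmarginal F, contDiffOn_cmarginal hδ hF, fun k _ _ => cmarginal_congr F,
    fun k z hz => norm_cmarginal_le F k fun t ht => (hbd _ (mix_mem_complexNhd k hz (hreal ht))).2,
    fun k z hz => le_re_cmarginal hδ hF k hz fun t ht => ?_,
    fun k x hx => cmarginal_toComplex hFf k hx,
    fun k z hz x hx hzx => norm_cmarginal_sub_le hδ hF k hz (hreal hx) fun t ht =>
      norm_comp_mix_sub_le hδ hC0 hvark k hx hzx ht,
    fun k z hz x hx hzx t ht => ?_, fun k x hx => ?_⟩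
  · exact le_trans (by linarith) (sub_le_re_comp_mix hδ hM hvar k hz ht)
  · have ht' : (t : ℂ) ∈ intervalNhd (δ k) := ofReal_mem_intervalNhd (hδ k) ht
    refine norm_cmarginal_sub_le hδ hF _ (update_mem_complexNhd hz ht')
      (update_mem_complexNhd (hreal hx) ht') fun s hs => ?_
    rw [mix_succ_update, mix_succ_update, ← toComplex_update]
    exact norm_comp_mix_sub_le hδ hC0 hvark k hx hzx (update_mem_cube hs ht)
  · have := marginal_eq_integral_marginal_succ k (integrable_comp_mix_real hδ hF hFf k hx)
    rw [integral_unitMeasure, smul_eq_mul] at this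
    linarith

lemma condCDF_eq (f : (Fin d → ℝ) → ℝ) (k : Fin d) (x : Fin d → ℝ) (s : ℝ) :
    condCDF f k x s =
      (∫ t in (-1 : ℝ)..s, marginal f (k + 1) (Function.update x k t)) / marginal f k x := by
  rw [condCDF, ← intervalIntegral.integral_div]
  congr 1
  ext t
  rw [condDensity, marginal_congr f (k := k) (x := Function.update x k t) (y := x) fun j hj =>
    Function.update_of_ne (fun e => by rw [e] at hj; exact lt_irrefl _ hj) _ _]

namespace MarginalExtension

variable {M L C : ℝ} {δ : Fin d → ℝ} {f : (Fin d → ℝ) → ℝ} {a : ℕ → (Fin d → ℂ) → ℂ}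

lemma marginal_pos (h : MarginalExtension M L C δ f a) (hM : 0 < M) (hδ : ∀ j, 0 < δ j) (k : ℕ)
    {x : Fin d → ℝ} (hx : x ∈ cube d) : 0 < marginal f k x := by
  have hre := h.le_re k _ (toComplex_mem_complexNhd hδ hx)
  rw [h.ofReal k x hx, Complex.ofReal_re] at hre
  linarith

lemma continuousOn_marginal (h : MarginalExtension M L C δ f a) (hδ : ∀ j, 0 < δ j) (k : ℕ) :
    ContinuousOn (marginal f k) (cube d) := by
  have : ContinuousOn (fun x => (a k (toComplex x)).re) (cube d) :=
    Complex.continuous_re.comp_continuousOn ((h.contDiffOn k).continuousOn.comp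
      continuous_toComplex.continuousOn fun x hx => toComplex_mem_complexNhd hδ hx)
  exact this.congr fun x hx => by simp only [h.ofReal k x hx, Complex.ofReal_re]

lemma continuousOn_marginal_update (h : MarginalExtension M L C δ f a) (hδ : ∀ j, 0 < δ j)
    (l : ℕ) (k : Fin d) {x : Fin d → ℝ} (hx : x ∈ cube d) :
    ContinuousOn (fun t => marginal f l (Function.update x k t)) (Icc (-1) 1) :=
  (h.continuousOn_marginal hδ l).comp
    (continuous_const.update k continuous_id :
      Continuous fun t : ℝ => Function.update x k t).continuousOn fun _ ht => update_mem_cube hx ht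

theorem hasCondCDF (h : MarginalExtension M L C δ f a) (hM : 0 < M) (hδ : ∀ j, 0 < δ j) :
    HasCondCDF f := by
  have hint : ∀ (k : Fin d), ∀ x ∈ cube d, ∀ s ∈ Icc (-1 : ℝ) 1, ∀ s' ∈ Icc (-1 : ℝ) 1,
      IntervalIntegrable (fun t => marginal f (k + 1) (Function.update x k t)) volume s s' :=
    fun k x hx s hs s' hs' => ((h.continuousOn_marginal_update hδ _ k hx).mono
      (uIcc_subset_Icc hs hs')).intervalIntegrable
  have hneg : (-1 : ℝ) ∈ Icc (-1 : ℝ) 1 := by norm_num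
  refine ⟨fun k x hx => ?_, fun k x hx s hs s' hs' hlt => ?_, fun k x hx => ?_⟩
  · simp_rw [funext (condCDF_eq f k x)]
    refine ContinuousOn.div_const ?_ _
    have hprimitive := intervalIntegral.continuousOn_primitive_interval'
      (hint k x hx (-1) hneg 1 (by norm_num)) left_mem_uIcc
    rwa [uIcc_of_le (by norm_num)] at hprimitive
  · rw [condCDF_eq, condCDF_eq]
    refine div_lt_div_of_pos_right ?_ (h.marginal_pos hM hδ k hx)
    rw [← sub_pos, intervalIntegral.integral_interval_sub_left
      (hint k x hx _ hneg _ hs') (hint k x hx _ hneg _ hs)]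
    refine intervalIntegral.intervalIntegral_pos_of_pos_on (hint k x hx _ hs _ hs') ?_ hlt
    intro t ht
    exact h.marginal_pos hM hδ _ (update_mem_cube hx ⟨hs.1.trans ht.1.le, ht.2.le.trans hs'.2⟩)
  · rw [condCDF_eq, h.integral_eq k x hx, mul_div_assoc, div_self (h.marginal_pos hM hδ k hx).ne',
      mul_one]

end MarginalExtension

end Marginals

/-! ### Holomorphic primitives in one coordinate -/

section LowerBoundReDeriv

variable {f f' : ℂ → ℂ} {s : Set ℂ} {c : ℝ}

lemma mul_norm_sub_le_norm_image_sub (hs : Convex ℝ s) (hf' : ContinuousOn f' s)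
    (hf : ∀ z ∈ s, HasDerivAt f (f' z) z) (hc : ∀ z ∈ s, c ≤ (f' z).re) {z w : ℂ} (hz : z ∈ s)
    (hw : w ∈ s) : c * ‖w - z‖ ≤ ‖f w - f z‖ := by
  have hmem : MapsTo (fun t : ℝ => z + t • (w - z)) (Icc 0 1) s :=
    fun t ht => hs.add_smul_sub_mem hz hw ht
  have hcont : ContinuousOn (fun t : ℝ => f' (z + t • (w - z))) (Icc 0 1) :=
    hf'.comp (by fun_prop) hmem
  have hint : IntervalIntegrable (fun t : ℝ => f' (z + t • (w - z))) volume 0 1 :=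
    hcont.intervalIntegrable_of_Icc zero_le_one
  have hre : c ≤ (∫ t in (0 : ℝ)..1, f' (z + t • (w - z))).re := calc
    c = ∫ _ in (0 : ℝ)..1, c := by simp
    _ ≤ ∫ t in (0 : ℝ)..1, (f' (z + t • (w - z))).re :=
        intervalIntegral.integral_mono_on zero_le_one intervalIntegrable_const
          (Complex.continuous_re.comp_continuousOn hcont |>.intervalIntegrable_of_Icc zero_le_one)
          fun t ht => hc _ (hmem ht)
    _ = (∫ t in (0 : ℝ)..1, f' (z + t • (w - z))).re :=
        Complex.reCLM.intervalIntegral_comp_comm hint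
  have hftc := intervalIntegral.integral_unitInterval_deriv_eq_sub hcont
    fun t ht => hf _ (hmem ht)
  rw [add_sub_cancel] at hftc
  rw [← hftc, norm_smul, mul_comm]
  exact mul_le_mul_of_nonneg_left (hre.trans (Complex.re_le_norm _)) (norm_nonneg _)

lemma injOn_of_pos_re_deriv (hs : Convex ℝ s) (hf' : ContinuousOn f' s)
    (hf : ∀ z ∈ s, HasDerivAt f (f' z) z) (hc0 : 0 < c) (hc : ∀ z ∈ s, c ≤ (f' z).re) :
    InjOn f s := by
  intro z hz w hw h
  have hle := mul_norm_sub_le_norm_image_sub hs hf' hf hc hw hz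
  rw [h, sub_self, norm_zero] at hle
  exact sub_eq_zero.1 (norm_le_zero_iff.1 (nonpos_of_mul_nonpos_right hle hc0))

lemma ball_subset_image_closedBall_of_le_re_deriv (hs : Convex ℝ s) (hf' : ContinuousOn f' s)
    (hf : ∀ z ∈ s, HasDerivAt f (f' z) z) (hc0 : 0 < c) (hc : ∀ z ∈ s, c ≤ (f' z).re) {z : ℂ}
    {r : ℝ} (hr : 0 < r) (hzr : closedBall z r ⊆ s) :
    ball (f z) (c * r / 2) ⊆ f '' closedBall z r := by
  have hz : z ∈ s := hzr (mem_closedBall_self hr.le)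
  have hdiff : DifferentiableOn ℂ f (closedBall z r) := fun w hw =>
    (hf w (hzr hw)).differentiableAt.differentiableWithinAt
  have hne : ∀ᶠ w in 𝓝[≠] z, f w ≠ f z := by
    filter_upwards [self_mem_nhdsWithin,
      nhdsWithin_le_nhds (closedBall_mem_nhds z hr)] with w hwz hw heq
    exact hwz (injOn_of_pos_re_deriv hs hf' hf hc0 hc (hzr hw) hz heq)
  refine (hdiff.diffContOnCl_ball subset_rfl).ball_subset_image_closedBall hr (fun w hw => ?_)
    (hne.frequently.filter_mono nhdsWithin_le_nhds)
  have hle := mul_norm_sub_le_norm_image_sub hs hf' hf hc hz (hzr (sphere_subset_closedBall hw))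
  rwa [mem_sphere_iff_norm.1 hw] at hle

end LowerBoundReDeriv

section SegPrimitive

variable {d : ℕ}

/-- The integral of `a` in the coordinate `k` along the segment from `-1` to `z k`, the holomorphic
extension of `∫ t in -1..x k, a (Function.update x k t)`. -/
def segPrimitive (k : Fin d) (a : (Fin d → ℂ) → ℂ) (z : Fin d → ℂ) : ℂ :=
  (z k + 1) * ∫ r in Icc (0 : ℝ) 1, a (Function.update z k (-1 + r * (z k + 1)))

lemma segment_mem_intervalNhd {δ : ℝ} (hδ : 0 < δ) {ζ : ℂ} (hζ : ζ ∈ intervalNhd δ) {r : ℝ}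
    (hr : r ∈ Icc (0 : ℝ) 1) : -1 + (r : ℂ) * (ζ + 1) ∈ intervalNhd δ := by
  have hneg : (-1 : ℂ) ∈ intervalNhd δ := by
    simpa using ofReal_mem_intervalNhd hδ (x := -1) (by norm_num)
  simpa only [sub_neg_eq_add, Complex.real_smul] using
    (convex_intervalNhd δ).add_smul_sub_mem hneg hζ hr

lemma segPrimitive_congr {k : Fin d} {a : (Fin d → ℂ) → ℂ}
    (ha : ∀ z w : Fin d → ℂ, (∀ j : Fin d, (j : ℕ) < k + 1 → z j = w j) → a z = a w)
    {z w : Fin d → ℂ} (h : ∀ j ≤ k, z j = w j) : segPrimitive k a z = segPrimitive k a w := by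
  rw [segPrimitive, segPrimitive, h k le_rfl]
  congr 2
  ext r
  refine ha _ _ fun j hj => ?_
  rcases eq_or_ne j k with rfl | hjk
  · simp
  · rw [Function.update_of_ne hjk, Function.update_of_ne hjk]
    exact h j (Nat.lt_succ_iff.1 hj)

variable {δ : Fin d → ℝ} {a : (Fin d → ℂ) → ℂ} {k : Fin d}

lemma continuousOn_comp_update (ha : ContinuousOn a (complexNhd δ)) {z : Fin d → ℂ}
    (hz : z ∈ complexNhd δ) (k : Fin d) :
    ContinuousOn (fun ζ => a (Function.update z k ζ)) (intervalNhd (δ k)) :=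
  ha.comp (continuous_const.update k continuous_id :
    Continuous fun ζ : ℂ => Function.update z k ζ).continuousOn
    fun _ hζ => update_mem_complexNhd hz hζ

lemma contDiffOn_segPrimitive (hδ : ∀ j, 0 < δ j) (ha : ContDiffOn ℂ 1 a (complexNhd δ))
    (k : Fin d) : ContDiffOn ℂ 1 (segPrimitive k a) (complexNhd δ) := by
  let A : ℝ → (Fin d → ℂ) →L[ℂ] (Fin d → ℂ) := fun r =>
    ContinuousLinearMap.id ℂ (Fin d → ℂ) + ((r - 1 : ℝ) : ℂ) •
      (ContinuousLinearMap.single ℂ (fun _ : Fin d => ℂ) k).comp (ContinuousLinearMap.proj k)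
  have hA : ∀ (z : Fin d → ℂ) (r : ℝ), A r z + Pi.single k ((r - 1 : ℝ) : ℂ) =
      Function.update z k (-1 + r * (z k + 1)) := by
    intro z r
    ext j
    rcases eq_or_ne j k with rfl | hjk
    · simp [A]
      ring
    · simp [A, hjk]
  have hintegral := contDiffOn_setIntegral_comp_affine (μ := volume) (K := Icc (0 : ℝ) 1)
    isCompact_Icc measurableSet_Icc (isOpen_complexNhd δ) (isOpen_complexNhd δ) ha
    (A := A) (Continuous.continuousOn (by fun_prop))
    (c := fun r => Pi.single k ((r - 1 : ℝ) : ℂ))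
    ((ContinuousLinearMap.single ℂ (fun _ : Fin d => ℂ) k).continuous.comp
      (by fun_prop : Continuous fun r : ℝ => ((r - 1 : ℝ) : ℂ))).continuousOn
    (φ := fun _ => (1 : ℂ)) continuousOn_const fun z hz r hr => by
      rw [hA]
      exact update_mem_complexNhd hz (segment_mem_intervalNhd (hδ k) (hz k) hr)
  simp only [hA, one_smul] at hintegral
  exact ((contDiff_apply ℂ ℂ k).add contDiff_const).contDiffOn.mul hintegral

lemma segPrimitive_update_eq_sub (hδ : ∀ j, 0 < δ j) (ha : ContinuousOn a (complexNhd δ))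
    {z : Fin d → ℂ} (hz : z ∈ complexNhd δ) {G : ℂ → ℂ}
    (hG : ∀ ζ ∈ intervalNhd (δ k), HasDerivAt G (a (Function.update z k ζ)) ζ) {ζ : ℂ}
    (hζ : ζ ∈ intervalNhd (δ k)) :
    segPrimitive k a (Function.update z k ζ) = G ζ - G (-1) := by
  have hmem : MapsTo (fun r : ℝ => -1 + r • (ζ + 1)) (Icc 0 1) (intervalNhd (δ k)) :=
    fun r hr => segment_mem_intervalNhd (hδ k) hζ hr
  have hftc := intervalIntegral.integral_unitInterval_deriv_eq_sub
    (f' := fun ζ => a (Function.update z k ζ)) ((continuousOn_comp_update ha hz k).comp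
      (f := fun r : ℝ => -1 + r • (ζ + 1)) (by fun_prop) hmem) fun r hr => hG _ (hmem hr)
  rw [neg_add_cancel_comm_assoc] at hftc
  simpa only [segPrimitive, Function.update_self, Function.update_idem, Complex.real_smul,
    smul_eq_mul, intervalIntegral.integral_of_le zero_le_one, integral_Icc_eq_integral_Ioc]
    using hftc

lemma hasDerivAt_segPrimitive (hδ : ∀ j, 0 < δ j) (ha : ContDiffOn ℂ 1 a (complexNhd δ))
    {z : Fin d → ℂ} (hz : z ∈ complexNhd δ) {ζ : ℂ} (hζ : ζ ∈ intervalNhd (δ k)) :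
    HasDerivAt (fun ζ => segPrimitive k a (Function.update z k ζ))
      (a (Function.update z k ζ)) ζ := by
  have hopen := isOpen_intervalNhd (δ k)
  have hdiff : DifferentiableOn ℂ (fun ζ => a (Function.update z k ζ)) (intervalNhd (δ k)) :=
    (ha.differentiableOn one_ne_zero).comp
      (fun ζ _ => (hasDerivAt_update z k ζ).differentiableAt.differentiableWithinAt)
      fun ζ hζ => update_mem_complexNhd hz hζ
  obtain ⟨G, hG⟩ := (convex_intervalNhd (δ k)).exists_forall_hasDerivWithinAt hdiff
  have hG' : ∀ ζ ∈ intervalNhd (δ k), HasDerivAt G (a (Function.update z k ζ)) ζ := fun ζ hζ =>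
    (hG ζ hζ).hasDerivAt (hopen.mem_nhds hζ)
  exact ((hG' ζ hζ).sub_const (G (-1))).congr_of_eventuallyEq <|
    Filter.mem_of_superset (hopen.mem_nhds hζ) fun _ =>
      segPrimitive_update_eq_sub hδ ha.continuousOn hz hG'

lemma segPrimitive_neg_one (z : Fin d → ℂ) :
    segPrimitive k a (Function.update z k (-1)) = 0 := by
  simp [segPrimitive]

lemma segPrimitive_ofReal (hδ : ∀ j, 0 < δ j) (ha : ContDiffOn ℂ 1 a (complexNhd δ))
    {z : Fin d → ℂ} (hz : z ∈ complexNhd δ) {s : ℝ} (hs : s ∈ Icc (-1 : ℝ) 1) :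
    segPrimitive k a (Function.update z k s) = ∫ t in (-1 : ℝ)..s, a (Function.update z k t) := by
  have hmem : ∀ t ∈ uIcc (-1 : ℝ) s, (t : ℂ) ∈ intervalNhd (δ k) := by
    intro t ht
    rw [uIcc_of_le hs.1] at ht
    exact ofReal_mem_intervalNhd (hδ k) ⟨ht.1, ht.2.trans hs.2⟩
  have h := intervalIntegral.integral_eq_sub_of_hasDerivAt
    (f := fun t : ℝ => segPrimitive k a (Function.update z k (t : ℂ)))
    (fun t ht => (hasDerivAt_segPrimitive hδ ha hz (hmem t ht)).comp_ofReal)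
    ((continuousOn_comp_update ha.continuousOn hz k).comp Complex.continuous_ofReal.continuousOn
      hmem).intervalIntegrable
  rw [h, Complex.ofReal_neg, Complex.ofReal_one, segPrimitive_neg_one, sub_zero]

lemma norm_segPrimitive_sub_le (hδ : ∀ j, 0 < δ j) (ha : ContDiffOn ℂ 1 a (complexNhd δ))
    {L : ℝ} (hL : ∀ z ∈ complexNhd δ, ‖a z‖ ≤ L)
    {z : Fin d → ℂ} (hz : z ∈ complexNhd δ) {ζ ζ' : ℂ} (hζ : ζ ∈ intervalNhd (δ k))
    (hζ' : ζ' ∈ intervalNhd (δ k)) :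
    ‖segPrimitive k a (Function.update z k ζ) - segPrimitive k a (Function.update z k ζ')‖ ≤
      L * ‖ζ - ζ'‖ :=
  (convex_intervalNhd (δ k)).norm_image_sub_le_of_norm_hasDerivWithin_le
    (fun _ hw => (hasDerivAt_segPrimitive hδ ha hz hw).hasDerivWithinAt)
    (fun _ hw => hL _ (update_mem_complexNhd hz hw)) hζ' hζ

lemma injOn_segPrimitive (hδ : ∀ j, 0 < δ j) (ha : ContDiffOn ℂ 1 a (complexNhd δ))
    {c : ℝ} (hc0 : 0 < c) (hc : ∀ z ∈ complexNhd δ, c ≤ (a z).re)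
    {z : Fin d → ℂ} (hz : z ∈ complexNhd δ) :
    InjOn (fun ζ => segPrimitive k a (Function.update z k ζ)) (intervalNhd (δ k)) :=
  injOn_of_pos_re_deriv (convex_intervalNhd (δ k))
    (continuousOn_comp_update ha.continuousOn hz k)
    (fun _ hζ => hasDerivAt_segPrimitive hδ ha hz hζ) hc0
    fun _ hζ => hc _ (update_mem_complexNhd hz hζ)

lemma exists_segPrimitive_eq (hδ : ∀ j, 0 < δ j) (ha : ContDiffOn ℂ 1 a (complexNhd δ))
    {c : ℝ} (hc0 : 0 < c) (hc : ∀ z ∈ complexNhd δ, c ≤ (a z).re)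
    {z : Fin d → ℂ} (hz : z ∈ complexNhd δ) {s : ℝ} (hs : s ∈ Icc (-1 : ℝ) 1) {v : ℂ}
    (hv : ‖v - segPrimitive k a (Function.update z k s)‖ < c * (δ k / 2) / 2) :
    ∃ ζ ∈ intervalNhd (δ k), segPrimitive k a (Function.update z k ζ) = v := by
  have hδk := hδ k
  have hsub : closedBall (s : ℂ) (δ k / 2) ⊆ intervalNhd (δ k) := fun ζ hζ =>
    ⟨s, hs, (mem_closedBall_iff_norm.1 hζ).trans_lt (half_lt_self hδk)⟩
  obtain ⟨ζ, hζ, hζv⟩ := ball_subset_image_closedBall_of_le_re_deriv (convex_intervalNhd (δ k))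
    (continuousOn_comp_update ha.continuousOn hz k)
    (fun _ hζ => hasDerivAt_segPrimitive hδ ha hz hζ) hc0
    (fun _ hζ => hc _ (update_mem_complexNhd hz hζ)) (half_pos hδk) hsub
    (mem_ball_iff_norm.2 hv)
  exact ⟨ζ, hsub hζ, hζv⟩

end SegPrimitive

/-! ### Holomorphic extension of the transport -/

section TransportExtension

variable {d : ℕ}

namespace MarginalExtension

variable {M L C : ℝ} {δ : Fin d → ℝ} {f : (Fin d → ℝ) → ℝ} {a : ℕ → (Fin d → ℂ) → ℂ}

lemma le_norm (h : MarginalExtension M L C δ f a) (k : ℕ) {z : Fin d → ℂ}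
    (hz : z ∈ complexNhd δ) : M / 2 ≤ ‖a k z‖ :=
  (h.le_re k z hz).trans (Complex.re_le_norm _)

lemma ne_zero (h : MarginalExtension M L C δ f a) (hM : 0 < M) (k : ℕ) {z : Fin d → ℂ}
    (hz : z ∈ complexNhd δ) : a k z ≠ 0 :=
  norm_pos_iff.1 ((half_pos hM).trans_le (h.le_norm k hz))

lemma segPrimitive_toComplex (h : MarginalExtension M L C δ f a) (hM : 0 < M)
    (hδ : ∀ j, 0 < δ j) (k : Fin d) {x : Fin d → ℝ} (hx : x ∈ cube d) {s : ℝ}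
    (hs : s ∈ Icc (-1 : ℝ) 1) :
    segPrimitive k (a (k + 1)) (Function.update (toComplex x) k s) =
      condCDF f k x s * a k (toComplex x) := by
  rw [segPrimitive_ofReal hδ (h.contDiffOn _) (toComplex_mem_complexNhd hδ hx) hs,
    h.ofReal k x hx, condCDF_eq, ← Complex.ofReal_mul,
    div_mul_cancel₀ _ (h.marginal_pos hM hδ k hx).ne', ← intervalIntegral.integral_ofReal]
  refine intervalIntegral.integral_congr fun t ht => ?_
  rw [uIcc_of_le hs.1] at ht
  rw [← toComplex_update, h.ofReal _ _ (update_mem_cube hx ⟨ht.1, ht.2.trans hs.2⟩)]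

lemma norm_segPrimitive_sub_toComplex_le (h : MarginalExtension M L C δ f a)
    (hC : 0 ≤ C) (hδ : ∀ j, 0 < δ j) (k : Fin d) {z : Fin d → ℂ} (hz : z ∈ complexNhd δ)
    {x : Fin d → ℝ} (hx : x ∈ cube d) (hzx : ∀ j, ‖z j - x j‖ < δ j) {s : ℝ}
    (hs : s ∈ Icc (-1 : ℝ) 1) :
    ‖segPrimitive k (a (k + 1)) (Function.update z k s) -
      segPrimitive k (a (k + 1)) (Function.update (toComplex x) k s)‖ ≤ 2 * (C * δ k) := by
  have hx' := toComplex_mem_complexNhd hδ hx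
  have hint : ∀ w ∈ complexNhd δ, IntervalIntegrable
      (fun t : ℝ => a (k + 1) (Function.update w k (t : ℂ))) volume (-1) s := fun w hw =>
    ((continuousOn_comp_update (h.contDiffOn _).continuousOn hw k).comp
      Complex.continuous_ofReal.continuousOn fun t ht =>
        ofReal_mem_intervalNhd (hδ k) ⟨ht.1, ht.2.trans hs.2⟩).intervalIntegrable_of_Icc hs.1
  rw [segPrimitive_ofReal hδ (h.contDiffOn _) hz hs, segPrimitive_ofReal hδ (h.contDiffOn _) hx' hs,
    ← intervalIntegral.integral_sub (hint z hz) (hint _ hx')]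
  refine (intervalIntegral.norm_integral_le_of_norm_le_const (C := C * δ k) fun t ht => ?_).trans ?_
  · rw [uIoc_of_le hs.1] at ht
    exact h.near_succ k z hz x hx hzx t ⟨ht.1.le, ht.2.trans hs.2⟩
  · rw [abs_of_nonneg (by linarith [hs.1]), mul_comm]
    exact mul_le_mul_of_nonneg_right (by linarith [hs.2]) (mul_nonneg hC (hδ k).le)

lemma norm_segPrimitive_sub_condCDF_mul_le (h : MarginalExtension M L C δ f a) (hM : 0 < M)
    (hC : 0 ≤ C) (hδ : ∀ j, 0 < δ j) (k : Fin d) {z : Fin d → ℂ} (hz : z ∈ complexNhd δ)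
    {x : Fin d → ℝ} (hx : x ∈ cube d) (hzx : ∀ j, ‖z j - x j‖ < δ j) {s : ℝ}
    (hs : s ∈ Icc (-1 : ℝ) 1) :
    ‖segPrimitive k (a (k + 1)) (Function.update z k s) - condCDF f k x s * a k z‖ ≤
      4 * C * δ k := by
  have hθ := (h.hasCondCDF hM hδ).mapsTo k hx hs
  have hnum := h.norm_segPrimitive_sub_toComplex_le hC hδ k hz hx hzx hs
  rw [h.segPrimitive_toComplex hM hδ k hx hs] at hnum
  have hden : ‖(condCDF f k x s : ℂ) * (a k (toComplex x) - a k z)‖ ≤ 2 * (C * δ k) := by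
    rw [norm_mul, Complex.norm_real, Real.norm_of_nonneg hθ.1, norm_sub_rev]
    exact mul_le_mul hθ.2 (h.near k z hz x hx hzx) (norm_nonneg _) two_pos.le
  have htriangle := norm_add_le_of_le hnum hden
  rw [mul_sub, sub_add_sub_cancel] at htriangle
  linarith

end MarginalExtension

/-- The hypotheses under which the transport from `fρ` to `fπ` extends to a holomorphic map from
`complexNhd fun j => C₇ * δ j` to `complexNhd δ`. The field `small` makes the equation for each
component solvable by a Rouché type argument; it is symmetric in the two densities, so that it also
covers the inverse transport. -/
structure TransportData (M L C₆ C₇ : ℝ) (δ : Fin d → ℝ) (fρ fπ : (Fin d → ℝ) → ℝ)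
    (a b : ℕ → (Fin d → ℂ) → ℂ) : Prop where
  source : MarginalExtension M L C₆ δ fρ a
  target : MarginalExtension M L C₆ δ fπ b
  radius_pos : ∀ j, 0 < δ j
  M_pos : 0 < M
  C₆_nonneg : 0 ≤ C₆
  C₇_pos : 0 < C₇
  C₇_le_one : C₇ ≤ 1
  small : 2 * L * (L * C₇ + 4 * C₆) / M + 4 * C₆ < M / 8

/-- The value that the primitive of `b (k + 1)` in the coordinate `k` takes at the image `w` of `z`
under the extended transport: the equation `F_{π;k}(w) = F_{ρ;k}(z)` with the denominator of the
left-hand side cleared. -/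
def transportValue (a b : ℕ → (Fin d → ℂ) → ℂ) (k : Fin d) (w z : Fin d → ℂ) : ℂ :=
  b k w * segPrimitive k (a (k + 1)) z / a k z

variable {M L C₆ C₇ : ℝ} {δ : Fin d → ℝ} {fρ fπ : (Fin d → ℝ) → ℝ} {a b : ℕ → (Fin d → ℂ) → ℂ}

namespace TransportData

lemma symm (h : TransportData M L C₆ C₇ δ fρ fπ a b) : TransportData M L C₆ C₇ δ fπ fρ b a :=
  { h with source := h.target, target := h.source }

lemma L_pos (h : TransportData M L C₆ C₇ δ fρ fπ a b) : 0 < L := by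
  have h0 : toComplex 0 ∈ complexNhd δ :=
    toComplex_mem_complexNhd h.radius_pos fun _ => by simp
  exact (half_pos h.M_pos).trans_le ((h.source.le_norm 0 h0).trans (h.source.norm_le 0 _ h0))

lemma smallRadius_pos (h : TransportData M L C₆ C₇ δ fρ fπ a b) (j : Fin d) : 0 < C₇ * δ j :=
  mul_pos h.C₇_pos (h.radius_pos j)

lemma smallRadius_le (h : TransportData M L C₆ C₇ δ fρ fπ a b) (j : Fin d) : C₇ * δ j ≤ δ j :=
  mul_le_of_le_one_left (h.radius_pos j).le h.C₇_le_one

lemma complexNhd_subset (h : TransportData M L C₆ C₇ δ fρ fπ a b) :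
    complexNhd (fun j => C₇ * δ j) ⊆ complexNhd δ :=
  complexNhd_mono h.smallRadius_le

lemma hasCondCDF_source (h : TransportData M L C₆ C₇ δ fρ fπ a b) : HasCondCDF fρ :=
  h.source.hasCondCDF h.M_pos h.radius_pos

lemma hasCondCDF_target (h : TransportData M L C₆ C₇ δ fρ fπ a b) : HasCondCDF fπ :=
  h.symm.hasCondCDF_source

lemma norm_segPrimitive_sub_condCDF_mul_le (h : TransportData M L C₆ C₇ δ fρ fπ a b) (k : Fin d)
    {z : Fin d → ℂ} (hz : z ∈ complexNhd fun j => C₇ * δ j) {x : Fin d → ℝ} (hx : x ∈ cube d)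
    (hzx : ∀ j, ‖z j - x j‖ < C₇ * δ j) :
    ‖segPrimitive k (a (k + 1)) z - condCDF fρ k x (x k) * a k z‖ ≤ (L * C₇ + 4 * C₆) * δ k := by
  have hzδ := h.complexNhd_subset hz
  have hmove := norm_segPrimitive_sub_le (k := k) h.radius_pos (h.source.contDiffOn (k + 1))
    (h.source.norm_le (k + 1)) hzδ (hzδ k) (ofReal_mem_intervalNhd (h.radius_pos k) (hx k))
  rw [Function.update_eq_self] at hmove
  have hreal := h.source.norm_segPrimitive_sub_condCDF_mul_le h.M_pos h.C₆_nonneg h.radius_pos k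
    hzδ hx (fun j => (hzx j).trans_le (h.smallRadius_le j)) (hx k)
  have htriangle := norm_add_le_of_le
    (hmove.trans (mul_le_mul_of_nonneg_left (hzx k).le h.L_pos.le)) hreal
  rw [sub_add_sub_cancel] at htriangle
  linarith

theorem exists_norm_transportValue_sub_lt (h : TransportData M L C₆ C₇ δ fρ fπ a b) (k : Fin d)
    {z w : Fin d → ℂ} (hz : z ∈ complexNhd fun j => C₇ * δ j) (hw : w ∈ complexNhd δ) :
    ∃ s ∈ Icc (-1 : ℝ) 1, ‖transportValue a b k w z -
      segPrimitive k (b (k + 1)) (Function.update w k s)‖ < M / 2 * (δ k / 2) / 2 := by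
  have hM := h.M_pos
  have hδk := h.radius_pos k
  have hzδ := h.complexNhd_subset hz
  obtain ⟨x, hx, hzx⟩ := exists_mem_cube_norm_sub_lt hz
  obtain ⟨y, hy, hwy⟩ := exists_mem_cube_norm_sub_lt hw
  obtain ⟨s, hs, hsθ⟩ := h.hasCondCDF_target.surjOn k hy (h.hasCondCDF_source.mapsTo k hx (hx k))
  refine ⟨s, hs, ?_⟩
  have hsource := h.norm_segPrimitive_sub_condCDF_mul_le k hz hx hzx
  have htarget := h.target.norm_segPrimitive_sub_condCDF_mul_le hM h.C₆_nonneg h.radius_pos k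
    hw hy hwy hs
  rw [hsθ] at htarget
  set θ := condCDF fρ k x (x k)
  have hquot : ‖b k w * ((segPrimitive k (a (k + 1)) z - θ * a k z) / a k z)‖ ≤
      L * ((L * C₇ + 4 * C₆) * δ k / (M / 2)) := by
    rw [norm_mul, norm_div]
    exact mul_le_mul (h.target.norm_le k w hw) (div_le_div₀ ((norm_nonneg _).trans hsource)
      hsource (half_pos hM) (h.source.le_norm k hzδ)) (by positivity) h.L_pos.le
  have hsplit : transportValue a b k w z - segPrimitive k (b (k + 1)) (Function.update w k s) =
      b k w * ((segPrimitive k (a (k + 1)) z - θ * a k z) / a k z) -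
        (segPrimitive k (b (k + 1)) (Function.update w k s) - θ * b k w) := by
    have := h.source.ne_zero hM k hzδ
    rw [transportValue]
    field_simp
    ring
  calc ‖transportValue a b k w z - segPrimitive k (b (k + 1)) (Function.update w k s)‖
      ≤ L * ((L * C₇ + 4 * C₆) * δ k / (M / 2)) + 4 * C₆ * δ k :=
        hsplit ▸ norm_sub_le_of_le hquot htarget
    _ = (2 * L * (L * C₇ + 4 * C₆) / M + 4 * C₆) * δ k := by field_simp
    _ < M / 8 * δ k := mul_lt_mul_of_pos_right h.small hδk
    _ = M / 2 * (δ k / 2) / 2 := by ring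

end TransportData

/-- A holomorphic extension of the first `n` components of the transport, completed by the
identity. -/
structure PartialExtension (C₇ : ℝ) (δ : Fin d → ℝ) (fρ fπ : (Fin d → ℝ) → ℝ)
    (a b : ℕ → (Fin d → ℂ) → ℂ) (n : ℕ) (W : (Fin d → ℂ) → (Fin d → ℂ)) : Prop where
  contDiffOn : ContDiffOn ℂ 1 W (complexNhd fun j => C₇ * δ j)
  mapsTo : MapsTo W (complexNhd fun j => C₇ * δ j) (complexNhd δ)
  triangular : ∀ z ∈ complexNhd (fun j => C₇ * δ j), ∀ z' ∈ complexNhd (fun j => C₇ * δ j),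
    ∀ j, (∀ i ≤ j, z i = z' i) → W z j = W z' j
  apply_toComplex : ∀ x ∈ cube d, W (toComplex x) = toComplex (transportAux fρ fπ x n)
  equation : ∀ k : Fin d, (k : ℕ) < n → ∀ z ∈ complexNhd (fun j => C₇ * δ j),
    segPrimitive k (b (k + 1)) (W z) = transportValue a b k (W z) z

/-- `s` solves the equation for the component `k` of the extended transport, given a map `W` with
the components before `k`, and the solution is unique near the interval. -/
structure IsNextComponent (C₇ : ℝ) (δ : Fin d → ℝ) (a b : ℕ → (Fin d → ℂ) → ℂ) (k : Fin d)
    (W : (Fin d → ℂ) → (Fin d → ℂ)) (s : (Fin d → ℂ) → ℂ) : Prop where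
  mapsTo : MapsTo s (complexNhd fun j => C₇ * δ j) (intervalNhd (δ k))
  eq_iff : ∀ z ∈ complexNhd (fun j => C₇ * δ j), ∀ ζ ∈ intervalNhd (δ k),
    segPrimitive k (b (k + 1)) (Function.update (W z) k ζ) = transportValue a b k (W z) z ↔ ζ = s z

lemma TransportData.exists_isNextComponent (h : TransportData M L C₆ C₇ δ fρ fπ a b) (k : Fin d)
    {W : (Fin d → ℂ) → (Fin d → ℂ)}
    (hW : MapsTo W (complexNhd fun j => C₇ * δ j) (complexNhd δ)) :
    ∃ s, IsNextComponent C₇ δ a b k W s := by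
  have hex : ∀ z ∈ complexNhd (fun j => C₇ * δ j), ∃ ζ ∈ intervalNhd (δ k),
      segPrimitive k (b (k + 1)) (Function.update (W z) k ζ) = transportValue a b k (W z) z := by
    intro z hz
    obtain ⟨s, hs, hlt⟩ := h.exists_norm_transportValue_sub_lt k hz (hW hz)
    exact exists_segPrimitive_eq h.radius_pos (h.target.contDiffOn _) (half_pos h.M_pos)
      (h.target.le_re _) (hW hz) hs hlt
  choose! s hs hsv using hex
  refine ⟨s, hs, fun z hz ζ hζ => ⟨fun hζv => ?_, fun hζs => hζs ▸ hsv z hz⟩⟩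
  exact injOn_segPrimitive h.radius_pos (h.target.contDiffOn _) (half_pos h.M_pos)
    (h.target.le_re _) (hW hz) hζ (hs z hz) (hζv.trans (hsv z hz).symm)

lemma isInvertible_smulRight {c : ℂ} (hc : c ≠ 0) {A : ℂ →L[ℂ] ℂ} (hA : A 1 = c) :
    A.IsInvertible := by
  refine ⟨ContinuousLinearEquiv.unitsEquivAut ℂ (Units.mk0 c hc), ?_⟩
  ext
  simp [hA]

lemma contDiffAt_of_unique_solution {E : Type*} [NormedAddCommGroup E] [NormedSpace ℂ E]
    [CompleteSpace E] {Ψ : E × ℂ → ℂ} {D : Set E} {V : Set ℂ} (hD : IsOpen D) (hV : IsOpen V)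
    {s : E → ℂ} (hsV : ∀ z ∈ D, s z ∈ V)
    (hs : ∀ z ∈ D, ∀ ζ ∈ V, Ψ (z, ζ) = 0 ↔ ζ = s z)
    {z : E} (hz : z ∈ D) (hΨ : ContDiffAt ℂ 1 Ψ (z, s z)) {c : ℂ} (hc : c ≠ 0)
    (hder : HasDerivAt (fun ζ => Ψ (z, ζ)) c (s z)) : ContDiffAt ℂ 1 s z := by
  have hfd : HasFDerivAt Ψ (fderiv ℂ Ψ (z, s z)) (z, s z) :=
    (hΨ.differentiableAt one_ne_zero).hasFDerivAt
  have hA : (fderiv ℂ Ψ (z, s z) ∘L .inr ℂ E ℂ) 1 = c := by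
    have hpair : HasDerivAt (fun ζ : ℂ => (z, ζ)) ((0 : E), (1 : ℂ)) (s z) :=
      (hasDerivAt_const _ _).prodMk (hasDerivAt_id _)
    simpa using (hfd.comp_hasDerivAt (s z) hpair).unique hder
  have hinv := isInvertible_smulRight hc hA
  have hφ := hΨ.contDiffAt_implicitFunction one_ne_zero hinv
  have hev := hΨ.eventually_apply_implicitFunction one_ne_zero hinv
  have hself := hΨ.implicitFunction_apply_self one_ne_zero hinv
  simp only at hφ hev hself
  refine hφ.congr_of_eventuallyEq ?_
  have hcont := hφ.continuousAt
  have hmem : ∀ᶠ w in 𝓝 z, hΨ.implicitFunction one_ne_zero hinv w ∈ V := by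
    refine hcont.eventually_mem (hV.mem_nhds ?_)
    rw [hself]
    exact hsV z hz
  filter_upwards [hev, hmem, hD.mem_nhds hz] with w hw hwV hwD
  refine ((hs w hwD _ hwV).1 ?_).symm
  rw [hw]
  exact (hs z hz _ (hsV z hz)).2 rfl

lemma contDiff_update_pair (k : Fin d) :
    ContDiff ℂ 1 fun q : (Fin d → ℂ) × ℂ => Function.update q.1 k q.2 := by
  refine contDiff_pi.2 fun j => ?_
  rcases eq_or_ne j k with rfl | hjk
  · simpa using contDiff_snd
  · simp only [Function.update_of_ne hjk]
    exact (contDiff_apply ℂ ℂ j).comp contDiff_fst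

namespace IsNextComponent

variable {k : Fin d} {W : (Fin d → ℂ) → (Fin d → ℂ)} {s : (Fin d → ℂ) → ℂ}

lemma contDiffOn (hs : IsNextComponent C₇ δ a b k W s) (h : TransportData M L C₆ C₇ δ fρ fπ a b)
    (hW : PartialExtension C₇ δ fρ fπ a b k W) :
    ContDiffOn ℂ 1 s (complexNhd fun j => C₇ * δ j) := by
  have hD := isOpen_complexNhd fun j => C₇ * δ j
  have hvalue : ContDiffOn ℂ 1 (fun z => transportValue a b k (W z) z)
      (complexNhd fun j => C₇ * δ j) :=
    (((h.target.contDiffOn k).comp hW.contDiffOn hW.mapsTo).mul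
      ((contDiffOn_segPrimitive h.radius_pos (h.source.contDiffOn _) k).mono
        h.complexNhd_subset)).div ((h.source.contDiffOn k).mono h.complexNhd_subset)
      fun z hz => h.source.ne_zero h.M_pos k (h.complexNhd_subset hz)
  intro z hz
  have hup := update_mem_complexNhd (hW.mapsTo hz) (hs.mapsTo hz)
  have hWz : ContDiffAt ℂ 1 W z := hW.contDiffOn.contDiffAt (hD.mem_nhds hz)
  have hupdate : ContDiffAt ℂ 1
      (fun q : (Fin d → ℂ) × ℂ => Function.update (W q.1) k q.2) (z, s z) :=
    (contDiff_update_pair k).contDiffAt.comp (z, s z)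
      ((hWz.comp (z, s z) contDiffAt_fst).prodMk contDiffAt_snd)
  have hprimitive : ContDiffAt ℂ 1 (segPrimitive k (b (k + 1))) (Function.update (W z) k (s z)) :=
    (contDiffOn_segPrimitive h.radius_pos (h.target.contDiffOn _) k).contDiffAt
      ((isOpen_complexNhd δ).mem_nhds hup)
  have hderiv : HasDerivAt
      (fun ζ => segPrimitive k (b (k + 1)) (Function.update (W z) k ζ) -
        transportValue a b k (W z) z)
      (b (k + 1) (Function.update (W z) k (s z))) (s z) :=
    (hasDerivAt_segPrimitive h.radius_pos (h.target.contDiffOn (k + 1)) (hW.mapsTo hz)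
      (hs.mapsTo hz)).sub_const _
  exact (contDiffAt_of_unique_solution
    (Ψ := fun q => segPrimitive k (b (k + 1)) (Function.update (W q.1) k q.2) -
      transportValue a b k (W q.1) q.1) hD (isOpen_intervalNhd (δ k)) hs.mapsTo
    (fun z hz ζ hζ => sub_eq_zero.trans (hs.eq_iff z hz ζ hζ)) hz
    ((hprimitive.comp (z, s z) hupdate).sub
      ((hvalue.contDiffAt (hD.mem_nhds hz)).comp (z, s z) contDiffAt_fst))
    (h.target.ne_zero h.M_pos (k + 1) hup) hderiv).contDiffWithinAt

lemma congr (hs : IsNextComponent C₇ δ a b k W s) (h : TransportData M L C₆ C₇ δ fρ fπ a b)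
    (hW : PartialExtension C₇ δ fρ fπ a b k W) {z z' : Fin d → ℂ}
    (hz : z ∈ complexNhd fun j => C₇ * δ j) (hz' : z' ∈ complexNhd fun j => C₇ * δ j)
    (hzz' : ∀ j ≤ k, z j = z' j) : s z = s z' := by
  have hWW' : ∀ j ≤ k, W z j = W z' j := fun j hj =>
    hW.triangular z hz z' hz' j fun i hi => hzz' i (hi.trans hj)
  have hprimitive : segPrimitive k (b (k + 1)) (Function.update (W z) k (s z)) =
      segPrimitive k (b (k + 1)) (Function.update (W z') k (s z)) :=
    segPrimitive_congr (h.target.congr _) fun j hj => by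
      rcases eq_or_ne j k with rfl | hjk
      · simp only [Function.update_self]
      · rw [Function.update_of_ne hjk, Function.update_of_ne hjk, hWW' j hj]
  have hvalue : transportValue a b k (W z) z = transportValue a b k (W z') z' := by
    rw [transportValue, transportValue, h.target.congr k _ _ fun j hj => hWW' j (le_of_lt hj),
      segPrimitive_congr (h.source.congr _) hzz',
      h.source.congr k _ _ fun j hj => hzz' j (le_of_lt hj)]
  refine (hs.eq_iff z' hz' _ (hs.mapsTo hz)).1 ?_
  rw [← hprimitive, ← hvalue]
  exact (hs.eq_iff z hz _ (hs.mapsTo hz)).2 rfl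

lemma apply_toComplex (hs : IsNextComponent C₇ δ a b k W s)
    (h : TransportData M L C₆ C₇ δ fρ fπ a b) (hW : PartialExtension C₇ δ fρ fπ a b k W)
    {x : Fin d → ℝ} (hx : x ∈ cube d) : s (toComplex x) = transport fρ fπ x k := by
  have hxD : toComplex x ∈ complexNhd fun j => C₇ * δ j :=
    toComplex_mem_complexNhd h.smallRadius_pos hx
  have hy := transportAux_mem_cube h.hasCondCDF_source h.hasCondCDF_target hx k
  obtain ⟨hTx, hT⟩ := transport_mem_and_condCDF h.hasCondCDF_source h.hasCondCDF_target hx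
  have hcdf : condCDF fπ k (transportAux fρ fπ x k) (transport fρ fπ x k) =
      condCDF fρ k x (x k) := by
    rw [← hT k, condCDF_congr fπ fun j hj => (transportAux_of_lt x hj k.isLt.le).symm, transport]
  refine ((hs.eq_iff _ hxD _ (ofReal_mem_intervalNhd (h.radius_pos k) (hTx k))).1 ?_).symm
  have hsource := h.source.segPrimitive_toComplex h.M_pos h.radius_pos k hx (hx k)
  rw [← toComplex_update, Function.update_eq_self] at hsource
  rw [hW.apply_toComplex x hx, transportValue, hsource,
    h.target.segPrimitive_toComplex h.M_pos h.radius_pos k hy (hTx k), hcdf]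
  have := h.source.ne_zero h.M_pos k (h.complexNhd_subset hxD)
  field_simp

end IsNextComponent

lemma PartialExtension.exists_succ (h : TransportData M L C₆ C₇ δ fρ fπ a b) {k : Fin d}
    {W : (Fin d → ℂ) → (Fin d → ℂ)} (hW : PartialExtension C₇ δ fρ fπ a b k W) :
    ∃ W', PartialExtension C₇ δ fρ fπ a b (k + 1) W' := by
  obtain ⟨s, hs⟩ := h.exists_isNextComponent k hW.mapsTo
  refine ⟨fun z => Function.update (W z) k (s z),
    (contDiff_update_pair k).comp_contDiffOn (hW.contDiffOn.prodMk (hs.contDiffOn h hW)),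
    fun z hz => update_mem_complexNhd (hW.mapsTo hz) (hs.mapsTo hz),
    fun z hz z' hz' j hj => ?_, fun x hx => ?_, fun l hl z hz => ?_⟩
  · rcases eq_or_ne j k with rfl | hjk
    · simpa only [Function.update_self] using hs.congr h hW hz hz' hj
    · simpa only [Function.update_of_ne hjk] using hW.triangular z hz z' hz' j hj
  · rw [hs.apply_toComplex h hW hx, hW.apply_toComplex x hx, transportAux_succ, toComplex_update]
  · have hcongr : ∀ j < k, Function.update (W z) k (s z) j = W z j := fun j hj =>
      Function.update_of_ne hj.ne _ _
    rcases (Nat.lt_succ_iff.1 hl : (l : ℕ) ≤ k).lt_or_eq with hlk | hlk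
    · rw [transportValue, h.target.congr l _ (W z) fun j hj => hcongr j (hj.trans hlk),
        segPrimitive_congr (h.target.congr _) fun j hj => hcongr j (lt_of_le_of_lt hj hlk)]
      exact hW.equation l hlk z hz
    · obtain rfl : l = k := Fin.ext hlk
      rw [transportValue, h.target.congr l _ (W z) hcongr]
      exact (hs.eq_iff z hz _ (hs.mapsTo hz)).2 rfl

theorem TransportData.exists_partialExtension (h : TransportData M L C₆ C₇ δ fρ fπ a b) {n : ℕ}
    (hn : n ≤ d) : ∃ W, PartialExtension C₇ δ fρ fπ a b n W := by
  induction n with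
  | zero => exact ⟨id, contDiffOn_id, h.complexNhd_subset, fun _ _ _ _ j hj => hj j le_rfl,
      fun _ _ => rfl, fun k hk => absurd hk (Nat.not_lt_zero _)⟩
  | succ n ih =>
    obtain ⟨W, hW⟩ := ih (n.le_succ.trans hn)
    exact PartialExtension.exists_succ (k := ⟨n, hn⟩) h hW

end TransportExtension

section RootExtension

variable {d : ℕ}

lemma complexSqrt_sq (z : ℂ) : z.sqrt ^ 2 = z := by simp [Complex.sqrt]

lemma complexSqrt_ne_zero {z : ℂ} (hz : z ≠ 0) : z.sqrt ≠ 0 := fun h =>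
  hz (by rw [← complexSqrt_sq z, h, zero_pow two_ne_zero])

lemma contDiffOn_complexSqrt {E : Type*} [NormedAddCommGroup E] [NormedSpace ℂ E] {g : E → ℂ}
    {s : Set E} {n : WithTop ℕ∞} (hg : ContDiffOn ℂ n g s) (h : ∀ z ∈ s, 0 < (g z).re) :
    ContDiffOn ℂ n (fun z => (g z).sqrt) s := by
  have hexp : ContDiffOn ℂ n (fun z => Complex.exp (Complex.log (g z) * 2⁻¹)) s :=
    ContDiffOn.cexp (ContDiffOn.mul (fun z hz => (Complex.contDiffAt_log
      (Or.inl (h z hz))).comp_contDiffWithinAt z (hg z hz)) contDiffOn_const)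
  refine hexp.congr fun z hz => Complex.cpow_def_of_ne_zero (fun h0 => ?_) _
  simpa [h0] using h z hz

/-- A holomorphic extension `R` of the square root of the derivative of the component `k` of `T`
in the direction `k`. -/
structure RootExtension (η : Fin d → ℝ) (T : (Fin d → ℝ) → (Fin d → ℝ)) (k : Fin d)
    (R : (Fin d → ℂ) → ℂ) : Prop where
  contDiffOn : ContDiffOn ℂ 1 R (complexNhd η)
  bounded : ∃ B, ∀ z ∈ complexNhd η, ‖R z‖ ≤ B
  triangular : ∀ z ∈ complexNhd η, ∀ z' ∈ complexNhd η, (∀ i ≤ k, z i = z' i) → R z = R z'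
  pos : ∀ x ∈ cube d, ∃ y : ℝ, 0 < y ∧ R (toComplex x) = y
  formula : ∀ x ∈ cube d, (T x k : ℂ) = -1 + segPrimitive k (fun z => R z ^ 2) (toComplex x)
  apply_one : ∀ x ∈ cube d, T (Function.update x k 1) k = 1

lemma RootExtension.congr {η : Fin d → ℝ} {T T' : (Fin d → ℝ) → (Fin d → ℝ)} {k : Fin d}
    {R : (Fin d → ℂ) → ℂ} (h : RootExtension η T k R) (hT : ∀ x ∈ cube d, T' x = T x) :
    RootExtension η T' k R :=
  { h with
    formula := fun x hx => by rw [hT x hx, h.formula x hx]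
    apply_one := fun x hx => by rw [hT _ (update_mem_cube hx (by norm_num)), h.apply_one x hx] }

section

variable {fρ fπ : (Fin d → ℝ) → ℝ} (hρ : HasCondCDF fρ) (hπ : HasCondCDF fπ) {x : Fin d → ℝ}
include hρ hπ

lemma transport_update_eq_self_of_condCDF_eq (hx : x ∈ cube d) (k : Fin d) {s : ℝ}
    (hs : s ∈ Icc (-1 : ℝ) 1) (h : condCDF fπ k (transport fρ fπ x) s = condCDF fρ k x s) :
    transport fρ fπ (Function.update x k s) k = s :=
  (hπ.strictMonoOn k _ (transport_mem_and_condCDF hρ hπ hx).1).injOn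
    ((transport_mem_and_condCDF hρ hπ (update_mem_cube hx hs)).1 k) hs
    ((condCDF_transport_update hρ hπ k hx hs).trans h.symm)

lemma transport_update_neg_one (hx : x ∈ cube d) (k : Fin d) :
    transport fρ fπ (Function.update x k (-1)) k = -1 :=
  transport_update_eq_self_of_condCDF_eq hρ hπ hx k (by norm_num)
    (by rw [condCDF_neg_one, condCDF_neg_one])

lemma transport_update_one (hx : x ∈ cube d) (k : Fin d) :
    transport fρ fπ (Function.update x k 1) k = 1 :=
  transport_update_eq_self_of_condCDF_eq hρ hπ hx k (by norm_num) <| by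
    rw [hρ.apply_one k _ hx, hπ.apply_one k _ (transport_mem_and_condCDF hρ hπ hx).1]

end

/-- The square root of the derivative of the component `k` of the extended transport `W` in the
direction `k`, where `a` and `b` extend the marginals of source and target. -/
def transportRoot (a b : ℕ → (Fin d → ℂ) → ℂ) (W : (Fin d → ℂ) → (Fin d → ℂ)) (k : Fin d)
    (z : Fin d → ℂ) : ℂ :=
  (a (k + 1) z).sqrt * (b k (W z)).sqrt / ((a k z).sqrt * (b (k + 1) (W z)).sqrt)

lemma transportRoot_sq (a b : ℕ → (Fin d → ℂ) → ℂ) (W : (Fin d → ℂ) → (Fin d → ℂ)) (k : Fin d)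
    (z : Fin d → ℂ) : transportRoot a b W k z ^ 2 =
      a (k + 1) z * b k (W z) / (a k z * b (k + 1) (W z)) := by
  simp only [transportRoot, div_pow, mul_pow, complexSqrt_sq]

namespace PartialExtension

variable {M L C₆ C₇ : ℝ} {δ : Fin d → ℝ} {fρ fπ : (Fin d → ℝ) → ℝ} {a b : ℕ → (Fin d → ℂ) → ℂ}
  {W : (Fin d → ℂ) → (Fin d → ℂ)}

lemma segPrimitive_update (hW : PartialExtension C₇ δ fρ fπ a b d W)
    (h : TransportData M L C₆ C₇ δ fρ fπ a b) (k : Fin d) {z z' : Fin d → ℂ}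
    (hz : z ∈ complexNhd fun j => C₇ * δ j) (hz' : z' ∈ complexNhd fun j => C₇ * δ j)
    (hzz' : ∀ j < k, z' j = z j) :
    segPrimitive k (b (k + 1)) (Function.update (W z) k (W z' k)) =
      b k (W z) * segPrimitive k (a (k + 1)) z' / a k z := by
  have hWW' : ∀ j < k, W z' j = W z j := fun j hj =>
    hW.triangular z' hz' z hz j fun i hi => hzz' i (hi.trans_lt hj)
  have hequation := hW.equation k k.isLt z' hz'
  rw [transportValue, h.target.congr k _ _ hWW', h.source.congr k z' z hzz'] at hequation
  rw [← hequation]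
  refine segPrimitive_congr (h.target.congr _) fun j hj => ?_
  rcases eq_or_ne j k with rfl | hjk
  · simp only [Function.update_self]
  · rw [Function.update_of_ne hjk, hWW' j (lt_of_le_of_ne hj hjk)]

theorem hasDerivAt_apply_update (hW : PartialExtension C₇ δ fρ fπ a b d W)
    (h : TransportData M L C₆ C₇ δ fρ fπ a b) (k : Fin d) {z : Fin d → ℂ}
    (hz : z ∈ complexNhd fun j => C₇ * δ j) :
    HasDerivAt (fun ζ => W (Function.update z k ζ) k) (transportRoot a b W k z ^ 2) (z k) := by
  have hzδ := h.complexNhd_subset hz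
  set g : ℂ → ℂ := fun ζ => W (Function.update z k ζ) k
  have hgz : g (z k) = W z k := by simp only [g, Function.update_eq_self]
  have hg : DifferentiableAt ℂ g (z k) := by
    have hWz : DifferentiableAt ℂ W (Function.update z k (z k)) := by
      rw [Function.update_eq_self]
      exact (hW.contDiffOn.contDiffAt ((isOpen_complexNhd _).mem_nhds hz)).differentiableAt
        one_ne_zero
    exact differentiableAt_pi.1 (hWz.comp (z k) (hasDerivAt_update z k _).differentiableAt) k
  have hleft : HasDerivAt (fun ζ => segPrimitive k (b (k + 1)) (Function.update (W z) k (g ζ)))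
      (b (k + 1) (W z) * deriv g (z k)) (z k) := by
    have hsegPrimitive := hasDerivAt_segPrimitive h.radius_pos (h.target.contDiffOn (k + 1))
      (hW.mapsTo hz) (hW.mapsTo hz k)
    rw [← hgz] at hsegPrimitive
    have hcomp := hsegPrimitive.comp (z k) hg.hasDerivAt
    rwa [hgz, Function.update_eq_self] at hcomp
  have hright : HasDerivAt
      (fun ζ => b k (W z) * segPrimitive k (a (k + 1)) (Function.update z k ζ) / a k z)
      (b k (W z) * a (k + 1) z / a k z) (z k) := by
    have hsegPrimitive :=
      hasDerivAt_segPrimitive h.radius_pos (h.source.contDiffOn (k + 1)) hzδ (hzδ k)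
    rw [Function.update_eq_self] at hsegPrimitive
    exact (hsegPrimitive.const_mul _).div_const _
  have hunique := hleft.unique <| hright.congr_of_eventuallyEq <|
    Filter.mem_of_superset ((isOpen_intervalNhd _).mem_nhds (hz k)) fun ζ hζ =>
      hW.segPrimitive_update h k hz (update_mem_complexNhd hz hζ) fun j hj =>
        Function.update_of_ne hj.ne _ _
  have hderiv : deriv g (z k) = transportRoot a b W k z ^ 2 := by
    have hb0 := h.target.ne_zero h.M_pos (k + 1) (hW.mapsTo hz)
    have ha0 := h.source.ne_zero h.M_pos k hzδ
    rw [transportRoot_sq]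
    field_simp at hunique ⊢
    linear_combination hunique
  exact hderiv ▸ hg.hasDerivAt

lemma contDiffOn_transportRoot (hW : PartialExtension C₇ δ fρ fπ a b d W)
    (h : TransportData M L C₆ C₇ δ fρ fπ a b) (k : Fin d) :
    ContDiffOn ℂ 1 (transportRoot a b W k) (complexNhd fun j => C₇ * δ j) := by
  have hsource : ∀ l, ContDiffOn ℂ 1 (fun z => (a l z).sqrt) (complexNhd fun j => C₇ * δ j) :=
    fun l => contDiffOn_complexSqrt ((h.source.contDiffOn l).mono h.complexNhd_subset)
      fun z hz => (half_pos h.M_pos).trans_le (h.source.le_re l z (h.complexNhd_subset hz))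
  have htarget : ∀ l, ContDiffOn ℂ 1 (fun z => (b l (W z)).sqrt) (complexNhd fun j => C₇ * δ j) :=
    fun l => contDiffOn_complexSqrt ((h.target.contDiffOn l).comp hW.contDiffOn hW.mapsTo)
      fun z hz => (half_pos h.M_pos).trans_le (h.target.le_re l _ (hW.mapsTo hz))
  exact ((hsource _).mul (htarget _)).div ((hsource _).mul (htarget _)) fun z hz =>
    mul_ne_zero (complexSqrt_ne_zero (h.source.ne_zero h.M_pos _ (h.complexNhd_subset hz)))
      (complexSqrt_ne_zero (h.target.ne_zero h.M_pos _ (hW.mapsTo hz)))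

lemma norm_transportRoot_le (hW : PartialExtension C₇ δ fρ fπ a b d W)
    (h : TransportData M L C₆ C₇ δ fρ fπ a b) (k : Fin d) {z : Fin d → ℂ}
    (hz : z ∈ complexNhd fun j => C₇ * δ j) : ‖transportRoot a b W k z‖ ≤ L / (M / 2) := by
  have hL := h.L_pos
  have hM := half_pos h.M_pos
  have hzδ := h.complexNhd_subset hz
  refine le_of_sq_le_sq ?_ (by positivity)
  rw [← norm_pow, transportRoot_sq, norm_div, norm_mul, norm_mul, div_pow, sq, sq]
  exact div_le_div₀ (by positivity)
    (mul_le_mul (h.source.norm_le _ _ hzδ) (h.target.norm_le _ _ (hW.mapsTo hz)) (norm_nonneg _)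
      hL.le) (by positivity)
    (mul_le_mul (h.source.le_norm _ hzδ) (h.target.le_norm _ (hW.mapsTo hz)) hM.le (norm_nonneg _))

lemma transportRoot_congr (hW : PartialExtension C₇ δ fρ fπ a b d W)
    (h : TransportData M L C₆ C₇ δ fρ fπ a b) {k : Fin d} {z z' : Fin d → ℂ}
    (hz : z ∈ complexNhd fun j => C₇ * δ j) (hz' : z' ∈ complexNhd fun j => C₇ * δ j)
    (hzz' : ∀ j ≤ k, z j = z' j) : transportRoot a b W k z = transportRoot a b W k z' := by
  have hWW' : ∀ j ≤ k, W z j = W z' j := fun j hj =>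
    hW.triangular z hz z' hz' j fun i hi => hzz' i (hi.trans hj)
  rw [transportRoot, transportRoot,
    h.source.congr (k + 1) z z' fun j hj => hzz' j (Nat.lt_succ_iff.1 hj),
    h.source.congr k z z' fun j hj => hzz' j (le_of_lt hj),
    h.target.congr (k + 1) (W z) (W z') fun j hj => hWW' j (Nat.lt_succ_iff.1 hj),
    h.target.congr k (W z) (W z') fun j hj => hWW' j (le_of_lt hj)]

lemma exists_transportRoot_eq_ofReal (hW : PartialExtension C₇ δ fρ fπ a b d W)
    (h : TransportData M L C₆ C₇ δ fρ fπ a b) (k : Fin d) {x : Fin d → ℝ} (hx : x ∈ cube d) :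
    ∃ y : ℝ, 0 < y ∧ transportRoot a b W k (toComplex x) = y := by
  have hTx := (transport_mem_and_condCDF h.hasCondCDF_source h.hasCondCDF_target hx).1
  have hsqrt : ∀ {s : ℝ}, 0 < s → (s : ℂ).sqrt = √s := fun hs =>
    Complex.sqrt_of_nonneg (Complex.zero_le_real.2 hs.le)
  have hρpos := fun l => h.source.marginal_pos h.M_pos h.radius_pos l hx
  have hπpos := fun l => h.target.marginal_pos h.M_pos h.radius_pos l hTx
  have hWx : W (toComplex x) = toComplex (transport fρ fπ x) := hW.apply_toComplex x hx
  refine ⟨√(marginal fρ (k + 1) x) * √(marginal fπ k (transport fρ fπ x)) /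
    (√(marginal fρ k x) * √(marginal fπ (k + 1) (transport fρ fπ x))), ?_, ?_⟩
  · exact div_pos (mul_pos (Real.sqrt_pos.2 (hρpos _)) (Real.sqrt_pos.2 (hπpos _)))
      (mul_pos (Real.sqrt_pos.2 (hρpos _)) (Real.sqrt_pos.2 (hπpos _)))
  · rw [transportRoot, hWx, h.source.ofReal _ x hx, h.source.ofReal _ x hx,
      h.target.ofReal _ _ hTx, h.target.ofReal _ _ hTx, hsqrt (hρpos _), hsqrt (hρpos _),
      hsqrt (hπpos _), hsqrt (hπpos _)]
    push_cast
    rfl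

lemma transport_eq_segPrimitive (hW : PartialExtension C₇ δ fρ fπ a b d W)
    (h : TransportData M L C₆ C₇ δ fρ fπ a b) (k : Fin d) {x : Fin d → ℝ} (hx : x ∈ cube d) :
    (transport fρ fπ x k : ℂ) =
      -1 + segPrimitive k (fun z => transportRoot a b W k z ^ 2) (toComplex x) := by
  have hxD := toComplex_mem_complexNhd h.smallRadius_pos hx
  have hsq := (hW.contDiffOn_transportRoot h k).pow 2
  have hmem : MapsTo Complex.ofReal (uIcc (-1 : ℝ) (x k)) (intervalNhd (C₇ * δ k)) := by
    intro t ht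
    rw [uIcc_of_le (hx k).1] at ht
    exact ofReal_mem_intervalNhd (h.smallRadius_pos k) ⟨ht.1, ht.2.trans (hx k).2⟩
  have hderiv : ∀ t ∈ uIcc (-1 : ℝ) (x k), HasDerivAt
      (fun t : ℝ => W (Function.update (toComplex x) k (t : ℂ)) k)
      (transportRoot a b W k (Function.update (toComplex x) k (t : ℂ)) ^ 2) t := by
    intro t ht
    have := hW.hasDerivAt_apply_update h k (update_mem_complexNhd hxD (hmem ht))
    simp only [Function.update_idem, Function.update_self] at this
    exact this.comp_ofReal
  have hprimitive := segPrimitive_ofReal (k := k) h.smallRadius_pos hsq hxD (hx k)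
  have hself : Function.update (toComplex x) k (x k : ℂ) = toComplex x :=
    Function.update_eq_self _ _
  have happly : ∀ y ∈ cube d, W (toComplex y) k = transport fρ fπ y k := fun y hy =>
    congrFun (hW.apply_toComplex y hy) k
  rw [intervalIntegral.integral_eq_sub_of_hasDerivAt hderiv
    ((continuousOn_comp_update hsq.continuousOn hxD k).comp
      Complex.continuous_ofReal.continuousOn hmem).intervalIntegrable, hself, ← toComplex_update,
    happly x hx, happly _ (update_mem_cube hx (by norm_num)),
    transport_update_neg_one h.hasCondCDF_source h.hasCondCDF_target hx] at hprimitive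
  rw [hprimitive]
  push_cast
  ring

end PartialExtension

theorem TransportData.exists_rootExtension {M L C₆ C₇ : ℝ} {δ : Fin d → ℝ}
    {fρ fπ : (Fin d → ℝ) → ℝ} {a b : ℕ → (Fin d → ℂ) → ℂ}
    (h : TransportData M L C₆ C₇ δ fρ fπ a b) (k : Fin d) :
    ∃ R, RootExtension (fun j => C₇ * δ j) (transport fρ fπ) k R := by
  obtain ⟨W, hW⟩ := h.exists_partialExtension le_rfl
  exact ⟨transportRoot a b W k,
    { contDiffOn := hW.contDiffOn_transportRoot h k
      bounded := ⟨L / (M / 2), fun _ => hW.norm_transportRoot_le h k⟩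
      triangular := fun _ hz _ hz' => hW.transportRoot_congr h hz hz'
      pos := fun _ => hW.exists_transportRoot_eq_ofReal h k
      formula := fun _ => hW.transport_eq_segPrimitive h k
      apply_one := fun _ hx =>
        transport_update_one h.hasCondCDF_source h.hasCondCDF_target hx k }⟩

end RootExtension

/-! ### Rational maps -/

section RationalMap

variable {d : ℕ} {k : Fin d}

/-- The component `k` of `rationalMap p`, as a function of the single polynomial `p k`. -/
def rationalComponent (k : Fin d) (p : MvPolynomial (Fin ((k : ℕ) + 1)) ℝ) (x : Fin d → ℝ) : ℝ :=
  -1 + 2 / squareIntegral k p x 1 * squareIntegral k p x (x k)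

lemma rationalMap_apply (p : (k : Fin d) → MvPolynomial (Fin ((k : ℕ) + 1)) ℝ) (x : Fin d → ℝ)
    (k : Fin d) : rationalMap p x k = rationalComponent k (p k) x := rfl

lemma rationalComponent_zero (k : Fin d) (x : Fin d → ℝ) : rationalComponent k 0 x = x k := by
  simp only [rationalComponent, squareIntegral, map_zero, add_zero, one_pow,
    intervalIntegral.integral_const, smul_eq_mul, mul_one]
  ring

lemma squareIntegral_neg_one (k : Fin d) (p : MvPolynomial (Fin ((k : ℕ) + 1)) ℝ)
    (x : Fin d → ℝ) : squareIntegral k p x (-1) = 0 :=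
  intervalIntegral.integral_same

lemma squareIntegral_congr (p : MvPolynomial (Fin ((k : ℕ) + 1)) ℝ) {x y : Fin d → ℝ}
    (h : ∀ j < k, x j = y j) (s : ℝ) : squareIntegral k p x s = squareIntegral k p y s := by
  have hseg : ∀ t, initialSegment k (Function.update x k t) =
      initialSegment k (Function.update y k t) := by
    intro t
    ext j
    simp only [initialSegment]
    rcases eq_or_ne (Fin.castLE k.isLt j) k with hjk | hjk
    · rw [hjk, Function.update_self, Function.update_self]
    · rw [Function.update_of_ne hjk, Function.update_of_ne hjk]
      exact h _ (lt_of_le_of_ne (Fin.le_def.2 (Nat.lt_succ_iff.1 j.isLt)) hjk)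
  simp only [squareIntegral, hseg]

lemma rationalComponent_update (k : Fin d) (p : MvPolynomial (Fin ((k : ℕ) + 1)) ℝ)
    (x : Fin d → ℝ) (s : ℝ) : rationalComponent k p (Function.update x k s) =
      -1 + 2 / squareIntegral k p x 1 * squareIntegral k p x s := by
  have h : ∀ j < k, Function.update x k s j = x j := fun j hj => Function.update_of_ne hj.ne _ _
  rw [rationalComponent, Function.update_self, squareIntegral_congr p h, squareIntegral_congr p h]

lemma continuous_squareIntegrand (k : Fin d) (p : MvPolynomial (Fin ((k : ℕ) + 1)) ℝ)
    (x : Fin d → ℝ) : Continuous fun t : ℝ =>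
      (1 + MvPolynomial.eval (initialSegment k (Function.update x k t)) p) ^ 2 := by
  have hseg : Continuous fun t : ℝ => initialSegment k (Function.update x k t) :=
    continuous_pi fun j =>
      (continuous_apply (Fin.castLE k.isLt j)).comp (continuous_const.update k continuous_id)
  exact (continuous_const.add ((MvPolynomial.continuous_eval p).comp hseg)).pow 2

lemma continuous_squareIntegral (k : Fin d) (p : MvPolynomial (Fin ((k : ℕ) + 1)) ℝ)
    (x : Fin d → ℝ) : Continuous (squareIntegral k p x) :=
  intervalIntegral.continuous_primitive
    (fun _ _ => (continuous_squareIntegrand k p x).intervalIntegrable _ _) (-1)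

lemma strictMonoOn_squareIntegral {p : MvPolynomial (Fin ((k : ℕ) + 1)) ℝ}
    (hp : ∀ x ∈ cube d, 0 < 1 + MvPolynomial.eval (initialSegment k x) p) {x : Fin d → ℝ}
    (hx : x ∈ cube d) : StrictMonoOn (squareIntegral k p x) (Icc (-1) 1) := by
  intro s hs t ht hst
  have hint := (continuous_squareIntegrand k p x).intervalIntegrable (μ := volume)
  have hpos := intervalIntegral.intervalIntegral_pos_of_pos_on (hint s t)
    (fun u hu => pow_pos (hp _ (update_mem_cube hx
      ⟨hs.1.trans hu.1.le, hu.2.le.trans ht.2⟩)) 2) hst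
  have hadd := intervalIntegral.integral_add_adjacent_intervals (hint (-1) s) (hint s t)
  simp only [squareIntegral]
  linarith

lemma squareIntegral_one_pos {p : MvPolynomial (Fin ((k : ℕ) + 1)) ℝ}
    (hp : ∀ x ∈ cube d, 0 < 1 + MvPolynomial.eval (initialSegment k x) p) {x : Fin d → ℝ}
    (hx : x ∈ cube d) : 0 < squareIntegral k p x 1 :=
  squareIntegral_neg_one k p x ▸
    strictMonoOn_squareIntegral hp hx (by norm_num) (by norm_num) (by norm_num : (-1 : ℝ) < 1)

theorem isMonotoneTriangularBijection_rationalMap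
    {p : (k : Fin d) → MvPolynomial (Fin ((k : ℕ) + 1)) ℝ}
    (hp : ∀ k, ∀ x ∈ cube d, 0 < 1 + MvPolynomial.eval (initialSegment k x) (p k)) :
    IsMonotoneTriangularBijection (rationalMap p) := by
  refine isMonotoneTriangularBijection_of_endpoints (fun k x _ y _ hxy => ?_)
    (fun k x hx s hs t ht hst => ?_) (fun k x _ => ?_) (fun k x _ => ?_) (fun k x hx => ?_) <;>
  simp only [rationalMap_apply, rationalComponent_update]
  · have h : ∀ j < k, x j = y j := fun j hj => hxy j hj.le
    simp only [rationalComponent, squareIntegral_congr (p k) h, hxy k le_rfl]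
  · gcongr
    · exact div_pos two_pos (squareIntegral_one_pos (hp k) hx)
    · exact strictMonoOn_squareIntegral (hp k) hx hs ht hst
  · exact (continuous_const.add
      (continuous_const.mul (continuous_squareIntegral k (p k) x))).continuousOn
  · rw [squareIntegral_neg_one, mul_zero, add_zero]
  · rw [div_mul_cancel₀ _ (squareIntegral_one_pos (hp k) hx).ne']
    norm_num

lemma contDiff_aeval {n : ℕ} (p : MvPolynomial (Fin n) ℝ) :
    ContDiff ℂ 1 fun z : Fin n → ℂ => MvPolynomial.aeval z p := by
  induction p using MvPolynomial.induction_on with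
  | C a => simpa using contDiff_const
  | add p q hp hq => simpa using hp.add hq
  | mul_X p j hp => simpa using hp.mul (contDiff_apply ℂ ℂ j)

/-- The function `1 + p` of the first `k + 1` variables, extended to complex arguments. -/
def shiftedEval (k : Fin d) (p : MvPolynomial (Fin ((k : ℕ) + 1)) ℝ) (z : Fin d → ℂ) : ℂ :=
  1 + MvPolynomial.aeval (fun j => z (Fin.castLE k.isLt j)) p

lemma contDiff_shiftedEval (k : Fin d) (p : MvPolynomial (Fin ((k : ℕ) + 1)) ℝ) :
    ContDiff ℂ 1 (shiftedEval k p) := by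
  have hseg : ContDiff ℂ 1 fun (z : Fin d → ℂ) (j : Fin ((k : ℕ) + 1)) => z (Fin.castLE k.isLt j) :=
    contDiff_pi.2 fun j => contDiff_apply ℂ ℂ _
  exact contDiff_const.add ((contDiff_aeval p).comp hseg)

lemma shiftedEval_toComplex (k : Fin d) (p : MvPolynomial (Fin ((k : ℕ) + 1)) ℝ)
    (x : Fin d → ℝ) : shiftedEval k p (toComplex x) =
      ((1 + MvPolynomial.eval (initialSegment k x) p : ℝ) : ℂ) := by
  rw [Complex.ofReal_add, Complex.ofReal_one]
  exact congrArg (1 + ·) (MvPolynomial.aeval_algebraMap_apply ℂ (initialSegment k x) p)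

lemma segPrimitive_shiftedEval_sq (p : MvPolynomial (Fin ((k : ℕ) + 1)) ℝ) {x : Fin d → ℝ}
    (hx : x ∈ cube d) {s : ℝ} (hs : s ∈ Icc (-1 : ℝ) 1) :
    segPrimitive k (fun z => shiftedEval k p z ^ 2) (Function.update (toComplex x) k s) =
      (squareIntegral k p x s : ℂ) := by
  have hδ : ∀ _ : Fin d, (0 : ℝ) < 1 := fun _ => one_pos
  rw [segPrimitive_ofReal hδ ((contDiff_shiftedEval k p).pow 2).contDiffOn
    (toComplex_mem_complexNhd hδ hx) hs, squareIntegral, ← intervalIntegral.integral_ofReal]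
  simp only [← toComplex_update, shiftedEval_toComplex, Complex.ofReal_pow]

end RationalMap

section NormalizedPrimitive

variable {d : ℕ} {k : Fin d} {δ : Fin d → ℝ} {a b : (Fin d → ℂ) → ℂ} {κ : ℝ}

/-- The primitive of `a` in the coordinate `k`, divided by its value at the right endpoint: for
`a = R²` and `a = (1 + p)²` it is the affine image in `[0,1]` of the component `k` of the transport
and of the rational map. -/
def normalizedPrimitive (k : Fin d) (a : (Fin d → ℂ) → ℂ) (z : Fin d → ℂ) : ℂ :=
  segPrimitive k a z / segPrimitive k a (Function.update z k 1)

lemma rationalComponent_eq_normalizedPrimitive (p : MvPolynomial (Fin ((k : ℕ) + 1)) ℝ)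
    {x : Fin d → ℝ} (hx : x ∈ cube d) : (rationalComponent k p x : ℂ) =
      -1 + 2 * normalizedPrimitive k (fun z => shiftedEval k p z ^ 2) (toComplex x) := by
  have hself := segPrimitive_shiftedEval_sq p hx (hx k)
  have hone := segPrimitive_shiftedEval_sq p hx (s := 1) (by norm_num)
  rw [← toComplex_update, Function.update_eq_self] at hself
  rw [Complex.ofReal_one] at hone
  rw [normalizedPrimitive, hself, hone, rationalComponent]
  push_cast
  ring

lemma one_mem_intervalNhd {r : ℝ} (hr : 0 < r) : (1 : ℂ) ∈ intervalNhd r := by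
  simpa using ofReal_mem_intervalNhd hr (x := 1) (by norm_num)

lemma norm_add_one_le {r : ℝ} (hr : r ≤ 1) {ζ : ℂ} (hζ : ζ ∈ intervalNhd r) : ‖ζ + 1‖ ≤ 4 := by
  obtain ⟨y, hy, hζy⟩ := hζ
  calc ‖ζ + 1‖ = ‖(ζ - y) + ((y + 1 : ℝ) : ℂ)‖ := by push_cast; ring_nf
    _ ≤ r + (y + 1) := norm_add_le_of_le hζy.le (by
      rw [Complex.norm_real, Real.norm_of_nonneg (by linarith [hy.1])])
    _ ≤ 4 := by linarith [hy.2]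

lemma norm_segPrimitive_le (hδ : ∀ j, 0 < δ j) (ha : ContDiffOn ℂ 1 a (complexNhd δ))
    (hκ : ∀ z ∈ complexNhd δ, ‖a z‖ ≤ κ) {z : Fin d → ℂ} (hz : z ∈ complexNhd δ) :
    ‖segPrimitive k a z‖ ≤ κ * ‖z k + 1‖ := by
  have hneg : (-1 : ℂ) ∈ intervalNhd (δ k) := by
    simpa using ofReal_mem_intervalNhd (hδ k) (x := -1) (by norm_num)
  simpa only [segPrimitive_neg_one, Function.update_eq_self, sub_zero, sub_neg_eq_add] using
    norm_segPrimitive_sub_le hδ ha hκ hz (hz k) hneg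

lemma segPrimitive_sub (hδ : ∀ j, 0 < δ j) (ha : ContinuousOn a (complexNhd δ))
    (hb : ContinuousOn b (complexNhd δ)) {z : Fin d → ℂ} (hz : z ∈ complexNhd δ) :
    segPrimitive k (fun w => a w - b w) z = segPrimitive k a z - segPrimitive k b z := by
  have hint : ∀ {c : (Fin d → ℂ) → ℂ}, ContinuousOn c (complexNhd δ) →
      IntegrableOn (fun r : ℝ => c (Function.update z k (-1 + r * (z k + 1)))) (Icc 0 1) :=
    fun hc => ContinuousOn.integrableOn_compact isCompact_Icc <|
      (continuousOn_comp_update hc hz k).comp (f := fun r : ℝ => -1 + (r : ℂ) * (z k + 1))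
        (by fun_prop) fun _ => segment_mem_intervalNhd (hδ k) (hz k)
  simp only [segPrimitive, integral_sub (hint ha) (hint hb), mul_sub]

lemma norm_segPrimitive_sub_segPrimitive_le (hδ : ∀ j, 0 < δ j)
    (ha : ContDiffOn ℂ 1 a (complexNhd δ)) (hb : ContDiffOn ℂ 1 b (complexNhd δ))
    (hab : ∀ z ∈ complexNhd δ, ‖a z - b z‖ ≤ κ) {z : Fin d → ℂ} (hz : z ∈ complexNhd δ) :
    ‖segPrimitive k a z - segPrimitive k b z‖ ≤ κ * ‖z k + 1‖ := by
  rw [← segPrimitive_sub hδ ha.continuousOn hb.continuousOn hz]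
  exact norm_segPrimitive_le hδ (ha.sub hb) hab hz

lemma contDiffOn_normalizedPrimitive (hδ : ∀ j, 0 < δ j) (ha : ContDiffOn ℂ 1 a (complexNhd δ))
    (hne : ∀ z ∈ complexNhd δ, segPrimitive k a (Function.update z k 1) ≠ 0) :
    ContDiffOn ℂ 1 (normalizedPrimitive k a) (complexNhd δ) := by
  have hupdate : ContDiff ℂ 1 fun z : Fin d → ℂ => Function.update z k 1 :=
    (contDiff_update_pair k).comp (contDiff_id.prodMk contDiff_const)
  have hP := contDiffOn_segPrimitive hδ ha k
  exact hP.div (hP.comp hupdate.contDiffOn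
    fun z hz => update_mem_complexNhd hz (one_mem_intervalNhd (hδ k))) hne

lemma norm_div_sub_div_le {𝕜 : Type*} [NormedField 𝕜] {a b c e : 𝕜} (hc : c ≠ 0) (he : e ≠ 0) :
    ‖a / c - b / e‖ ≤ (‖a / c‖ * ‖c - e‖ + ‖a - b‖) / ‖e‖ := by
  have hsplit : a / c - b / e = (a / c * (e - c) + (a - b)) / e := by
    field_simp
    ring
  rw [hsplit, norm_div, norm_sub_rev c e, ← norm_mul]
  gcongr
  exact norm_add_le _ _

variable {r A : ℝ}

lemma half_le_norm_segPrimitive_update_one (hr : 0 < r) (hr1 : r ≤ 1)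
    (ha : ContDiffOn ℂ 1 a (complexNhd fun _ => r)) (hb : ContDiffOn ℂ 1 b (complexNhd fun _ => r))
    (hab : ∀ z ∈ complexNhd (fun _ => r), ‖a z - b z‖ ≤ κ) (hκ : 8 * κ ≤ 1) {z : Fin d → ℂ}
    (hz : z ∈ complexNhd fun _ => r)
    (hone : 1 ≤ ‖segPrimitive k a (Function.update z k 1)‖) :
    1 / 2 ≤ ‖segPrimitive k b (Function.update z k 1)‖ := by
  have hz' := update_mem_complexNhd (k := k) hz (one_mem_intervalNhd hr)
  have hκ0 : 0 ≤ κ := (norm_nonneg _).trans (hab z hz)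
  have hdiff := norm_segPrimitive_sub_segPrimitive_le (k := k) (fun _ => hr) ha hb hab hz'
  have hlen := mul_le_mul_of_nonneg_left (norm_add_one_le hr1 (hz' k)) hκ0
  linarith [norm_sub_norm_le (segPrimitive k a (Function.update z k 1))
    (segPrimitive k b (Function.update z k 1))]

theorem norm_normalizedPrimitive_sub_le (hr : 0 < r) (hr1 : r ≤ 1)
    (ha : ContDiffOn ℂ 1 a (complexNhd fun _ => r)) (hb : ContDiffOn ℂ 1 b (complexNhd fun _ => r))
    (hA : ∀ z ∈ complexNhd (fun _ => r), ‖a z‖ ≤ A)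
    (hab : ∀ z ∈ complexNhd (fun _ => r), ‖a z - b z‖ ≤ κ) (hκ : 8 * κ ≤ 1) {z : Fin d → ℂ}
    (hz : z ∈ complexNhd fun _ => r)
    (hone : 1 ≤ ‖segPrimitive k a (Function.update z k 1)‖) :
    ‖normalizedPrimitive k a z - normalizedPrimitive k b z‖ ≤ 8 * (4 * A + 1) * κ := by
  have hδ : ∀ _ : Fin d, 0 < r := fun _ => hr
  have hA0 : 0 ≤ A := (norm_nonneg _).trans (hA z hz)
  have hκ0 : 0 ≤ κ := (norm_nonneg _).trans (hab z hz)
  have hhalf := half_le_norm_segPrimitive_update_one hr hr1 ha hb hab hκ hz hone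
  have hdiff : ∀ w ∈ complexNhd (fun _ => r),
      ‖segPrimitive k a w - segPrimitive k b w‖ ≤ κ * 4 := fun w hw =>
    (norm_segPrimitive_sub_segPrimitive_le hδ ha hb hab hw).trans
      (mul_le_mul_of_nonneg_left (norm_add_one_le hr1 (hw k)) hκ0)
  have hquot : ‖segPrimitive k a z / segPrimitive k a (Function.update z k 1)‖ ≤ A * 4 := by
    rw [norm_div]
    exact (div_le_self (norm_nonneg _) hone).trans ((norm_segPrimitive_le hδ ha hA hz).trans
      (mul_le_mul_of_nonneg_left (norm_add_one_le hr1 (hz k)) hA0))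
  refine (norm_div_sub_div_le (norm_pos_iff.1 (one_pos.trans_le hone))
    (norm_pos_iff.1 (one_half_pos.trans_le hhalf))).trans ?_
  calc _ ≤ (A * 4 * (κ * 4) + κ * 4) / (1 / 2) := by
        gcongr
        · exact hdiff _ (update_mem_complexNhd hz (one_mem_intervalNhd hr))
        · exact hdiff z hz
    _ = 8 * (4 * A + 1) * κ := by ring

end NormalizedPrimitive

/-! ### Approximation of triangular maps -/

section ZeroExtend

variable {d : ℕ} {k : Fin d} {R : Type*} [Zero R]

/-- The extension by zero of a vector of length `k + 1`, a right inverse of `initialSegment`. -/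
def zeroExtend (k : Fin d) (z : Fin ((k : ℕ) + 1) → R) : Fin d → R :=
  fun j => if h : (j : ℕ) < k + 1 then z ⟨j, h⟩ else 0

lemma contDiff_zeroExtend (k : Fin d) :
    ContDiff ℂ 1 (zeroExtend k : (Fin ((k : ℕ) + 1) → ℂ) → Fin d → ℂ) := by
  refine contDiff_pi.2 fun j => ?_
  simp only [zeroExtend]
  split_ifs
  · exact contDiff_apply ℂ ℂ _
  · exact contDiff_const

lemma zeroExtend_mem_complexNhd {η : Fin d → ℝ} (hη : ∀ j, 0 < η j) {z : Fin ((k : ℕ) + 1) → ℂ}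
    (hz : z ∈ complexNhd (initialSegment k η)) : zeroExtend k z ∈ complexNhd η := by
  intro j
  simp only [zeroExtend]
  split_ifs with h
  · exact hz ⟨j, h⟩
  · exact ⟨0, by norm_num, by simpa using hη j⟩

lemma zeroExtend_mem_cube {x : Fin ((k : ℕ) + 1) → ℝ} (hx : x ∈ cube (k + 1)) :
    zeroExtend k x ∈ cube d := by
  intro j
  simp only [zeroExtend]
  split_ifs
  · exact hx _
  · norm_num

lemma zeroExtend_toComplex (x : Fin ((k : ℕ) + 1) → ℝ) :
    zeroExtend k (toComplex x) = toComplex (zeroExtend k x) := by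
  ext j
  simp only [zeroExtend, toComplex]
  split_ifs <;> simp

lemma zeroExtend_castLE_apply (z : Fin d → R) {j : Fin d} (hj : j ≤ k) :
    zeroExtend k (fun i => z (Fin.castLE k.isLt i)) j = z j := by
  simp only [zeroExtend, Nat.lt_succ_iff.2 (Fin.le_def.1 hj), ↓reduceDIte, Fin.castLE_mk, Fin.eta]

end ZeroExtend

lemma norm_sq_sub_sq_le {𝕜 : Type*} [NormedField 𝕜] {x y : 𝕜} {B e : ℝ} (hx : ‖x‖ ≤ B)
    (hxy : ‖x - y‖ ≤ e) : ‖x ^ 2 - y ^ 2‖ ≤ (2 * B + e) * e := by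
  have hsum : ‖x + y‖ ≤ 2 * B + e := by
    have hsplit : x + y = x + x - (x - y) := by ring
    rw [hsplit, two_mul]
    exact norm_sub_le_of_le (norm_add_le_of_le hx hx) hxy
  rw [sq_sub_sq, norm_mul]
  exact mul_le_mul hsum hxy (norm_nonneg _) ((norm_nonneg _).trans hsum)

theorem contDiffOn_and_norm_normalizedPrimitive_sq_sub_le {d : ℕ} {k : Fin d}
    {f g : (Fin d → ℂ) → ℂ} {r B e : ℝ} (hr : 0 < r) (hr1 : r ≤ 1)
    (hf : ContDiffOn ℂ 1 f (complexNhd fun _ => r)) (hg : ContDiffOn ℂ 1 g (complexNhd fun _ => r))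
    (hB : ∀ z ∈ complexNhd (fun _ => r), ‖f z‖ ≤ B)
    (hfg : ∀ z ∈ complexNhd (fun _ => r), ‖f z - g z‖ ≤ e) (he1 : e ≤ 1)
    (he : 8 * ((2 * B + 1) * e) ≤ 1)
    (hone : ∀ z ∈ complexNhd (fun _ => r),
      1 ≤ ‖segPrimitive k (fun w => f w ^ 2) (Function.update z k 1)‖) :
    ContDiffOn ℂ 1 (fun z => normalizedPrimitive k (fun w => f w ^ 2) z -
      normalizedPrimitive k (fun w => g w ^ 2) z) (complexNhd fun _ => r) ∧
    ∀ z ∈ complexNhd (fun _ => r), ‖normalizedPrimitive k (fun w => f w ^ 2) z -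
      normalizedPrimitive k (fun w => g w ^ 2) z‖ ≤ 8 * (4 * B ^ 2 + 1) * ((2 * B + 1) * e) := by
  have hfB : ∀ z ∈ complexNhd (fun _ => r), ‖f z ^ 2‖ ≤ B ^ 2 := fun z hz => by
    rw [norm_pow]
    exact pow_le_pow_left₀ (norm_nonneg _) (hB z hz) 2
  have hsq : ∀ z ∈ complexNhd (fun _ => r), ‖f z ^ 2 - g z ^ 2‖ ≤ (2 * B + 1) * e :=
    fun z hz => (norm_sq_sub_sq_le (hB z hz) (hfg z hz)).trans
      (mul_le_mul_of_nonneg_right (by linarith) ((norm_nonneg _).trans (hfg z hz)))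
  refine ⟨(contDiffOn_normalizedPrimitive (fun _ => hr) (hf.pow 2) fun z hz =>
      norm_pos_iff.1 (one_pos.trans_le (hone z hz))).sub
    (contDiffOn_normalizedPrimitive (fun _ => hr) (hg.pow 2) fun z hz =>
      norm_pos_iff.1 (one_half_pos.trans_le (half_le_norm_segPrimitive_update_one hr hr1
        (hf.pow 2) (hg.pow 2) hsq he hz (hone z hz)))), fun z hz => ?_⟩
  exact norm_normalizedPrimitive_sub_le hr hr1 (hf.pow 2) (hg.pow 2) hfB hsq he hz (hone z hz)

namespace RootExtension

variable {d : ℕ} {η : Fin d → ℝ} {T : (Fin d → ℝ) → (Fin d → ℝ)} {k : Fin d}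
  {R : (Fin d → ℂ) → ℂ}

lemma comp_zeroExtend_castLE (h : RootExtension η T k R) (hη : ∀ j, 0 < η j) {z : Fin d → ℂ}
    (hz : z ∈ complexNhd η) : R (zeroExtend k fun i => z (Fin.castLE k.isLt i)) = R z :=
  h.triangular _ (zeroExtend_mem_complexNhd hη fun _ => hz _) _ hz
    fun _ hi => zeroExtend_castLE_apply z hi

lemma exists_norm_sub_shiftedEval_le (h : RootExtension η T k R) (hη : ∀ j, 0 < η j) {τ : ℝ}
    (hτ0 : 0 < τ) (hτ1 : τ < 1) :
    ∃ r > (0 : ℝ), ∃ K : ℝ, 0 ≤ K ∧ ∀ ℓ : ℝ, 0 ≤ ℓ →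
      ∃ p ∈ MvPolynomial.restrictSupport ℝ
          (weightedSimplex (initialSegment k fun j => 1 + η j) ℓ),
        ∀ z ∈ complexNhd (fun _ : Fin d => r),
          ‖R z - shiftedEval k p z‖ ≤ K * Real.exp (-(τ * ℓ)) := by
  obtain ⟨B, hB⟩ := h.bounded
  obtain ⟨C, hC, r, hr, -, happrox⟩ := exists_polynomialApproxBound hτ0 hτ1
    (initialSegment k fun j => 1 + η j) fun j => by simpa [initialSegment] using hη _
  obtain ⟨r', hr', hsub⟩ := exists_complexNhd_const_subset (isOpen_complexNhd η)
    fun x hx => toComplex_mem_complexNhd hη hx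
  have hradius : (fun j => initialSegment k (fun j => 1 + η j) j - 1) = initialSegment k η := by
    ext j
    simp [initialSegment]
  rw [PolynomialApproxBound, hradius] at happrox
  have hB0 : 0 ≤ B := (norm_nonneg _).trans
    (hB (toComplex 0) (toComplex_mem_complexNhd hη fun _ => by simp))
  refine ⟨min r r', lt_min hr hr', C * (B + 1), by positivity, fun ℓ hℓ => ?_⟩
  obtain ⟨p, hp, happ⟩ := happrox (fun z => R (zeroExtend k z) - 1) (B + 1)
    ((h.contDiffOn.comp (contDiff_zeroExtend k).contDiffOn
      fun z hz => zeroExtend_mem_complexNhd hη hz).sub contDiffOn_const)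
    (fun z hz => norm_sub_le_of_le (hB _ (zeroExtend_mem_complexNhd hη hz)) norm_one.le)
    (fun x hx => by
      obtain ⟨y, -, hy⟩ := h.pos (zeroExtend k x) (zeroExtend_mem_cube hx)
      exact ⟨y - 1, by rw [zeroExtend_toComplex, hy, Complex.ofReal_sub, Complex.ofReal_one]⟩) ℓ hℓ
  refine ⟨p, hp, fun z hz => ?_⟩
  have hseg : (fun i : Fin ((k : ℕ) + 1) => z (Fin.castLE k.isLt i)) ∈ complexNhd fun _ => r :=
    fun i => complexNhd_mono (fun _ => min_le_left r r') hz (Fin.castLE k.isLt i)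
  rw [← h.comp_zeroExtend_castLE hη (hsub (complexNhd_mono (fun _ => min_le_right r r') hz)),
    shiftedEval, ← sub_sub]
  exact happ _ hseg

lemma segPrimitive_one (h : RootExtension η T k R) {x : Fin d → ℝ} (hx : x ∈ cube d) :
    segPrimitive k (fun z => R z ^ 2) (Function.update (toComplex x) k 1) = 2 := by
  have hformula := h.formula _ (update_mem_cube (k := k) hx (s := 1) (by norm_num))
  rw [h.apply_one x hx, toComplex_update] at hformula
  push_cast at hformula
  linear_combination -hformula

lemma eq_normalizedPrimitive (h : RootExtension η T k R) {x : Fin d → ℝ} (hx : x ∈ cube d) :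
    (T x k : ℂ) = -1 + 2 * normalizedPrimitive k (fun z => R z ^ 2) (toComplex x) := by
  rw [normalizedPrimitive, h.segPrimitive_one hx, h.formula x hx,
    mul_div_cancel₀ _ (two_ne_zero (α := ℂ))]

lemma exists_pos_le_re (h : RootExtension η T k R) (hη : ∀ j, 0 < η j) :
    ∃ c > (0 : ℝ), ∀ x ∈ cube d, c ≤ (R (toComplex x)).re := by
  have hcont : ContinuousOn (fun x => (R (toComplex x)).re) (cube d) :=
    Complex.continuous_re.comp_continuousOn (h.contDiffOn.continuousOn.comp
      continuous_toComplex.continuousOn fun x hx => toComplex_mem_complexNhd hη hx)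
  obtain ⟨x₀, hx₀, hmin⟩ := (isCompact_cube d).exists_isMinOn ⟨0, fun _ => by simp⟩ hcont
  refine ⟨_, ?_, fun x hx => hmin hx⟩
  obtain ⟨y, hy, hRy⟩ := h.pos x₀ hx₀
  simpa [hRy] using hy

lemma exists_pos_one_add_eval (h : RootExtension η T k R) (hη : ∀ j, 0 < η j) :
    ∃ e₀ > (0 : ℝ), ∀ p : MvPolynomial (Fin ((k : ℕ) + 1)) ℝ, ∀ x ∈ cube d,
      ‖R (toComplex x) - shiftedEval k p (toComplex x)‖ ≤ e₀ →
      0 < 1 + MvPolynomial.eval (initialSegment k x) p := by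
  obtain ⟨c, hc, hcR⟩ := h.exists_pos_le_re hη
  refine ⟨c / 2, half_pos hc, fun p x hx hp => ?_⟩
  have hre := (Complex.re_le_norm _).trans hp
  rw [shiftedEval_toComplex, Complex.sub_re, Complex.ofReal_re] at hre
  linarith [hcR x hx]

lemma exists_one_le_norm_segPrimitive_update_one (h : RootExtension η T k R)
    (hη : ∀ j, 0 < η j) {r : ℝ} (hr : 0 < r) :
    ∃ s > 0, s ≤ r ∧ s ≤ 1 ∧ complexNhd (fun _ : Fin d => s) ⊆ complexNhd η ∧
      ∀ z ∈ complexNhd (fun _ : Fin d => s),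
        1 ≤ ‖segPrimitive k (fun z => R z ^ 2) (Function.update z k 1)‖ := by
  have hupdate : Continuous fun z : Fin d → ℂ => Function.update z k 1 :=
    continuous_id.update k continuous_const
  have hcont : ContinuousOn (fun z => segPrimitive k (fun z => R z ^ 2) (Function.update z k 1))
      (complexNhd η) :=
    (contDiffOn_segPrimitive hη (h.contDiffOn.pow 2) k).continuousOn.comp hupdate.continuousOn
      fun z hz => update_mem_complexNhd hz (one_mem_intervalNhd (hη k))
  obtain ⟨s, hs, hsub⟩ := exists_complexNhd_const_subset
    (hcont.isOpen_inter_preimage (isOpen_complexNhd η) (isOpen_ball (x := 2) (ε := 1)))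
    fun x hx => ⟨toComplex_mem_complexNhd hη hx, by
      rw [mem_preimage, h.segPrimitive_one hx]
      exact mem_ball_self one_pos⟩
  have hsub' := (complexNhd_mono (δ := fun _ : Fin d => min s (min r 1))
    fun _ => min_le_left s _).trans hsub
  refine ⟨min s (min r 1), lt_min hs (lt_min hr one_pos),
    (min_le_right _ _).trans (min_le_left _ _), (min_le_right _ _).trans (min_le_right _ _),
    fun z hz => (hsub' hz).1, fun z hz => ?_⟩
  have hnear := mem_ball_iff_norm'.1 (hsub' hz).2
  have htriangle := norm_sub_norm_le (2 : ℂ)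
    (segPrimitive k (fun z => R z ^ 2) (Function.update z k 1))
  rw [Complex.norm_ofNat] at htriangle
  linarith

lemma exists_sobolevNorm_sub_rationalComponent_le (h : RootExtension η T k R)
    (hη : ∀ j, 0 < η j) (m : ℕ) {r : ℝ} (hr : 0 < r) :
    ∃ C : ℝ, 0 ≤ C ∧ ∃ e₀ > (0 : ℝ),
      ∀ (e : ℝ) (p : MvPolynomial (Fin ((k : ℕ) + 1)) ℝ), e ≤ e₀ →
      (∀ z ∈ complexNhd (fun _ : Fin d => r), ‖R z - shiftedEval k p z‖ ≤ e) →
      sobolevNorm m (fun x => T x k - rationalComponent k p x) ≤ ENNReal.ofReal (C * e) := by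
  obtain ⟨B, hB⟩ := h.bounded
  have hB0 : 0 ≤ B := (norm_nonneg _).trans
    (hB (toComplex 0) (toComplex_mem_complexNhd hη fun _ => by simp))
  obtain ⟨s, hs0, hsr, hs1, hsη, hone⟩ := h.exists_one_le_norm_segPrimitive_update_one hη hr
  obtain ⟨C, hC, hsobolev⟩ := exists_sobolevNorm_le (d := d) m hs0
  refine ⟨C * (2 * (8 * (4 * B ^ 2 + 1) * (2 * B + 1))), by positivity,
    min 1 (1 / (8 * (2 * B + 1))), by positivity, fun e p he hp => ?_⟩
  have hκ : 8 * ((2 * B + 1) * e) ≤ 1 := by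
    rw [← mul_assoc, mul_comm, ← le_div_iff₀ (by positivity)]
    exact he.trans (min_le_right _ _)
  obtain ⟨hdiff, hnorm⟩ := contDiffOn_and_norm_normalizedPrimitive_sq_sub_le hs0 hs1
    (h.contDiffOn.mono hsη) (contDiff_shiftedEval k p).contDiffOn (fun z hz => hB z (hsη hz))
    (fun z hz => hp z (complexNhd_mono (fun _ => hsr) hz)) (he.trans (min_le_left _ _)) hκ hone
  rw [mul_assoc]
  refine hsobolev (fun z => 2 * (normalizedPrimitive k (fun w => R w ^ 2) z -
    normalizedPrimitive k (fun w => shiftedEval k p w ^ 2) z)) _ _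
    (contDiffOn_const.mul hdiff) (fun z hz => ?_) fun x hx => ?_
  · rw [norm_mul, Complex.norm_ofNat, mul_assoc, mul_assoc (8 * _)]
    exact mul_le_mul_of_nonneg_left (hnorm z hz) two_pos.le
  · have hx' := openCube_subset_cube d hx
    rw [← Complex.ofReal_re (T x k - rationalComponent k p x), Complex.ofReal_sub,
      h.eq_normalizedPrimitive hx', rationalComponent_eq_normalizedPrimitive p hx']
    ring_nf

theorem exists_rationalComponent_approx (h : RootExtension η T k R) (hη : ∀ j, 0 < η j) (m : ℕ)
    {τ : ℝ} (hτ0 : 0 < τ) (hτ1 : τ < 1) :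
    ∃ C : ℝ, 0 ≤ C ∧ ∃ ℓ₀ : ℝ, ∀ ℓ : ℝ, ℓ₀ ≤ ℓ →
      ∃ p ∈ MvPolynomial.restrictSupport ℝ
          (weightedSimplex (initialSegment k fun j => 1 + η j) ℓ),
        (∀ x ∈ cube d, 0 < 1 + MvPolynomial.eval (initialSegment k x) p) ∧
        sobolevNorm m (fun x => T x k - rationalComponent k p x) ≤
          ENNReal.ofReal (C * Real.exp (-(τ * ℓ))) := by
  obtain ⟨r, hr, K, hK, happrox⟩ := h.exists_norm_sub_shiftedEval_le hη hτ0 hτ1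
  obtain ⟨C, hC, e₁, he₁, hstable⟩ := h.exists_sobolevNorm_sub_rationalComponent_le hη m hr
  obtain ⟨e₂, he₂, hpos⟩ := h.exists_pos_one_add_eval hη
  have he₀ : 0 < min e₁ e₂ := lt_min he₁ he₂
  refine ⟨C * K, by positivity, K / min e₁ e₂ / τ, fun ℓ hℓ => ?_⟩
  obtain ⟨p, hp, hpR⟩ := happrox ℓ (le_trans (by positivity) hℓ)
  have hsmall : K * Real.exp (-(τ * ℓ)) ≤ min e₁ e₂ := by
    rw [Real.exp_neg, ← div_eq_mul_inv, div_le_iff₀ (Real.exp_pos _)]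
    rw [div_le_iff₀ hτ0, div_le_iff₀ he₀] at hℓ
    nlinarith [mul_le_mul_of_nonneg_left (Real.add_one_le_exp (τ * ℓ)) he₀.le]
  refine ⟨p, hp, fun x hx => hpos p x hx ((hpR _ (toComplex_mem_complexNhd (fun _ => hr) hx)).trans
    (hsmall.trans (min_le_right _ _))), ?_⟩
  rw [mul_assoc]
  exact hstable _ p (hsmall.trans (min_le_left _ _)) hpR

lemma exists_sobolevNorm_sub_coord_le (h : RootExtension η T k R) (hη : ∀ j, 0 < η j) (m : ℕ) :
    ∃ C : ℝ, 0 ≤ C ∧ sobolevNorm m (fun x => T x k - x k) ≤ ENNReal.ofReal C := by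
  obtain ⟨B, hB⟩ := h.bounded
  obtain ⟨r, hr, hsub⟩ := exists_complexNhd_const_subset (isOpen_complexNhd η)
    fun x hx => toComplex_mem_complexNhd hη hx
  have hs0 : 0 < min r 1 := lt_min hr one_pos
  have hsη : complexNhd (fun _ : Fin d => min r 1) ⊆ complexNhd η :=
    (complexNhd_mono fun _ => min_le_left _ _).trans hsub
  have hR : ContDiffOn ℂ 1 (fun z => R z ^ 2) (complexNhd fun _ => min r 1) :=
    (h.contDiffOn.mono hsη).pow 2
  obtain ⟨C, hC, hsobolev⟩ := exists_sobolevNorm_le (d := d) m hs0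
  refine ⟨C * (B ^ 2 * 4 + 4), by positivity,
    hsobolev (fun z => segPrimitive k (fun w => R w ^ 2) z - (z k + 1)) _ _ ?_
      (fun z hz => ?_) fun x hx => ?_⟩
  · exact (contDiffOn_segPrimitive (fun _ => hs0) hR k).sub
      ((contDiff_apply ℂ ℂ k).add contDiff_const).contDiffOn
  · have hlen := norm_add_one_le (min_le_right _ _) (hz k)
    have hprimitive := norm_segPrimitive_le (k := k) (κ := B ^ 2) (fun _ => hs0) hR
      (fun w hw => by
        rw [norm_pow]
        exact pow_le_pow_left₀ (norm_nonneg _) (hB w (hsη hw)) 2) hz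
    exact norm_sub_le_of_le
      (hprimitive.trans (mul_le_mul_of_nonneg_left hlen (sq_nonneg B))) hlen
  · rw [← Complex.ofReal_re (T x k - x k), Complex.ofReal_sub,
      h.formula x (openCube_subset_cube d hx), toComplex]
    ring_nf

lemma exists_rationalComponent_indexSet_approx (h : RootExtension η T k R) (hη : ∀ j, 0 < η j)
    (m : ℕ) {τ : ℝ} (hτ0 : 0 < τ) (hτ1 : τ < 1) :
    ∃ C : ℝ, 0 ≤ C ∧ ∀ ε ∈ Ioo (0 : ℝ) 1,
      ∃ p ∈ MvPolynomial.restrictSupport ℝ (indexSet (fun j => 1 + η j) k ε),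
        (∀ x ∈ cube d, 0 < 1 + MvPolynomial.eval (initialSegment k x) p) ∧
        sobolevNorm m (fun x => T x k - rationalComponent k p x) ≤
          ENNReal.ofReal (C * Real.exp (τ * Real.log ε)) := by
  obtain ⟨A, hA, ℓ₀, happrox⟩ := h.exists_rationalComponent_approx hη m hτ0 hτ1
  obtain ⟨B, hB, hcoord⟩ := h.exists_sobolevNorm_sub_coord_le hη m
  set lk := Real.log (1 + η k)
  refine ⟨A * Real.exp (τ * lk) + B * Real.exp (τ * (ℓ₀ + lk)), by positivity, fun ε hε => ?_⟩
  rcases le_total ℓ₀ (-Real.log ε - lk) with hlarge | hsmall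
  · obtain ⟨p, hp, hpos, hnorm⟩ := happrox _ hlarge
    refine ⟨p, MvPolynomial.restrictSupport_mono ℝ
      (weightedSimplex_subset_indexSet (fun j => by linarith [hη j]) k hε.1) hp, hpos,
      hnorm.trans (ENNReal.ofReal_le_ofReal ?_)⟩
    have hexp : Real.exp (-(τ * (-Real.log ε - lk))) =
        Real.exp (τ * lk) * Real.exp (τ * Real.log ε) := by
      rw [← Real.exp_add]
      ring_nf
    rw [hexp, ← mul_assoc]
    exact mul_le_mul_of_nonneg_right (le_add_of_nonneg_right (by positivity)) (Real.exp_pos _).le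
  · refine ⟨0, Submodule.zero_mem _, fun x _ => by simp, ?_⟩
    simp only [rationalComponent_zero]
    refine hcoord.trans (ENNReal.ofReal_le_ofReal ?_)
    have hexp : 1 ≤ Real.exp (τ * (ℓ₀ + lk)) * Real.exp (τ * Real.log ε) := by
      rw [← Real.exp_add, ← mul_add]
      exact Real.one_le_exp (mul_nonneg hτ0.le (by linarith))
    calc B ≤ B * (Real.exp (τ * (ℓ₀ + lk)) * Real.exp (τ * Real.log ε)) :=
          le_mul_of_one_le_right hB hexp
      _ ≤ _ := by
          rw [← mul_assoc]
          exact mul_le_mul_of_nonneg_right (le_add_of_nonneg_left (by positivity))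
            (Real.exp_pos _).le

end RootExtension

lemma HasRationalApprox.mono {d : ℕ} {ξ : Fin d → ℝ} {m : ℕ} {τ C C' : ℝ}
    {T : (Fin d → ℝ) → (Fin d → ℝ)} (h : HasRationalApprox ξ m τ C T) (hC : C ≤ C') :
    HasRationalApprox ξ m τ C' T := by
  intro ε hε
  obtain ⟨p, hp, hbij, hnorm⟩ := h ε hε
  exact ⟨p, hp, hbij, fun k => (hnorm k).trans (ENNReal.ofReal_le_ofReal
    (mul_le_mul_of_nonneg_right hC (Real.exp_pos _).le))⟩

theorem exists_hasRationalApprox {d : ℕ} (hd : 1 ≤ d) {η : Fin d → ℝ} (hη : ∀ j, 0 < η j)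
    {T : (Fin d → ℝ) → (Fin d → ℝ)} (hT : ∀ k, ∃ R, RootExtension η T k R) (m : ℕ) {τ : ℝ}
    (hτ0 : 0 < τ) (hτ1 : τ < 1) :
    ∃ C > (0 : ℝ), HasRationalApprox (fun j => 1 + η j) m τ C T := by
  choose R hR using hT
  choose A hA happrox using fun k =>
    (hR k).exists_rationalComponent_indexSet_approx hη m hτ0 hτ1
  obtain ⟨K, hK⟩ := exists_rate_mul_totalCard_rpow_le hd (ξ := fun j => 1 + η j)
    fun j => lt_add_of_pos_right 1 (hη j)
  have hA_le : ∀ k, A k ≤ 1 + ∑ j, A j := fun k =>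
    (Finset.single_le_sum (fun j _ => hA j) (Finset.mem_univ k)).trans
      (le_add_of_nonneg_left zero_le_one)
  have hsum : 0 < 1 + ∑ j, A j := by
    linarith [Finset.sum_nonneg fun j (_ : j ∈ Finset.univ) => hA j]
  refine ⟨(1 + ∑ j, A j) * Real.exp (τ * K), mul_pos hsum (Real.exp_pos _), fun ε hε => ?_⟩
  choose p hp hpos hnorm using fun k => happrox k ε hε
  refine ⟨p, hp, isMonotoneTriangularBijection_rationalMap hpos, fun k =>
    (hnorm k).trans (ENNReal.ofReal_le_ofReal ?_)⟩
  rw [mul_assoc, ← Real.exp_add, mul_assoc τ]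
  refine mul_le_mul (hA_le k) (Real.exp_le_exp.2 ?_) (Real.exp_pos _).le hsum.le
  linarith [mul_le_mul_of_nonneg_left (hK ε hε) hτ0.le]

lemma DensityAssumption.exists_transportData {d : ℕ} {M L : ℝ} {δ : Fin d → ℝ}
    {fρ fπ : (Fin d → ℝ) → ℝ}
    (hρ : DensityAssumption M L (M ^ 2 / (200 * L)) δ fρ)
    (hπ : DensityAssumption M L (M ^ 2 / (200 * L)) δ fπ)
    (hM : 0 < M) (hML : M < L) (hδ : ∀ j, 0 < δ j) :
    ∃ a b, TransportData M L (M ^ 2 / (200 * L)) (M ^ 2 / (100 * L ^ 2)) δ fρ fπ a b := by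
  have hL : 0 < L := hM.trans hML
  have hC₆ : M ^ 2 / (200 * L) ≤ M / 200 := by
    rw [div_le_div_iff₀ (by positivity) (by norm_num)]
    nlinarith
  have hC₇ : M ^ 2 / (100 * L ^ 2) ≤ 1 := by
    rw [div_le_one (by positivity)]
    nlinarith
  obtain ⟨a, ha⟩ := hρ.exists_marginalExtension hδ (by positivity) (by linarith)
  obtain ⟨b, hb⟩ := hπ.exists_marginalExtension hδ (by positivity) (by linarith)
  refine ⟨a, b, ha, hb, hδ, hM, by positivity, by positivity, hC₇, ?_⟩
  have hfirst : 2 * L * (L * (M ^ 2 / (100 * L ^ 2)) + 4 * (M ^ 2 / (200 * L))) / M =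
      3 * M / 50 := by
    field_simp
    ring
  rw [hfirst]
  linarith

end KRApprox

end

theorem mainTheorem2 (M L : ℝ) (hM : 0 < M) (hML : M < L) :
    ∃ C₆ > (0 : ℝ), ∃ C₇ > (0 : ℝ),
      ∀ (d : ℕ), 1 ≤ d → ∀ (δ : Fin d → ℝ), (∀ j, 0 < δ j) →
      ∀ (fρ fπ : (Fin d → ℝ) → ℝ),
        KRApprox.DensityAssumption M L C₆ δ fρ → KRApprox.DensityAssumption M L C₆ δ fπ →
        KRApprox.IsMonotoneTriangularBijection (KRApprox.transport fρ fπ) ∧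
        ∀ (m : ℕ) (τ : ℝ), 0 < τ → τ < 1 →
          ∃ C > (0 : ℝ),
            KRApprox.HasRationalApprox (fun j => 1 + C₇ * δ j) m τ C
              (KRApprox.transport fρ fπ) ∧
            KRApprox.HasRationalApprox (fun j => 1 + C₇ * δ j) m τ C
              (KRApprox.invTransport fρ fπ) := by
  have hL : 0 < L := hM.trans hML
  refine ⟨M ^ 2 / (200 * L), by positivity, M ^ 2 / (100 * L ^ 2), by positivity,
    fun d hd δ hδ fρ fπ hρ hπ => ?_⟩
  obtain ⟨a, b, h⟩ := hρ.exists_transportData hπ hM hML hδ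
  refine ⟨KRApprox.isMonotoneTriangularBijection_transport h.hasCondCDF_source
    h.hasCondCDF_target, fun m τ hτ0 hτ1 => ?_⟩
  have hinverse : ∀ k, ∃ R, KRApprox.RootExtension (fun j => M ^ 2 / (100 * L ^ 2) * δ j)
      (KRApprox.invTransport fρ fπ) k R := fun k =>
    (h.symm.exists_rootExtension k).imp fun R hR => hR.congr fun y hy =>
      KRApprox.invTransport_eq h.hasCondCDF_source h.hasCondCDF_target hy
  obtain ⟨C, hC, hT⟩ := KRApprox.exists_hasRationalApprox hd h.smallRadius_pos
    h.exists_rootExtension m hτ0 hτ1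
  obtain ⟨C', _, hS⟩ := KRApprox.exists_hasRationalApprox hd h.smallRadius_pos hinverse m hτ0 hτ1
  exact ⟨max C C', lt_max_of_lt_left hC, hT.mono (le_max_left _ _), hS.mono (le_max_right _ _)⟩
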